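/- **Setting: wells and potential.** Let $\delta_0>0$. Let $\mathfrak m_\pm\subset\mathbb R^n$ be disjoint smooth closed (compact, without boundary) connected embedded hypersurfaces enclosing disjoint bounded domains $U_\pm$ (so $\partial U_\pm=\mathfrak m_\pm$), put $\mathfrak m=\mathfrak m_+\cup\mathfrak m_-$ and $\mathrm{dist}_{\mathfrak m}=\mathrm{dist}(\mathfrak m_+,\mathfrak m_-)$, and suppose that the nearest-point projection onto $\mathfrak m$ is well defined and smooth on the $2\delta_0$-neighbourhood of $\mathfrak m$. Let $F(\mathbf u)=f(\mathrm{dist}(\mathbf u,\mathfrak m)^2)$, where $F$ is of class $C^2$ on $\mathbb R^n$, $f$ is of class $C^2$ and positive on $(0,\infty)$, $c_1s\le f(s)\le c_2s$ for $0\le s\le\delta_0^2$, $f(s)=c_3$ for $s\ge\delta_0^2$ and $\lim_{s\downarrow0}f(s)/s=c_4$, with positive constants $c_1,\dots,c_4$. Let $\mathrm d_{\mathfrak m_\pm}$ be the signed distance to $\mathfrak m_\pm$, positive in $U_\pm$ and nonpositive outside, $c_F=2\int_0^{\mathrm{dist}_{\mathfrak m}/2}\sqrt{2f(\lambda^2)}\,d\lambda$,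 and $$\mathrm d_F(\mathbf u)=\begin{cases}\int_0^{|\mathrm d_{\mathfrak m_-}(\mathbf u)|}\sqrt{2f(\lambda^2)}\,d\lambda&\text{if }\mathrm{dist}(\mathbf u,\mathfrak m_-)\le\frac12\mathrm{dist}_{\mathfrak m},\\ c_F+\int_0^{\mathrm d_{\mathfrak m_+}(\mathbf u)}\sqrt{2f(\lambda^2)}\,d\lambda&\text{if }\mathbf u\in U_+\text{ or }\mathrm{dist}(\mathbf u,\mathfrak m_+)\le\frac12\mathrm{dist}_{\mathfrak m},\\ \frac12c_F&\text{otherwise.}\end{cases}$$ **Setting: interface.** Let $T>0$ and let $\Sigma_t$, $t\in[0,T]$, be a smoothly evolving closed hypersurface in $\mathbb R^d$ moving by mean curvature flow, $\Sigma_t$ being the boundary of a bounded open set $D_t$. Let $\mathrm d_\Sigma(x,t)$ be the signed distance to $\Sigma_t$, positive in $D_t$; "smoothly evolving" means that $\mathrm d_\Sigma$ is continuous on $\mathbb R^d\times[0,T]$ and smooth on the tube $\{|\mathrm d_\Sigma|<4\delta_0\}$, and mean curvature flow means that the normal velocity $-\partial_t\mathrm d_\Sigma$ equals the mean curvature $-\Delta\mathrm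 d_\Sigma$ on $\Sigma_t$ for $t\in(0,T)$ (inner normal $\nabla\mathrm d_\Sigma$). Put $$\boldsymbol\xi=\phi\Big(\frac{\mathrm d_\Sigma}{\delta_0}\Big)\nabla\mathrm d_\Sigma,\qquad \mathbf H(x,t)=-\Delta\mathrm d_\Sigma(P_\Sigma(x,t),t)\,\eta_0(x,t)\,\nabla\mathrm d_\Sigma(x,t),\qquad P_\Sigma(x,t)=x-\mathrm d_\Sigma\nabla\mathrm d_\Sigma .$$ Here $\phi\ge0$ is a smooth even function on $\mathbb R$, nonincreasing on $[0,1]$, with $\phi>0$ on $(-1,1)$, $\phi=0$ off $(-1,1)$ and $1-4r^2\le\phi(r)\le1-\frac12r^2$ for $|r|\le\frac12$; and $\eta_0$ is smooth on $\mathbb R^d\times[0,T]$, for each $t$ the support of $\eta_0(\cdot,t)$ lies in $\{|\mathrm d_\Sigma(\cdot,t)|<2\delta_0\}$, and $\eta_0=1$ where $|\mathrm d_\Sigma|<\delta_0$. **Setting: solutions.** Let $\Omega\subset\mathbb R^d$ be a bounded open set such that, for all $t\in[0,T]$, $\Sigma_t\subset\Omega$ has distance at least $\delta_0$ from $\partial\Omega$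 and $\operatorname{supp}\eta_0(\cdot,t)\subset\Omega$. Let $\mathbf g:\overline\Omega\to\mathfrak m_-$ be smooth and $\varepsilon>0$. Let $\mathbf u_\varepsilon:\overline\Omega\times(0,T)\to\mathbb R^n$ be a solution of $$\partial_t\mathbf u_\varepsilon=\Delta\mathbf u_\varepsilon-\varepsilon^{-2}\partial F(\mathbf u_\varepsilon)\ \text{ in }\Omega\times(0,T),\qquad \mathbf u_\varepsilon=\mathbf g\ \text{ on }\partial\Omega\times(0,T),$$ that is, $\mathbf u_\varepsilon$ is continuous on $\overline\Omega\times(0,T)$, of class $C^1$ in $\Omega\times(0,T)$ and $C^2$ in $x$, satisfies both equations pointwise, and belongs to $C((0,T);H^1(\Omega))\cap H^1_{loc}((0,T);L^2(\Omega))$; its initial value is arbitrary. Let $\psi_\varepsilon=\mathrm d_F\circ\mathbf u_\varepsilon$ and $$E_\varepsilon[\mathbf u_\varepsilon|\Sigma](t)=\int_\Omega\Big(\frac\varepsilon2|\nabla\mathbf u_\varepsilon|^2+\frac1\varepsilon F(\mathbf u_\varepsilon)-\boldsymbol\xi\cdot\nabla\psi_\varepsilon\Big)(x,t)\,dx,$$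 $$\mathbf H_\varepsilon=-\Big(\varepsilon\Delta\mathbf u_\varepsilon-\frac1\varepsilon\partial F(\mathbf u_\varepsilon)\Big)\cdot\frac{\nabla\mathbf u_\varepsilon}{|\nabla\mathbf u_\varepsilon|}\ \text{ if }\nabla\mathbf u_\varepsilon\ne0,\qquad\mathbf H_\varepsilon=0\ \text{ otherwise}.$$ Finally let $\partial\mathrm d_F(\mathbf u_\varepsilon)(x,t)$ be the generalized gradient: the derivative at $\mathbf u_\varepsilon(x,t)$ of the restriction of $\mathrm d_F$ to the affine space $\mathbf u_\varepsilon(x,t)+\operatorname{span}\{\partial_t\mathbf u_\varepsilon,\partial_1\mathbf u_\varepsilon,\dots,\partial_d\mathbf u_\varepsilon\}(x,t)$, composed with the orthogonal projection onto this span (it exists for a.e. $(x,t)$). **Proposition.** There is a constant $C>0$ depending only on the interface (on $(\Sigma_t)_{t\in[0,T]}$ and on $\delta_0,\phi,\eta_0$), and not on $\Omega,n,\mathfrak m_\pm,f,\mathbf g,\varepsilon,\mathbf u_\varepsilon$ or $t$, such that for every such solution: the integrand of $E_\varepsilon[\mathbf u_\varepsilon|\Sigma](t)$ is integrable for every $t\in(0,T)$,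 the function $t\mapsto E_\varepsilon[\mathbf u_\varepsilon|\Sigma](t)$ is absolutely continuous on every compact subinterval of $(0,T)$, and for almost every $t\in(0,T)$ it is differentiable at $t$, the three integrands below are integrable on $\Omega$, and $$\frac{d}{dt}E_\varepsilon[\mathbf u_\varepsilon|\Sigma]+\frac1{2\varepsilon}\int_\Omega\big(\varepsilon^2|\partial_t\mathbf u_\varepsilon|^2-|\mathbf H_\varepsilon|^2\big)dx+\frac1{2\varepsilon}\int_\Omega\big|\mathbf H_\varepsilon-\varepsilon|\nabla\mathbf u_\varepsilon|\mathbf H\big|^2dx+\frac1{2\varepsilon}\int_\Omega\big|\varepsilon\partial_t\mathbf u_\varepsilon-(\nabla\cdot\boldsymbol\xi)\,\partial\mathrm d_F(\mathbf u_\varepsilon)\big|^2dx\le C\,E_\varepsilon[\mathbf u_\varepsilon|\Sigma].$$ -/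

import Mathlib

open Set Filter Topology MeasureTheory
open scoped ContDiff

noncomputable section

namespace VectorialAllenCahn

/-- Euclidean space of dimension `k`. -/
abbrev E (k : ℕ) := EuclideanSpace ℝ (Fin k)

/-! ### Distances -/

/-- Signed distance to the boundary of `U`: positive in `U`, nonpositive outside. -/
def signedDist {k : ℕ} (U : Set (E k)) (x : E k) : ℝ :=
  open Classical in
  if x ∈ U then Metric.infDist x (frontier U) else -Metric.infDist x (frontier U)

/-- The distance between two sets. -/
def setDist {k : ℕ} (A B : Set (E k)) : ℝ :=
  sInf {r : ℝ | ∃ p ∈ A, ∃ q ∈ B, r = dist p q}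

/-! ### Calculus -/

/-- The partial derivative in the `i`-th coordinate direction. -/
def partialD {d : ℕ} {G : Type*} [NormedAddCommGroup G] [NormedSpace ℝ G]
    (v : E d → G) (i : Fin d) (x : E d) : G :=
  fderiv ℝ v x (EuclideanSpace.single i 1)

/-- The Euclidean (Frobenius) norm of the Jacobian matrix of `v` at `x`. -/
def gradNorm {d : ℕ} {G : Type*} [NormedAddCommGroup G] [NormedSpace ℝ G]
    (v : E d → G) (x : E d) : ℝ :=
  Real.sqrt (∑ i, ‖partialD v i x‖ ^ 2)

/-- The divergence of a vector field. -/
def divergence {d : ℕ} (X : E d → E d) (x : E d) : ℝ :=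
  ∑ i, (partialD X i x) i

/-- The time derivative of a map `(t, x) ↦ u t x`. -/
def timeD {d : ℕ} {G : Type*} [NormedAddCommGroup G] [NormedSpace ℝ G]
    (u : ℝ → E d → G) (t : ℝ) (x : E d) : G :=
  deriv (fun s => u s x) t

/-! ### The wells and the potential -/

/-- `M` is a smooth closed (compact, without boundary) connected hypersurface, embedded in
Euclidean space. -/
def IsClosedHypersurface {n : ℕ} (M : Set (E n)) : Prop :=
  IsCompact M ∧ IsConnected M ∧
    ∀ p ∈ M, ∃ (V : Set (E n)) (h : E n → ℝ), IsOpen V ∧ p ∈ V ∧ ContDiffOn ℝ ∞ h V ∧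
      (∀ x ∈ V, fderiv ℝ h x ≠ 0) ∧ M ∩ V = {x ∈ V | h x = 0}

/-- `U` is the bounded open domain enclosed by `M`. -/
def IsEnclosedBy {n : ℕ} (U M : Set (E n)) : Prop :=
  IsOpen U ∧ IsConnected U ∧ Bornology.IsBounded U ∧ frontier U = M

/-- The nearest-point projection onto `M` is well defined and smooth on the `r`-neighbourhood
of `M`. -/
def HasSmoothProjection {n : ℕ} (M : Set (E n)) (r : ℝ) : Prop :=
  ∃ P : E n → E n, ContDiffOn ℝ ∞ P (Metric.thickening r M) ∧
    ∀ x ∈ Metric.thickening r M, {p ∈ M | dist x p = Metric.infDist x M} = {P x}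

/-- A pair of disjoint wells `m₊`, `m₋` (smooth closed connected hypersurfaces enclosing the
disjoint bounded domains `U₊`, `U₋`), together with a profile `f` such that the potential
`F = f ∘ dist(·, m)²`, `m = m₊ ∪ m₋`, is a double equal-well potential. -/
structure WellPotential (n : ℕ) (δ₀ : ℝ) where
  mPlus : Set (E n)
  mMinus : Set (E n)
  UPlus : Set (E n)
  UMinus : Set (E n)
  f : ℝ → ℝ
  hypersurface_plus : IsClosedHypersurface mPlus
  hypersurface_minus : IsClosedHypersurface mMinus
  disjoint_wells : Disjoint mPlus mMinus
  enclosed_plus : IsEnclosedBy UPlus mPlus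
  enclosed_minus : IsEnclosedBy UMinus mMinus
  disjoint_domains : Disjoint UPlus UMinus
  /-- `δ₀` is small compared with the geometry of the wells -/
  projection : HasSmoothProjection (mPlus ∪ mMinus) (2 * δ₀)
  f_smooth : ContDiffOn ℝ 2 f (Ioi 0)
  f_pos : ∀ s, 0 < s → 0 < f s
  f_linear : ∃ c₁ c₂ : ℝ, 0 < c₁ ∧ 0 < c₂ ∧ ∀ s ∈ Icc 0 (δ₀ ^ 2), c₁ * s ≤ f s ∧ f s ≤ c₂ * s
  f_const : ∃ c₃ : ℝ, 0 < c₃ ∧ ∀ s, δ₀ ^ 2 ≤ s → f s = c₃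
  f_limit : ∃ c₄ : ℝ, 0 < c₄ ∧ Tendsto (fun s => f s / s) (𝓝[>] 0) (𝓝 c₄)
  F_smooth : ContDiff ℝ 2 fun u : E n => f (Metric.infDist u (mPlus ∪ mMinus) ^ 2)

namespace WellPotential

variable {n : ℕ} {δ₀ : ℝ} (W : WellPotential n δ₀)

/-- The potential `F`. -/
def F (u : E n) : ℝ := W.f (Metric.infDist u (W.mPlus ∪ W.mMinus) ^ 2)

/-- The distance `dist_m` between the two wells. -/
def wellDist : ℝ := setDist W.mPlus W.mMinus

/-- The surface tension coefficient `c_F`. -/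
def cF : ℝ := 2 * ∫ l in (0 : ℝ)..(W.wellDist / 2), Real.sqrt (2 * W.f (l ^ 2))

/-- The quasi-distance function `d_F`. -/
def dF (u : E n) : ℝ :=
  open Classical in
  if Metric.infDist u W.mMinus ≤ W.wellDist / 2 then
    ∫ l in (0 : ℝ)..|signedDist W.UMinus u|, Real.sqrt (2 * W.f (l ^ 2))
  else if u ∈ W.UPlus ∨ Metric.infDist u W.mPlus ≤ W.wellDist / 2 then
    W.cF + ∫ l in (0 : ℝ)..(signedDist W.UPlus u), Real.sqrt (2 * W.f (l ^ 2))
  else W.cF / 2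

end WellPotential

/-! ### The evolving interface

An interface is given by the family `D t` of domains that it encloses: `Σ_t = frontier (D t)`, and
the signed distance `d_Σ(·, t) = signedDist (D t)` is positive inside. -/

/-- On `[0, T]` the sets `Σ_t = frontier (D t)` form a smoothly evolving closed hypersurface that
moves by mean curvature flow, and `4 δ₀` is the width of a tubular neighbourhood of it on which
the signed distance is smooth.
With the inner normal `n = ∇ d_Σ`, the normal velocity of `Σ_t` is `-∂ₜ d_Σ` and its mean
curvature vector is `-(Δ d_Σ) n`. -/
structure IsMeanCurvatureFlow {d : ℕ} (T δ₀ : ℝ) (D : ℝ → Set (E d)) : Prop where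
  isOpen : ∀ t ∈ Icc 0 T, IsOpen (D t)
  isBounded : ∀ t ∈ Icc 0 T, Bornology.IsBounded (D t)
  nonempty : ∀ t ∈ Icc 0 T, (frontier (D t)).Nonempty
  /-- the interface moves continuously in time (no sudden jump, birth or loss of a piece) -/
  continuous : ContinuousOn (fun p : ℝ × E d => signedDist (D p.1) p.2) (Icc 0 T ×ˢ univ)
  smooth : ContDiffOn ℝ ∞ (fun p : ℝ × E d => signedDist (D p.1) p.2)
    {p | p.1 ∈ Icc 0 T ∧ |signedDist (D p.1) p.2| < 4 * δ₀}
  flow : ∀ t ∈ Ioo 0 T, ∀ x ∈ frontier (D t),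
    -timeD (fun s => signedDist (D s)) t x = -Laplacian.laplacian (signedDist (D t)) x

/-- The interface stays inside `Ω`, at distance at least `δ₀` from `∂Ω`. -/
def InterfaceInside {d : ℕ} (T δ₀ : ℝ) (D : ℝ → Set (E d)) (Ω : Set (E d)) : Prop :=
  ∀ t ∈ Icc 0 T, ∀ x ∈ frontier (D t), x ∈ Ω ∧ ∀ y ∈ frontier Ω, δ₀ ≤ dist x y

/-- The truncation profile `φ`. -/
structure IsProfile (φ : ℝ → ℝ) : Prop where
  smooth : ContDiff ℝ ∞ φ
  even : ∀ r, φ (-r) = φ r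
  nonneg : ∀ r, 0 ≤ φ r
  antitone : AntitoneOn φ (Icc 0 1)
  pos : ∀ r, |r| < 1 → 0 < φ r
  zero : ∀ r, 1 ≤ |r| → φ r = 0
  bounds : ∀ r, |r| ≤ 1 / 2 → 1 - 4 * r ^ 2 ≤ φ r ∧ φ r ≤ 1 - r ^ 2 / 2

/-- The cut-off `η₀`: smooth, supported in the `2 δ₀`-neighbourhood of `Σ_t` and equal to `1` in
its `δ₀`-neighbourhood. -/
structure IsTubeCutoff {d : ℕ} (T δ₀ : ℝ) (D : ℝ → Set (E d)) (η₀ : ℝ → E d → ℝ) : Prop where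
  smooth : ContDiffOn ℝ ∞ (fun p : ℝ × E d => η₀ p.1 p.2) (Icc 0 T ×ˢ univ)
  support : ∀ t ∈ Icc 0 T, tsupport (η₀ t) ⊆ {x | |signedDist (D t) x| < 2 * δ₀}
  one : ∀ t ∈ Icc 0 T, ∀ x, |signedDist (D t) x| < δ₀ → η₀ t x = 1

/-- The extended normal field `ξ = φ(d_Σ / δ₀) ∇ d_Σ`. -/
def xi {d : ℕ} (δ₀ : ℝ) (φ : ℝ → ℝ) (D : ℝ → Set (E d)) (t : ℝ) (x : E d) : E d :=
  φ (signedDist (D t) x / δ₀) • gradient (signedDist (D t)) x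

/-- The nearest-point projection `P_Σ(x, t) = x - d_Σ ∇ d_Σ`. -/
def proj {d : ℕ} (D : ℝ → Set (E d)) (t : ℝ) (x : E d) : E d :=
  x - signedDist (D t) x • gradient (signedDist (D t)) x

/-- The extended mean curvature vector `H = κ ∇ d_Σ`, `κ = -Δ d_Σ(P_Σ(x, t)) η₀`. -/
def curvH {d : ℕ} (η₀ : ℝ → E d → ℝ) (D : ℝ → Set (E d)) (t : ℝ) (x : E d) : E d :=
  (-Laplacian.laplacian (signedDist (D t)) (proj D t x) * η₀ t x) •
    gradient (signedDist (D t)) x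

/-! ### The vectorial Allen-Cahn system -/

/-- The boundary datum: a smooth map from the closure of `Ω` to `m₋`. -/
def IsBoundaryDatum {d n : ℕ} {δ₀ : ℝ} (W : WellPotential n δ₀) (Ω : Set (E d))
    (g : E d → E n) : Prop :=
  ContDiffOn ℝ ∞ g (closure Ω) ∧ ∀ x ∈ closure Ω, g x ∈ W.mMinus

/-- `u` solves `∂ₜ u = Δ u - ε⁻² ∂F(u)` in `Ω × (0, T)` with `u = g` on `∂Ω × (0, T)`:
`u` is a classical solution in the interior, attains the boundary datum continuously, and
`u ∈ C((0,T); H¹(Ω)) ∩ H¹_loc((0,T); L²(Ω))`. -/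
structure IsSolution {d n : ℕ} {δ₀ : ℝ} (W : WellPotential n δ₀) (Ω : Set (E d)) (T ε : ℝ)
    (g : E d → E n) (u : ℝ → E d → E n) : Prop where
  contDiff_one : ContDiffOn ℝ 1 (fun p : ℝ × E d => u p.1 p.2) (Ioo 0 T ×ˢ Ω)
  contDiff_two : ∀ t ∈ Ioo 0 T, ContDiffOn ℝ 2 (u t) Ω
  equation : ∀ t ∈ Ioo 0 T, ∀ x ∈ Ω,
    timeD u t x = Laplacian.laplacian (u t) x - (ε ^ 2)⁻¹ • gradient W.F (u t x)
  continuous : ContinuousOn (fun p : ℝ × E d => u p.1 p.2) (Ioo 0 T ×ˢ closure Ω)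
  boundary : ∀ t ∈ Ioo 0 T, ∀ x ∈ frontier Ω, u t x = g x
  grad_integrable : ∀ t ∈ Ioo 0 T, IntegrableOn (fun x => gradNorm (u t) x ^ 2) Ω
  grad_continuous : ∀ t₀ ∈ Ioo 0 T,
    Tendsto (fun t => ∫ x in Ω, gradNorm (u t - u t₀) x ^ 2) (𝓝 t₀) (𝓝 0)
  time_integrable : ∀ a b, 0 < a → a < b → b < T →
    IntegrableOn (fun p : ℝ × E d => ‖timeD u p.1 p.2‖ ^ 2) (Ioo a b ×ˢ Ω)

/-- The space spanned by all first order derivatives `∂ₜ u, ∂₁ u, …, ∂_d u` at `(t, x)`. -/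
def tangentSpan {d n : ℕ} (u : ℝ → E d → E n) (t : ℝ) (x : E d) : Submodule ℝ (E n) :=
  Submodule.span ℝ (insert (timeD u t x) (range fun i => partialD (u t) i x))

/-- The generalized differential of `Φ` at `u(x, t)`: the derivative at `u(x, t)` of the
restriction of `Φ` to the affine space `u(x, t) + span{∂ₜ u, ∂₁ u, …, ∂_d u}`, composed with the
orthogonal projection onto this span, and read as a vector. -/
def genGradient {d n : ℕ} (Φ : E n → ℝ) (u : ℝ → E d → E n) (t : ℝ) (x : E d) : E n :=
  (InnerProductSpace.toDual ℝ (E n)).symm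
    ((fderiv ℝ (fun v : tangentSpan u t x => Φ (u t x + (v : E n))) 0).comp
      (tangentSpan u t x).orthogonalProjectionOnto)

/-- The phase-field mean curvature vector `H_ε`. -/
def curvHeps {d n : ℕ} {δ₀ : ℝ} (W : WellPotential n δ₀) (ε : ℝ) (u : ℝ → E d → E n)
    (t : ℝ) (x : E d) : E d :=
  open Classical in
  if gradNorm (u t) x = 0 then 0
  else WithLp.toLp 2 fun i =>
    -(inner ℝ (ε • Laplacian.laplacian (u t) x - ε⁻¹ • gradient W.F (u t x))
        (partialD (u t) i x)) / gradNorm (u t) x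

/-- The function `ψ_ε = d_F ∘ u_ε`. -/
def psi {d n : ℕ} {δ₀ : ℝ} (W : WellPotential n δ₀) (u : ℝ → E d → E n) (t : ℝ) (x : E d) : ℝ :=
  W.dF (u t x)

/-- The integrand of the modulated energy. For `u t` of class `C¹` the function `ψ_ε(·, t)` is
locally Lipschitz, so that its pointwise gradient is its distributional gradient. -/
def energyDensity {d n : ℕ} {δ₀ : ℝ} (W : WellPotential n δ₀) (φ : ℝ → ℝ) (D : ℝ → Set (E d))
    (ε : ℝ) (u : ℝ → E d → E n) (t : ℝ) (x : E d) : ℝ :=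
  ε / 2 * gradNorm (u t) x ^ 2 + 1 / ε * W.F (u t x)
    - inner ℝ (xi δ₀ φ D t x) (gradient (psi W u t) x)

/-- The modulated energy (relative entropy) `E_ε[u_ε | Σ](t)`. -/
def modulatedEnergy {d n : ℕ} {δ₀ : ℝ} (W : WellPotential n δ₀) (φ : ℝ → ℝ)
    (D : ℝ → Set (E d)) (Ω : Set (E d)) (ε : ℝ) (u : ℝ → E d → E n) (t : ℝ) : ℝ :=
  ∫ x in Ω, energyDensity W φ D ε u t x

end VectorialAllenCahn

end

noncomputable section

namespace VectorialAllenCahn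

/-! ### The signed distance -/

section SignedDistance

variable {k : ℕ} {U : Set (E k)}

/-! Write ψ = d_F(u), w = ∂d_F(u), c = ∇·ξ. Along a solution the energy has time derivative ∫
(-ε|∂ₜu|² + ∂ₜc ψ + c ∂ₜψ). Indeed ξ has compact support in Ω, so -∫ ξ·∇ψ = ∫ c ψ, and the rest of
the energy dissipates as in the Allen-Cahn gradient flow (`relEnergy_evolution`). Three integrals
vanish and may be subtracted: that of ∂ₜξ·∇ψ + ∂ₜc ψ, by integration by parts; that of ∇ψ against
the commutator field of ξ and H, which is divergence free; and that of the divergence of the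
energy-stress tensor contracted with H. Once the three quadratic terms of the claim are added, what
is left is algebraic in ∇u and w at a single point, and `pointwise_dissipation_le` bounds it by a
constant times the energy density.

That bound has two sources. The first is the sharp estimate |w|² ≤ 2F(u): the density then controls
both the squared defects |√ε ∂ᵢu - ξᵢ w/√ε|² and (1 - |ξ|)F(u)/ε (`quadratic_estimate`). The second
is the geometry of the interface, collected in `IsCalibration` and proved in `exists_isCalibration`:
ξ is transported by H, H is parallel to ξ and not stretched along it, and (∇·ξ + H·ξ)² ≤ C(1 - |ξ|).
Every remaining term is then the density times a bounded factor, quadratic in the defects, or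
carries the factor 1 - |ξ|.

Little regularity is available. The function d_F is only Lipschitz. By `dF_eq` it is, up to a
constant, a sum of two one-variable primitives, at least one of which keeps its value between nearby
points; so its local slope is at most √(2F) and not twice that (`eventually_abs_dF_sub_le`).
Rademacher's theorem makes ψ differentiable almost everywhere in space-time, and there
`genGradient_spec` gives the chain rule and the bound for w. Moreover ∂Ω is arbitrary and ∂ₜ∇u need
not exist. Green's formula is therefore obtained by truncating a function that vanishes on ∂Ω
(`setIntegral_green`), and the evolution of the Dirichlet energy by convexity and difference
quotients in both time directions (`dirichlet_sub_eq`). -/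

lemma abs_signedDist (x : E k) : |signedDist U x| = Metric.infDist x (frontier U) := by
  unfold signedDist
  split_ifs <;> simp [abs_of_nonneg, Metric.infDist_nonneg]

/-- A segment that avoids the frontier would be disconnected by the interior of `U` and the interior
of its complement. No regularity of `U` is involved. -/
lemma exists_mem_frontier_dist_add {x y : E k} (hx : x ∈ U) (hy : y ∉ U) :
    ∃ z ∈ frontier U, dist x z + dist z y = dist x y := by
  suffices ∃ z ∈ segment ℝ x y, z ∈ frontier U by
    obtain ⟨z, hz, hzU⟩ := this
    exact ⟨z, hzU, dist_add_dist_of_mem_segment hz⟩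
  by_contra! h
  have hsub : segment ℝ x y ⊆ interior U ∪ interior Uᶜ := fun z hz => by
    rw [← compl_frontier_eq_union_interior]
    exact h z hz
  have hx' : x ∈ interior U := (hsub (left_mem_segment ℝ x y)).resolve_right
    fun h' => interior_subset h' hx
  have hy' : y ∈ interior Uᶜ := (hsub (right_mem_segment ℝ x y)).resolve_left
    fun h' => hy (interior_subset h')
  obtain ⟨z, -, hz, hz'⟩ := (convex_segment (𝕜 := ℝ) x y).isPreconnected _ _ isOpen_interior
    isOpen_interior hsub ⟨x, left_mem_segment ℝ x y, hx'⟩ ⟨y, right_mem_segment ℝ x y, hy'⟩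
  exact interior_subset hz' (interior_subset hz)

/-- Only points on opposite sides need an argument beyond the Lipschitz bound for the distance: the
segment joining them crosses the frontier, so the two distances add up to at most its length. -/
lemma abs_signedDist_sub_le (x y : E k) : |signedDist U x - signedDist U y| ≤ dist x y := by
  have key : ∀ a b : E k, Metric.infDist a (frontier U) ≤ Metric.infDist b (frontier U) + dist a b :=
    fun a b => Metric.infDist_le_infDist_add_dist
  have h1 := key x y
  have h2 := key y x
  rw [dist_comm y x] at h2
  have n1 := Metric.infDist_nonneg (x := x) (s := frontier U)
  have n2 := Metric.infDist_nonneg (x := y) (s := frontier U)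
  have cross : ∀ a b : E k, a ∈ U → b ∉ U →
      Metric.infDist a (frontier U) + Metric.infDist b (frontier U) ≤ dist a b := by
    intro a b ha hb
    obtain ⟨z, hz, h⟩ := exists_mem_frontier_dist_add ha hb
    have e1 := Metric.infDist_le_dist_of_mem (x := a) hz
    have e2 := Metric.infDist_le_dist_of_mem (x := b) hz
    rw [dist_comm b z] at e2
    linarith
  unfold signedDist
  rw [abs_le]
  split_ifs with ha hb hb
  · constructor <;> linarith
  · have := cross x y ha hb
    constructor <;> linarith
  · have := cross y x hb ha
    rw [dist_comm] at this
    constructor <;> linarith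
  · constructor <;> linarith

lemma lipschitzWith_signedDist : LipschitzWith 1 (signedDist U) :=
  LipschitzWith.of_dist_le_mul fun x y => by
    simpa [Real.dist_eq] using abs_signedDist_sub_le (U := U) x y

lemma signedDist_pos (hU : IsOpen U) (hne : (frontier U).Nonempty) {x : E k} (hx : x ∈ U) :
    0 < signedDist U x := by
  have : x ∉ frontier U := fun h => by
    rw [hU.frontier_eq] at h
    exact h.2 hx
  simpa [signedDist, hx] using (isClosed_frontier.notMem_iff_infDist_pos hne).1 this

lemma mem_frontier_iff_signedDist_eq_zero (hne : (frontier U).Nonempty) {x : E k} :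
    x ∈ frontier U ↔ signedDist U x = 0 := by
  rw [isClosed_frontier.mem_iff_infDist_zero hne, ← abs_signedDist, abs_eq_zero]

end SignedDistance

/-! ### The quasi-distance -/

namespace WellPotential

variable {n : ℕ} {δ₀ : ℝ} (W : WellPotential n δ₀)

/-- The slope `√(2 f(λ²))` of the one-dimensional profile. -/
def slope (l : ℝ) : ℝ := Real.sqrt (2 * W.f (l ^ 2))

/-- The primitive of the slope. -/
def prim (r : ℝ) : ℝ := ∫ l in (0 : ℝ)..r, W.slope l

lemma f_zero : W.f 0 = 0 := by
  obtain ⟨c₁, c₂, h1, h2, h⟩ := W.f_linear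
  have := h 0 ⟨le_rfl, sq_nonneg _⟩
  simp at this
  linarith [this.1, this.2]

lemma f_nonneg {s : ℝ} (hs : 0 ≤ s) : 0 ≤ W.f s := by
  rcases hs.eq_or_lt with rfl | h
  · exact W.f_zero.ge
  · exact (W.f_pos s h).le

variable {W} in
lemma slope_neg (l : ℝ) : W.slope (-l) = W.slope l := by simp [slope]

lemma slope_abs (l : ℝ) : W.slope |l| = W.slope l := by simp [slope]

lemma slope_nonneg (l : ℝ) : 0 ≤ W.slope l := Real.sqrt_nonneg _

/-- The origin is the only delicate point, since `f` is regular on the open half-line only; there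
the linear bounds on `f` squeeze it to zero. -/
lemma continuous_slope (hδ : 0 < δ₀) : Continuous W.slope := by
  refine Real.continuous_sqrt.comp (continuous_const.mul ?_)
  rw [continuous_iff_continuousAt]
  intro l
  by_cases hl : l = 0
  · subst hl
    obtain ⟨c₁, c₂, h1, h2, h⟩ := W.f_linear
    have e : Tendsto (fun l : ℝ => c₂ * l ^ 2) (𝓝 0) (𝓝 0) := by
      have : Continuous fun l : ℝ => c₂ * l ^ 2 := by fun_prop
      simpa using this.tendsto 0
    have : ∀ᶠ l : ℝ in 𝓝 0, l ^ 2 ≤ δ₀ ^ 2 := by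
      have : Continuous fun l : ℝ => l ^ 2 := by fun_prop
      exact (this.tendsto 0).eventually (ge_mem_nhds (by simpa using pow_pos hδ 2))
    unfold ContinuousAt
    simp only [ne_eq, OfNat.ofNat_ne_zero, not_false_eq_true, zero_pow, W.f_zero]
    refine tendsto_of_tendsto_of_tendsto_of_le_of_le' tendsto_const_nhds e ?_ ?_
    · exact Eventually.of_forall fun l => W.f_nonneg (sq_nonneg _)
    · filter_upwards [this] with l hl using (h _ ⟨sq_nonneg _, hl⟩).2
  · have h1 : ContinuousAt W.f (l ^ 2) :=
      (W.f_smooth.continuousOn).continuousAt (Ioi_mem_nhds (by positivity))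
    exact h1.comp (f := fun l : ℝ => l ^ 2) (by fun_prop)

lemma exists_slope_le (hδ : 0 < δ₀) : ∃ M : ℝ, 0 ≤ M ∧ ∀ l, W.slope l ≤ M := by
  obtain ⟨c₃, h3, h⟩ := W.f_const
  obtain ⟨M, hM⟩ := (isCompact_Icc (a := -δ₀) (b := δ₀)).exists_bound_of_continuousOn
    (W.continuous_slope hδ).continuousOn
  refine ⟨max M (Real.sqrt (2 * c₃)), le_max_of_le_right (Real.sqrt_nonneg _), fun l => ?_⟩
  by_cases hl : |l| ≤ δ₀
  · exact le_max_of_le_left ((le_abs_self _).trans (hM l (abs_le.1 hl)))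
  · refine le_max_of_le_right ?_
    rw [slope, h]
    rw [← sq_abs l]
    exact pow_le_pow_left₀ hδ.le (not_le.1 hl).le 2

lemma hasDerivAt_prim (hδ : 0 < δ₀) (r : ℝ) : HasDerivAt W.prim (W.slope r) r :=
  (W.continuous_slope hδ).integral_hasStrictDerivAt 0 r |>.hasDerivAt

lemma prim_neg (r : ℝ) : W.prim (-r) = -W.prim r := by
  have := intervalIntegral.integral_comp_neg (a := 0) (b := r) W.slope
  simp only [slope_neg, neg_zero] at this
  rw [prim, prim, this, intervalIntegral.integral_symm]

lemma abs_prim_sub_le (hδ : 0 < δ₀) {s : Set ℝ} (hs : Convex ℝ s) {M : ℝ}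
    (hM : ∀ l ∈ s, W.slope l ≤ M) {a b : ℝ} (ha : a ∈ s) (hb : b ∈ s) :
    |W.prim a - W.prim b| ≤ M * |a - b| := by
  have := hs.norm_image_sub_le_of_norm_hasDerivWithin_le (f := W.prim) (f' := W.slope) (C := M)
    (fun x _ => (W.hasDerivAt_prim hδ x).hasDerivWithinAt)
    (fun x hx => by rw [Real.norm_of_nonneg (W.slope_nonneg x)]; exact hM x hx) hb ha
  simpa [Real.norm_eq_abs] using this

/-- A chain rule for local slopes: `h` is 1-Lipschitz but may fail to be differentiable, so the
continuity of the slope of the primitive is used instead, at the price of an arbitrarily small `η`.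
-/
lemma eventually_abs_prim_sub_le (hδ : 0 < δ₀) {X : Type*} [PseudoMetricSpace X] {h : X → ℝ}
    (hh : ∀ x y, |h x - h y| ≤ dist x y) (x : X) {η : ℝ} (hη : 0 < η) :
    ∀ᶠ y in 𝓝 x, |W.prim (h y) - W.prim (h x)| ≤ (W.slope (h x) + η) * dist y x := by
  have hc : ∀ᶠ r in 𝓝 (h x), W.slope r < W.slope (h x) + η :=
    (W.continuous_slope hδ).continuousAt.eventually_lt_const (by linarith)
  obtain ⟨ρ, hρ, hball⟩ := Metric.eventually_nhds_iff_ball.1 hc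
  filter_upwards [Metric.ball_mem_nhds x hρ] with y hy
  have hy' : h y ∈ Metric.ball (h x) ρ := by
    rw [Metric.mem_ball, Real.dist_eq]
    exact (hh y x).trans_lt hy
  refine (W.abs_prim_sub_le hδ (convex_ball (h x) ρ) (fun l hl => (hball l hl).le) hy'
    (Metric.mem_ball_self hρ)).trans ?_
  exact mul_le_mul_of_nonneg_left (hh y x) (by linarith [W.slope_nonneg (h x)])

lemma wellDist_le_dist {p q : E n} (hp : p ∈ W.mPlus) (hq : q ∈ W.mMinus) :
    W.wellDist ≤ dist p q :=
  csInf_le ⟨0, by rintro r ⟨p, -, q, -, rfl⟩; exact dist_nonneg⟩ ⟨p, hp, q, hq, rfl⟩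

lemma mPlus_nonempty : W.mPlus.Nonempty := W.hypersurface_plus.2.1.nonempty

lemma mMinus_nonempty : W.mMinus.Nonempty := W.hypersurface_minus.2.1.nonempty

lemma wellDist_pos : 0 < W.wellDist := by
  obtain ⟨r, hr, h⟩ := Metric.exists_pos_forall_lt_edist W.hypersurface_plus.1
    W.hypersurface_minus.1.isClosed W.disjoint_wells
  obtain ⟨p, hp⟩ := W.mPlus_nonempty
  obtain ⟨q, hq⟩ := W.mMinus_nonempty
  refine lt_of_lt_of_le (NNReal.coe_pos.2 hr) (le_csInf ⟨_, p, hp, q, hq, rfl⟩ ?_)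
  rintro _ ⟨p, hp, q, hq, rfl⟩
  have := h p hp q hq
  rw [edist_nndist] at this
  rw [dist_nndist]
  exact_mod_cast this.le

lemma wellDist_le_infDist_add (u : E n) :
    W.wellDist ≤ Metric.infDist u W.mMinus + Metric.infDist u W.mPlus := by
  obtain ⟨p, hp, hp'⟩ := W.hypersurface_plus.1.exists_infDist_eq_dist W.mPlus_nonempty u
  obtain ⟨q, hq, hq'⟩ := W.hypersurface_minus.1.exists_infDist_eq_dist W.mMinus_nonempty u
  rw [hp', hq', dist_comm u q, add_comm]
  exact (W.wellDist_le_dist hp hq).trans (by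
    rw [dist_comm u p, dist_comm q u]; exact dist_triangle p u q)

lemma notMem_UPlus_of_mem_mMinus {q : E n} (hq : q ∈ W.mMinus) : q ∉ W.UPlus := by
  intro h
  rw [← W.enclosed_minus.2.2.2] at hq
  have : q ∈ closure W.UMinus := frontier_subset_closure hq
  obtain ⟨z, hz, hz'⟩ := mem_closure_iff.1 this _ W.enclosed_plus.1 h
  exact W.disjoint_domains.le_bot ⟨hz, hz'⟩

/-- The segment from `u` to its nearest point on `mMinus` must leave `UPlus` through `mPlus`,
because `mMinus` does not meet `UPlus`. -/
lemma wellDist_add_le_infDist {u : E n} (hu : u ∈ W.UPlus) :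
    W.wellDist + Metric.infDist u W.mPlus ≤ Metric.infDist u W.mMinus := by
  obtain ⟨q, hq, hq'⟩ := W.hypersurface_minus.1.exists_infDist_eq_dist W.mMinus_nonempty u
  obtain ⟨z, hz, h⟩ := exists_mem_frontier_dist_add hu (W.notMem_UPlus_of_mem_mMinus hq)
  rw [W.enclosed_plus.2.2.2] at hz
  have := W.wellDist_le_dist hz hq
  have := Metric.infDist_le_dist_of_mem (x := u) hz
  linarith

/-- Distance to the well `m₋`. -/
def distMinus (u : E n) : ℝ := Metric.infDist u W.mMinus

/-- Signed distance to the well `m₊`. -/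
def distPlus (u : E n) : ℝ := signedDist W.UPlus u

lemma abs_distPlus (u : E n) : |W.distPlus u| = Metric.infDist u W.mPlus := by
  rw [distPlus, abs_signedDist, W.enclosed_plus.2.2.2]

lemma wellDist_le_distMinus_sub (u : E n) : W.wellDist ≤ W.distMinus u - W.distPlus u := by
  by_cases hu : u ∈ W.UPlus
  · have := W.wellDist_add_le_infDist hu
    rw [← abs_distPlus] at this
    have := le_abs_self (W.distPlus u)
    unfold distMinus
    linarith
  · have := W.wellDist_le_infDist_add u
    have e : W.distPlus u = -Metric.infDist u W.mPlus := by
      rw [distPlus, signedDist, if_neg hu, W.enclosed_plus.2.2.2]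
    rw [e]
    unfold distMinus
    linarith

lemma wellDist_le_distMinus_add (u : E n) : W.wellDist ≤ W.distMinus u + |W.distPlus u| := by
  rw [abs_distPlus]
  exact W.wellDist_le_infDist_add u

lemma distMinus_nonneg (u : E n) : 0 ≤ W.distMinus u := Metric.infDist_nonneg

/-- The case distinction in the definition becomes a sum of primitives of two truncated 1-Lipschitz
distances. The inequalities between the two well distances ensure that in each case at least one
truncation is saturated; since the primitive is odd, its contribution then combines with the
constant. -/
lemma dF_eq (u : E n) : W.dF u = W.prim (min (W.distMinus u) (W.wellDist / 2))
    + W.prim (max (W.distPlus u) (-(W.wellDist / 2))) + W.prim (W.wellDist / 2) := by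
  have h1 := W.wellDist_le_distMinus_sub u
  have h2 := W.wellDist_le_distMinus_add u
  have hw := W.wellDist_pos
  have hcF : W.cF = 2 * W.prim (W.wellDist / 2) := rfl
  have key : ∀ r : ℝ, ∫ l in (0 : ℝ)..r, Real.sqrt (2 * W.f (l ^ 2)) = W.prim r := fun _ => rfl
  have hA : Metric.infDist u W.mMinus = W.distMinus u := rfl
  unfold dF
  simp only [key, hA]
  split_ifs with ha hb
  · have e : |signedDist W.UMinus u| = W.distMinus u := by
      rw [abs_signedDist, W.enclosed_minus.2.2.2, distMinus]
    rw [e, min_eq_left ha, max_eq_right, prim_neg]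
    · ring
    · linarith
  · push Not at ha
    rw [min_eq_right ha.le, max_eq_left, hcF]
    · simp only [distPlus]
      ring
    · rcases hb with hb | hb
      · have := signedDist_pos W.enclosed_plus.1
          (by rw [W.enclosed_plus.2.2.2]; exact W.mPlus_nonempty) hb
        unfold distPlus
        linarith
      · rw [← abs_distPlus] at hb
        linarith [neg_abs_le (W.distPlus u)]
  · push Not at ha hb
    have h3 : W.distPlus u ≤ 0 := by
      rw [distPlus, signedDist, if_neg hb.1]
      simp [Metric.infDist_nonneg]
    have h4 := hb.2
    rw [← abs_distPlus, abs_of_nonpos h3] at h4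
    rw [min_eq_right ha.le, max_eq_right (by linarith), prim_neg, hcF]
    ring

lemma abs_min_distMinus_sub_le (u v : E n) :
    |min (W.distMinus u) (W.wellDist / 2) - min (W.distMinus v) (W.wellDist / 2)| ≤ dist u v := by
  refine (abs_min_sub_min_le_max _ _ _ _).trans ?_
  have h1 : W.distMinus u ≤ W.distMinus v + dist u v := Metric.infDist_le_infDist_add_dist
  have h2 : W.distMinus v ≤ W.distMinus u + dist v u := Metric.infDist_le_infDist_add_dist
  rw [dist_comm v u] at h2
  simp only [sub_self, abs_zero]
  exact max_le (abs_le.2 ⟨by linarith, by linarith⟩) dist_nonneg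

lemma abs_max_distPlus_sub_le (u v : E n) :
    |max (W.distPlus u) (-(W.wellDist / 2)) - max (W.distPlus v) (-(W.wellDist / 2))|
      ≤ dist u v := by
  refine (abs_max_sub_max_le_max _ _ _ _).trans ?_
  simp only [sub_self, abs_zero]
  exact max_le (abs_signedDist_sub_le u v) dist_nonneg

/-- The quasi-distance is globally Lipschitz. -/
lemma exists_lipschitzWith_dF (hδ : 0 < δ₀) : ∃ K, LipschitzWith K W.dF := by
  obtain ⟨M, hM0, hM⟩ := W.exists_slope_le hδ
  refine ⟨⟨2 * M, by positivity⟩, LipschitzWith.of_dist_le_mul fun u v => ?_⟩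
  have h1 := W.abs_prim_sub_le hδ convex_univ (fun l _ => hM l)
    (mem_univ (min (W.distMinus u) (W.wellDist / 2)))
    (mem_univ (min (W.distMinus v) (W.wellDist / 2)))
  have h2 := W.abs_prim_sub_le hδ convex_univ (fun l _ => hM l)
    (mem_univ (max (W.distPlus u) (-(W.wellDist / 2))))
    (mem_univ (max (W.distPlus v) (-(W.wellDist / 2))))
  have h3 := mul_le_mul_of_nonneg_left (W.abs_min_distMinus_sub_le u v) hM0
  have h4 := mul_le_mul_of_nonneg_left (W.abs_max_distPlus_sub_le u v) hM0
  rw [Real.dist_eq, dF_eq, dF_eq]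
  change _ ≤ 2 * M * dist u v
  refine le_trans ?_ (show M * dist u v + M * dist u v ≤ _ by linarith)
  refine le_trans ?_ (add_le_add (h1.trans h3) (h2.trans h4))
  refine le_trans (le_of_eq ?_) (abs_add_le _ _)
  congr 1
  ring

lemma F_nonneg (u : E n) : 0 ≤ W.F u := W.f_nonneg (sq_nonneg _)

lemma sqrt_two_F (u : E n) :
    Real.sqrt (2 * W.F u) = W.slope (min |W.distPlus u| (W.distMinus u)) := by
  have h : Metric.infDist u (W.mPlus ∪ W.mMinus)
      = min (Metric.infDist u W.mPlus) (Metric.infDist u W.mMinus) := by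
    rw [Metric.infDist, Metric.infEDist_union]
    exact ENNReal.toReal_min (Metric.infEDist_ne_top W.mPlus_nonempty)
      (Metric.infEDist_ne_top W.mMinus_nonempty)
  rw [F, slope, abs_distPlus, distMinus, h]

/-- The local slope of the quasi-distance is at most `√(2 F)`. -/
lemma eventually_abs_dF_sub_le (hδ : 0 < δ₀) (u : E n) {η : ℝ} (hη : 0 < η) :
    ∀ᶠ v in 𝓝 u, |W.dF v - W.dF u| ≤ (Real.sqrt (2 * W.F u) + η) * dist v u := by
  have hw := W.wellDist_pos
  have s1 := W.wellDist_le_distMinus_sub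
  have s2 := W.wellDist_le_distMinus_add
  have n1 := W.distMinus_nonneg
  have cA : Continuous W.distMinus := Metric.continuous_infDist_pt _
  have cS : Continuous W.distPlus := lipschitzWith_signedDist.continuous
  have pos : ∀ v, 0 ≤ (Real.sqrt (2 * W.F u) + η) * dist v u := fun v => by positivity
  -- Where the truncation is strictly saturated the term is locally constant. Otherwise `mMinus` is
  -- the nearer well, and the slope at the truncated distance is exactly `√(2F)`.
  have claim1 : ∀ᶠ v in 𝓝 u, |W.prim (min (W.distMinus v) (W.wellDist / 2)) -
      W.prim (min (W.distMinus u) (W.wellDist / 2))| ≤ (Real.sqrt (2 * W.F u) + η) * dist v u := by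
    by_cases h : W.wellDist / 2 < W.distMinus u
    · filter_upwards [cA.continuousAt.eventually_const_lt h] with v hv
      rw [min_eq_right hv.le, min_eq_right h.le]
      simpa using pos v
    · push Not at h
      have e : Real.sqrt (2 * W.F u) = W.slope (min (W.distMinus u) (W.wellDist / 2)) := by
        rw [sqrt_two_F, min_eq_left h, min_eq_right]
        linarith [s2 u]
      rw [e]
      exact W.eventually_abs_prim_sub_le hδ (W.abs_min_distMinus_sub_le) u hη
  have claim2 : ∀ᶠ v in 𝓝 u, |W.prim (max (W.distPlus v) (-(W.wellDist / 2))) -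
      W.prim (max (W.distPlus u) (-(W.wellDist / 2)))|
        ≤ (Real.sqrt (2 * W.F u) + η) * dist v u := by
    by_cases h : W.distPlus u < -(W.wellDist / 2)
    · filter_upwards [cS.continuousAt.eventually_lt_const h] with v hv
      rw [max_eq_right hv.le, max_eq_right h.le]
      simpa using pos v
    · push Not at h
      have e : Real.sqrt (2 * W.F u) = W.slope (max (W.distPlus u) (-(W.wellDist / 2))) := by
        rw [sqrt_two_F, max_eq_left h, min_eq_left, slope_abs]
        rw [abs_le]
        constructor <;> linarith [s1 u, n1 u]
      rw [e]
      exact W.eventually_abs_prim_sub_le hδ (W.abs_max_distPlus_sub_le) u hη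
  -- The two slopes never add up: between `u` and a nearby `v` at most one truncated distance
  -- changes. If both are saturated at `u`, which one is unchanged depends on `v`, hence the
  -- disjunction under the quantifier.
  have claim3 : ∀ᶠ v in 𝓝 u,
      min (W.distMinus v) (W.wellDist / 2) = min (W.distMinus u) (W.wellDist / 2) ∨
      max (W.distPlus v) (-(W.wellDist / 2)) = max (W.distPlus u) (-(W.wellDist / 2)) := by
    by_cases h1 : W.distMinus u < W.wellDist / 2
    · filter_upwards [cA.continuousAt.eventually_lt_const h1] with v hv
      right
      rw [max_eq_right (by linarith [s1 v]), max_eq_right (by linarith [s1 u])]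
    by_cases h2 : -(W.wellDist / 2) < W.distPlus u
    · filter_upwards [cS.continuousAt.eventually_const_lt h2] with v hv
      left
      rw [min_eq_right (by linarith [s1 v]), min_eq_right (by linarith [s1 u])]
    push Not at h1 h2
    refine Eventually.of_forall fun v => ?_
    by_cases h3 : W.distMinus v < W.wellDist / 2
    · right
      rw [max_eq_right (by linarith [s1 v]), max_eq_right h2]
    · left
      rw [min_eq_right (not_lt.1 h3), min_eq_right h1]
  filter_upwards [claim1, claim2, claim3] with v h1 h2 h3
  rw [dF_eq, dF_eq]
  rcases h3 with h | h
  · refine le_trans (le_of_eq ?_) h2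
    rw [h]
    congr 1
    ring
  · refine le_trans (le_of_eq ?_) h1
    rw [h]
    congr 1
    ring

end WellPotential

/-! ### Partial derivatives, cut-offs and integration by parts -/

section Calculus

variable {d n : ℕ}

/-- Near a point outside the topological support the function is identically zero, so regularity is
needed only on an open set containing the support. -/
lemma contDiff_of_tsupport_subset {X G : Type*} [NormedAddCommGroup X] [NormedSpace ℝ X]
    [NormedAddCommGroup G] [NormedSpace ℝ G] {Y : X → G} {Ω : Set X} {m : WithTop ℕ∞}
    (hΩ : IsOpen Ω) (hY : ContDiffOn ℝ m Y Ω) (hs : tsupport Y ⊆ Ω) : ContDiff ℝ m Y := by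
  rw [contDiff_iff_contDiffAt]
  intro x
  by_cases hx : x ∈ tsupport Y
  · exact hY.contDiffAt (hΩ.mem_nhds (hs hx))
  · have : Y =ᶠ[𝓝 x] fun _ => 0 := notMem_tsupport_iff_eventuallyEq.1 hx
    exact contDiffAt_const.congr_of_eventuallyEq this

lemma partialD_of_notMem_tsupport {G : Type*} [NormedAddCommGroup G] [NormedSpace ℝ G]
    {Y : E d → G} {x : E d} (hx : x ∉ tsupport Y) (i : Fin d) : partialD Y i x = 0 := by
  rw [partialD, fderiv_of_notMem_tsupport ℝ hx]
  rfl

lemma fderiv_eq_sum_partialD {G : Type*} [NormedAddCommGroup G] [NormedSpace ℝ G]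
    (Y : E d → G) (x v : E d) : fderiv ℝ Y x v = ∑ i, v i • partialD Y i x := by
  conv_lhs => rw [← (EuclideanSpace.basisFun (Fin d) ℝ).sum_repr v]
  simp [partialD]

lemma gradient_apply (f : E d → ℝ) (x : E d) (i : Fin d) : gradient f x i = partialD f i x := by
  have := InnerProductSpace.toDual_symm_apply (𝕜 := ℝ) (x := EuclideanSpace.single i (1 : ℝ))
    (y := fderiv ℝ f x)
  rw [EuclideanSpace.inner_single_right] at this
  simpa [partialD, gradient] using this

lemma inner_gradient (f : E d → ℝ) (x v : E d) : inner ℝ v (gradient f x) = fderiv ℝ f x v := by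
  rw [real_inner_comm, gradient, InnerProductSpace.toDual_symm_apply]

lemma inner_eq_sum (a b : E d) : inner ℝ a b = ∑ i, a i * b i := by
  simp [PiLp.inner_apply, mul_comm]

lemma partialD_apply {X : E d → E n} {x : E d} (hX : DifferentiableAt ℝ X x) (i : Fin d)
    (j : Fin n) : partialD X i x j = partialD (fun y => X y j) i x := by
  have h := ((EuclideanSpace.proj (𝕜 := ℝ) (ι := Fin n) j).hasFDerivAt.comp x
    hX.hasFDerivAt).fderiv
  have h' : fderiv ℝ (fun y => X y j) x = _ := h
  rw [partialD, partialD, h']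
  rfl

lemma divergence_eq {X : E d → E d} {x : E d} (hX : DifferentiableAt ℝ X x) :
    divergence X x = ∑ i, partialD (fun y => X y i) i x := by
  unfold divergence
  exact Finset.sum_congr rfl fun i _ => partialD_apply hX i i

lemma continuous_partialD {G : Type*} [NormedAddCommGroup G] [NormedSpace ℝ G] {Y : E d → G}
    (hY : ContDiff ℝ 1 Y) (i : Fin d) : Continuous (partialD Y i) :=
  (hY.continuous_fderiv (by simp)).clm_apply continuous_const

lemma hasCompactSupport_partialD {G : Type*} [NormedAddCommGroup G] [NormedSpace ℝ G] {Y : E d → G}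
    (hY : HasCompactSupport Y) (i : Fin d) : HasCompactSupport (partialD Y i) :=
  hY.fderiv_apply (𝕜 := ℝ) _

lemma contDiffOn_partialD {G : Type*} [NormedAddCommGroup G] [NormedSpace ℝ G] {Y : E d → G}
    {Ω : Set (E d)} (hΩ : IsOpen Ω) {m k : WithTop ℕ∞} (hY : ContDiffOn ℝ m Y Ω) (hk : k + 1 ≤ m)
    (i : Fin d) : ContDiffOn ℝ k (partialD Y i) Ω :=
  (hY.fderiv_of_isOpen hΩ hk).clm_apply contDiffOn_const

lemma integral_partialD_eq_zero {Y : E d → ℝ} (hY : ContDiff ℝ 1 Y) (hc : HasCompactSupport Y)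
    (i : Fin d) : ∫ x, partialD Y i x = 0 := by
  have h1 : Integrable (fun x => partialD Y i x) :=
    (continuous_partialD hY i).integrable_of_hasCompactSupport (hasCompactSupport_partialD hc i)
  have h0 : Integrable Y := hY.continuous.integrable_of_hasCompactSupport hc
  have := integral_mul_fderiv_eq_neg_fderiv_mul_of_integrable (μ := (volume : Measure (E d)))
    (f := fun _ => (1 : ℝ)) (g := Y) (v := EuclideanSpace.single i (1 : ℝ))
    (by simp) (by simpa [partialD] using h1) (by simpa using h0) (fun _ _ => by simp)
    (fun x _ => hY.differentiable (by simp) x)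
  simpa [partialD] using this

lemma setIntegral_eq_integral_of_tsupport {f : E d → ℝ} {Ω : Set (E d)}
    (h : ∀ x, x ∉ Ω → f x = 0) : ∫ x in Ω, f x = ∫ x, f x :=
  setIntegral_eq_integral_of_forall_compl_eq_zero h

/-- The divergence theorem for a `C¹` field with compact support in an open set. -/
lemma setIntegral_sum_partialD_eq_zero {Ω : Set (E d)} (hΩ : IsOpen Ω) {Y : Fin d → E d → ℝ}
    {K : Set (E d)} (hK : IsCompact K) (hKΩ : K ⊆ Ω) (hs : ∀ i, tsupport (Y i) ⊆ K)
    (hY : ∀ i, ContDiffOn ℝ 1 (Y i) Ω) : ∫ x in Ω, ∑ i, partialD (Y i) i x = 0 := by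
  have hY' : ∀ i, ContDiff ℝ 1 (Y i) := fun i =>
    contDiff_of_tsupport_subset hΩ (hY i) ((hs i).trans hKΩ)
  have hc : ∀ i, HasCompactSupport (Y i) := fun i => hK.of_isClosed_subset (isClosed_tsupport _)
    (hs i)
  rw [setIntegral_eq_integral_of_tsupport]
  · rw [integral_finsetSum]
    · exact Finset.sum_eq_zero fun i _ => integral_partialD_eq_zero (hY' i) (hc i) i
    · exact fun i _ => (continuous_partialD (hY' i) i).integrable_of_hasCompactSupport
        (hasCompactSupport_partialD (hc i) i)
  · exact fun x hx => Finset.sum_eq_zero fun i _ =>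
      partialD_of_notMem_tsupport (fun h => hx (hKΩ (hs i h))) i

/-- A smooth cut-off for a compact subset of an open set. -/
lemma exists_cutoff {K Ω : Set (E d)} (hK : IsCompact K) (hΩ : IsOpen Ω) (hKΩ : K ⊆ Ω) :
    ∃ χ : E d → ℝ, ContDiff ℝ ∞ χ ∧ HasCompactSupport χ ∧ tsupport χ ⊆ Ω ∧
      ∀ x ∈ K, ∀ᶠ y in 𝓝 x, χ y = 1 := by
  obtain ⟨L, hL, hKL, hLΩ⟩ := exists_compact_between hK hΩ hKΩ
  obtain ⟨χ, h1, h0, -⟩ := exists_contMDiffMap_one_nhds_of_subset_interior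
    (n := ⊤) (modelWithCornersSelf ℝ (E d)) hK.isClosed hKL
  have hsub : tsupport χ ⊆ L := closure_minimal (fun x hx => by
    by_contra h
    exact hx (h0 x h)) hL.isClosed
  refine ⟨χ, χ.contMDiff.contDiff, hL.of_isClosed_subset (isClosed_tsupport _) hsub,
    hsub.trans hLΩ, fun x hx => ?_⟩
  exact (eventually_nhdsSet_iff_forall.1 h1) x hx

/-- Multiplying by a cut-off gives a globally Lipschitz map with the same germs along `K`. This
allows global results on Lipschitz functions, Rademacher's theorem in particular, to be applied to a
map known only on `Ω`. -/
lemma exists_localization {K Ω : Set (E d)} (hK : IsCompact K) (hΩ : IsOpen Ω) (hKΩ : K ⊆ Ω)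
    {u : E d → E n} (hu : ContDiffOn ℝ 1 u Ω) :
    ∃ v : E d → E n, (∃ C, LipschitzWith C v) ∧ ContDiff ℝ 1 v ∧
      ∀ x ∈ K, ∀ᶠ y in 𝓝 x, v y = u y := by
  obtain ⟨χ, h1, h2, h3, h4⟩ := exists_cutoff hK hΩ hKΩ
  have hs : tsupport (fun x => χ x • u x) ⊆ tsupport χ := tsupport_smul_subset_left χ u
  have hv : ContDiff ℝ 1 (fun x => χ x • u x) :=
    contDiff_of_tsupport_subset hΩ ((h1.of_le (by simp)).contDiffOn.smul hu) (hs.trans h3)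
  have hc : HasCompactSupport (fun x => χ x • u x) :=
    h2.of_isClosed_subset (isClosed_tsupport _) hs
  refine ⟨fun x => χ x • u x, hv.lipschitzWith_of_hasCompactSupport hc (by simp), hv,
    fun x hx => ?_⟩
  filter_upwards [h4 x hx] with y hy
  simp [hy]

/-- A Lipschitz function can be integrated by parts through its line derivatives, which agree with
the pointwise partial derivatives almost everywhere by Rademacher's theorem. The bounded derivative
also gives integrability. -/
lemma integral_mul_partialD_of_lipschitz {ψ Y : E d → ℝ} {C : NNReal} (hψ : LipschitzWith C ψ)
    (hY : ContDiff ℝ 1 Y) (hc : HasCompactSupport Y) (i : Fin d) :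
    Integrable (fun x => Y x * partialD ψ i x) ∧
    ∫ x, Y x * partialD ψ i x = -∫ x, partialD Y i x * ψ x := by
  obtain ⟨D, hD⟩ := hY.lipschitzWith_of_hasCompactSupport hc (by simp)
  have h := hψ.integral_lineDeriv_mul_eq (μ := (volume : Measure (E d))) hD hc
    (EuclideanSpace.single i (1 : ℝ))
  have e1 : (fun x => lineDeriv ℝ ψ x (EuclideanSpace.single i (1 : ℝ)) * Y x)
      =ᵐ[volume] fun x => Y x * partialD ψ i x := by
    filter_upwards [hψ.ae_differentiableAt (μ := (volume : Measure (E d)))] with x hx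
    rw [hx.lineDeriv_eq_fderiv, mul_comm]
    rfl
  constructor
  · have hb : ∀ x, ‖partialD ψ i x‖ ≤ C := fun x => by
      refine (ContinuousLinearMap.le_opNorm _ _).trans ?_
      have := norm_fderiv_le_of_lipschitz ℝ hψ (x₀ := x)
      simpa using this
    have hm : Measurable (partialD ψ i) := measurable_fderiv_apply_const ℝ ψ _
    exact (hY.continuous.integrable_of_hasCompactSupport hc).mul_bdd hm.aestronglyMeasurable
      (Eventually.of_forall hb)
  · rw [← integral_congr_ae e1, h, ← integral_neg]
    refine integral_congr_ae (Eventually.of_forall fun x => ?_)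
    simp only [(hY.differentiable (by simp) x).lineDeriv_eq_fderiv, map_neg, partialD, neg_mul]

/-- Integration by parts against a Lipschitz function of a `C¹` map. -/
lemma setIntegral_inner_gradient_comp {Ω K : Set (E d)} (hΩ : IsOpen Ω) (hK : IsCompact K)
    (hKΩ : K ⊆ Ω) {u : E d → E n} (hu : ContDiffOn ℝ 1 u Ω) {Φ : E n → ℝ} {C : NNReal}
    (hΦ : LipschitzWith C Φ) {X : E d → E d} (hX : ContDiff ℝ 1 X) (hs : tsupport X ⊆ K) :
    ∫ x in Ω, inner ℝ (X x) (gradient (fun y => Φ (u y)) x)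
      = -∫ x in Ω, divergence X x * Φ (u x) := by
  obtain ⟨v, ⟨C', hv⟩, -, hvu⟩ := exists_localization hK hΩ hKΩ hu
  have hψ : LipschitzWith (C * C') (fun y => Φ (v y)) := hΦ.comp hv
  have hXi : ∀ i, ContDiff ℝ 1 (fun x => X x i) := fun i => by fun_prop
  have hsi : ∀ i, tsupport (fun x => X x i) ⊆ tsupport X := fun i =>
    closure_mono fun x hx => by
      simp only [Function.mem_support] at hx ⊢
      exact fun h => hx (by simp [h])
  have hcX : HasCompactSupport X := hK.of_isClosed_subset (isClosed_tsupport _) hs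
  have hci : ∀ i, HasCompactSupport (fun x => X x i) := fun i =>
    hcX.of_isClosed_subset (isClosed_tsupport _) (hsi i)
  have key := fun i => integral_mul_partialD_of_lipschitz hψ (hXi i) (hci i) i
  have e1 : ∀ x, inner ℝ (X x) (gradient (fun y => Φ (u y)) x)
      = ∑ i, X x i * partialD (fun y => Φ (v y)) i x := by
    intro x
    rw [inner_eq_sum]
    by_cases hx : x ∈ tsupport X
    · refine Finset.sum_congr rfl fun i _ => ?_
      have : (fun y => Φ (v y)) =ᶠ[𝓝 x] fun y => Φ (u y) := by
        filter_upwards [hvu x (hs hx)] with y hy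
        rw [hy]
      rw [gradient_apply, partialD, partialD, this.fderiv_eq]
    · have : X x = 0 := image_eq_zero_of_notMem_tsupport hx
      simp [this]
  have e2 : ∀ x, divergence X x * Φ (u x)
      = ∑ i, partialD (fun y => X y i) i x * Φ (v x) := by
    intro x
    rw [divergence_eq (hX.differentiable (by simp) x), Finset.sum_mul]
    refine Finset.sum_congr rfl fun i _ => ?_
    by_cases hx : x ∈ tsupport X
    · rw [(hvu x (hs hx)).self_of_nhds]
    · rw [partialD_of_notMem_tsupport (fun h => hx (hsi i h))]
      simp
  simp only [e1, e2]
  rw [setIntegral_eq_integral_of_tsupport, setIntegral_eq_integral_of_tsupport,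
    integral_finsetSum, integral_finsetSum, ← Finset.sum_neg_distrib]
  · exact Finset.sum_congr rfl fun i _ => (key i).2
  · intro i _
    refine Continuous.integrable_of_hasCompactSupport
      ((continuous_partialD (hXi i) i).mul hψ.continuous) ?_
    exact (hasCompactSupport_partialD (hci i) i).mul_right
  · exact fun i _ => (key i).1
  · exact fun x hx => Finset.sum_eq_zero fun i _ => by
      rw [partialD_of_notMem_tsupport (fun h => hx (hKΩ (hs (hsi i h)))), zero_mul]
  · exact fun x hx => Finset.sum_eq_zero fun i _ => by
      have : X x = 0 := image_eq_zero_of_notMem_tsupport fun h => hx (hKΩ (hs h))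
      simp [this]

end Calculus

/-! ### The generalized gradient -/

section GenGradient

variable {d n : ℕ}

/-- The derivative of `Φ ∘ u` is controlled by that of `u` and the local slope of `Φ`. -/
lemma abs_apply_le_of_slope {X : Type*} [NormedAddCommGroup X] [NormedSpace ℝ X]
    {u : X → E n} {Φ : E n → ℝ} {p : X} {σ : ℝ}
    (hΦ : ∀ η > 0, ∀ᶠ v in 𝓝 (u p), |Φ v - Φ (u p)| ≤ (σ + η) * dist v (u p))
    {A : X →L[ℝ] E n} {B : X →L[ℝ] ℝ} (hu : HasFDerivAt u A p)
    (hψ : HasFDerivAt (fun q => Φ (u q)) B p) (h : X) : |B h| ≤ σ * ‖A h‖ := by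
  have hu' := (hu.hasLineDerivAt h).tendsto_slope_zero_right.norm
  have hψ' := (hψ.hasLineDerivAt h).tendsto_slope_zero_right.norm
  -- Only increments of `u` along the line through `p` in direction `h` enter. The hypothesis is
  -- applied along one-sided difference quotients with slack `η`, which is removed at the end.
  have key : ∀ η > 0, |B h| ≤ (σ + η) * ‖A h‖ := by
    intro η hη
    have hc : Tendsto (fun s : ℝ => p + s • h) (𝓝[>] 0) (𝓝 p) := by
      have : Continuous fun s : ℝ => p + s • h := by fun_prop
      simpa using (this.tendsto 0).mono_left nhdsWithin_le_nhds
    have hev := (hu.continuousAt.tendsto.comp hc).eventually (hΦ η hη)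
    refine le_of_tendsto_of_tendsto hψ' (hu'.const_mul (σ + η)) ?_
    filter_upwards [hev, self_mem_nhdsWithin] with s hs hs0
    rw [norm_smul, norm_smul, Real.norm_eq_abs s⁻¹, Real.norm_eq_abs, ← mul_assoc, mul_comm (σ + η),
      mul_assoc]
    refine mul_le_mul_of_nonneg_left ?_ (abs_nonneg _)
    simpa [dist_eq_norm] using hs
  have hlim : Tendsto (fun η : ℝ => (σ + η) * ‖A h‖) (𝓝[>] 0) (𝓝 (σ * ‖A h‖)) := by
    have : Continuous fun η : ℝ => (σ + η) * ‖A h‖ := by fun_prop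
    simpa using (this.tendsto 0).mono_left nhdsWithin_le_nhds
  exact ge_of_tendsto hlim (by filter_upwards [self_mem_nhdsWithin] with η hη using key η hη)

lemma timeD_eq_of_hasFDerivAt {G : Type*} [NormedAddCommGroup G] [NormedSpace ℝ G]
    {u : ℝ → E d → G} {t : ℝ} {x : E d} {A : ℝ × E d →L[ℝ] G}
    (hu : HasFDerivAt (fun p : ℝ × E d => u p.1 p.2) A (t, x)) :
    HasDerivAt (fun s => u s x) (A (1, 0)) t := by
  have h1 : HasFDerivAt (fun s : ℝ => (s, x)) (ContinuousLinearMap.inl ℝ ℝ (E d)) t :=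
    hasFDerivAt_prodMk_left t x
  have h2 : HasFDerivAt (fun p : ℝ × E d => u p.1 p.2) A ((fun s : ℝ => (s, x)) t) := hu
  have h3 := (h2.comp t h1).hasDerivAt
  simp only [ContinuousLinearMap.comp_apply, ContinuousLinearMap.inl_apply] at h3
  exact h3

lemma hasFDerivAt_slice {G : Type*} [NormedAddCommGroup G] [NormedSpace ℝ G]
    {u : ℝ → E d → G} {t : ℝ} {x : E d} {A : ℝ × E d →L[ℝ] G}
    (hu : HasFDerivAt (fun p : ℝ × E d => u p.1 p.2) A (t, x)) :
    HasFDerivAt (u t) (A.comp (ContinuousLinearMap.inr ℝ ℝ (E d))) x := by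
  have h1 : HasFDerivAt (fun y : E d => (t, y)) (ContinuousLinearMap.inr ℝ ℝ (E d)) x :=
    hasFDerivAt_prodMk_right t x
  have h2 : HasFDerivAt (fun p : ℝ × E d => u p.1 p.2) A ((fun y : E d => (t, y)) x) := hu
  exact h2.comp x h1

lemma partialD_eq_of_hasFDerivAt {G : Type*} [NormedAddCommGroup G] [NormedSpace ℝ G]
    {u : ℝ → E d → G} {t : ℝ} {x : E d} {A : ℝ × E d →L[ℝ] G}
    (hu : HasFDerivAt (fun p : ℝ × E d => u p.1 p.2) A (t, x)) (i : Fin d) :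
    partialD (u t) i x = A (0, EuclideanSpace.single i 1) := by
  rw [partialD, (hasFDerivAt_slice hu).fderiv]
  simp

/-- The columns of the space-time differential span its range; tangent vectors can thus be lifted to
directions in space-time. -/
lemma tangentSpan_eq_range {u : ℝ → E d → E n} {t : ℝ} {x : E d} {A : ℝ × E d →L[ℝ] E n}
    (hu : HasFDerivAt (fun p : ℝ × E d => u p.1 p.2) A (t, x)) :
    tangentSpan u t x = LinearMap.range (A : ℝ × E d →ₗ[ℝ] E n) := by
  apply le_antisymm
  · rw [tangentSpan, Submodule.span_le]
    rintro _ (rfl | ⟨i, rfl⟩)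
    · rw [timeD, (timeD_eq_of_hasFDerivAt hu).deriv]
      exact ⟨_, rfl⟩
    · simp only [partialD_eq_of_hasFDerivAt hu]
      exact ⟨_, rfl⟩
  · rintro _ ⟨⟨s, y⟩, rfl⟩
    have e : A (s, y) = s • timeD u t x + ∑ i, y i • partialD (u t) i x := by
      rw [← fderiv_eq_sum_partialD, (hasFDerivAt_slice hu).fderiv, timeD,
        (timeD_eq_of_hasFDerivAt hu).deriv, ← map_smul]
      simp [← map_add]
    change A (s, y) ∈ _
    rw [e]
    refine add_mem (Submodule.smul_mem _ _ (Submodule.subset_span (mem_insert _ _)))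
      (Submodule.sum_mem _ fun i _ => Submodule.smul_mem _ _ (Submodule.subset_span
        (mem_insert_of_mem _ ⟨i, rfl⟩)))

/-- At a point where `Φ ∘ u` is differentiable, the generalized gradient of `Φ` represents the
derivative of `Φ ∘ u`, lies in the tangent span, and is bounded by the local slope of `Φ`. -/
lemma genGradient_spec {u : ℝ → E d → E n} {t : ℝ} {x : E d} {A : ℝ × E d →L[ℝ] E n}
    (hu : HasFDerivAt (fun p : ℝ × E d => u p.1 p.2) A (t, x)) {Φ : E n → ℝ} {C : NNReal}
    (hΦ : LipschitzWith C Φ) {σ : ℝ} (hσ0 : 0 ≤ σ)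
    (hσ : ∀ η > 0, ∀ᶠ v in 𝓝 (u t x), |Φ v - Φ (u t x)| ≤ (σ + η) * dist v (u t x))
    {B : ℝ × E d →L[ℝ] ℝ} (hψ : HasFDerivAt (fun p : ℝ × E d => Φ (u p.1 p.2)) B (t, x)) :
    (∀ h, inner ℝ (genGradient Φ u t x) (A h) = B h) ∧
    genGradient Φ u t x ∈ LinearMap.range (A : ℝ × E d →ₗ[ℝ] E n) ∧
    ‖genGradient Φ u t x‖ ≤ σ := by
  have hB : ∀ h, |B h| ≤ σ * ‖A h‖ := fun h =>
    abs_apply_le_of_slope (u := fun p : ℝ × E d => u p.1 p.2) hσ hu hψ h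
  -- A linear right inverse of `A` on its range selects, for each tangent vector, a space-time
  -- direction that produces it.
  obtain ⟨R₀, hR₀⟩ := (A : ℝ × E d →ₗ[ℝ] E n).rangeRestrict.exists_rightInverse_of_surjective
    (A : ℝ × E d →ₗ[ℝ] E n).range_rangeRestrict
  have hspan := tangentSpan_eq_range hu
  have hAR₀ : ∀ v, A (R₀ v) = (v : E n) := fun v =>
    congrArg Subtype.val (LinearMap.congr_fun hR₀ v)
  let R₁ : tangentSpan u t x →ₗ[ℝ] ℝ × E d := R₀.comp (LinearEquiv.ofEq _ _ hspan).toLinearMap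
  let R : tangentSpan u t x →L[ℝ] ℝ × E d := R₁.toContinuousLinearMap
  have hAR : ∀ v, A (R v) = (v : E n) := fun v => hAR₀ _
  have hL : HasFDerivAt (fun v : tangentSpan u t x => Φ (u t x + (v : E n))) (B.comp R) 0 := by
    have hp : HasFDerivAt (fun v : tangentSpan u t x => ((t, x) : ℝ × E d) + R v) R 0 :=
      R.hasFDerivAt.const_add _
    have h0 : ((t, x) : ℝ × E d) + R 0 = (t, x) := by simp
    have h1 : HasFDerivAt (fun v : tangentSpan u t x =>
        u ((t, x) + R v).1 ((t, x) + R v).2) (A.comp R) 0 :=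
      HasFDerivAt.comp (f := fun v : tangentSpan u t x => ((t, x) : ℝ × E d) + R v)
        (g := fun p : ℝ × E d => u p.1 p.2) 0 (by rw [h0]; exact hu) hp
    have h2 : HasFDerivAt (fun v : tangentSpan u t x =>
        Φ (u ((t, x) + R v).1 ((t, x) + R v).2)) (B.comp R) 0 :=
      HasFDerivAt.comp (f := fun v : tangentSpan u t x => ((t, x) : ℝ × E d) + R v)
        (g := fun p : ℝ × E d => Φ (u p.1 p.2)) 0 (by rw [h0]; exact hψ) hp
    -- The affine path `u + v` and the curved path `u((t, x) + R v)` differ by `o(v)`. As `Φ` is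
    -- Lipschitz, differentiability of `Φ ∘ u` passes to the restriction of `Φ` to the affine space,
    -- with derivative `B ∘ R`.
    have h3 : HasFDerivAt (fun v : tangentSpan u t x => Φ (u t x + (v : E n)) -
        Φ (u ((t, x) + R v).1 ((t, x) + R v).2)) (0 : tangentSpan u t x →L[ℝ] ℝ) 0 := by
      rw [hasFDerivAt_iff_isLittleO_nhds_zero] at h1 ⊢
      refine Asymptotics.IsBigO.trans_isLittleO ?_ h1
      refine Asymptotics.IsBigO.of_bound C (Eventually.of_forall fun v => ?_)
      have := hΦ.dist_le_mul (u t x + (v : E n)) (u ((t, x) + R v).1 ((t, x) + R v).2)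
      rw [Real.dist_eq] at this
      simp only [zero_add, map_zero, Submodule.coe_zero, add_zero, sub_self, sub_zero,
        ContinuousLinearMap.comp_apply, hAR, zero_apply]
      rw [Real.norm_eq_abs]
      refine this.trans (le_of_eq ?_)
      rw [dist_comm, dist_eq_norm]
      congr 2
      abel
    have h4 := h3.add h2
    rw [zero_add] at h4
    exact h4.congr_of_eventuallyEq (Eventually.of_forall fun v => by simp)
  have hw : ∀ y, inner ℝ (genGradient Φ u t x) y
      = B (R ((tangentSpan u t x).orthogonalProjectionOnto y)) := fun y => by
    rw [genGradient, InnerProductSpace.toDual_symm_apply, hL.fderiv]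
    rfl
  refine ⟨fun h => ?_, ?_, ?_⟩
  · have hm : A h ∈ tangentSpan u t x := by rw [hspan]; exact ⟨h, rfl⟩
    have e := (tangentSpan u t x).orthogonalProjectionOnto_mem_subspace_eq_self ⟨A h, hm⟩
    rw [hw, show (tangentSpan u t x).orthogonalProjectionOnto (A h) = ⟨A h, hm⟩ from e,
      ← sub_eq_zero, ← map_sub, ← abs_nonpos_iff]
    refine (hB _).trans ?_
    rw [map_sub, hAR]
    simp
  · rw [← hspan, ← Submodule.orthogonal_orthogonal (tangentSpan u t x),
      Submodule.mem_orthogonal']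
    intro y hy
    rw [hw, (Submodule.orthogonalProjectionOnto_eq_zero_iff).2 hy]
    simp
  -- The slope bound is tested on the generalized gradient itself, using that orthogonal projection
  -- does not increase the norm.
  · have h1 : ‖genGradient Φ u t x‖ ^ 2 ≤ σ * ‖genGradient Φ u t x‖ := by
      rw [← real_inner_self_eq_norm_sq, hw]
      refine (le_abs_self _).trans ((hB _).trans ?_)
      rw [hAR]
      exact mul_le_mul_of_nonneg_left
        ((tangentSpan u t x).norm_orthogonalProjectionOnto_apply_le _) hσ0
    by_contra! hcon
    nlinarith [norm_nonneg (genGradient Φ u t x)]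

end GenGradient

/-! ### Integration by parts for functions vanishing on the boundary -/

section BoundaryValues

variable {d n : ℕ}

lemma laplacian_eq_sum_partialD {G : Type*} [NormedAddCommGroup G] [NormedSpace ℝ G]
    {f : E d → G} {x : E d} (hf : ContDiffAt ℝ 2 f x) :
    Laplacian.laplacian f x = ∑ i, partialD (partialD f i) i x := by
  rw [InnerProductSpace.laplacian_eq_iteratedFDeriv_orthonormalBasis f
    (EuclideanSpace.basisFun (Fin d) ℝ)]
  refine Finset.sum_congr rfl fun i _ => ?_
  have h : DifferentiableAt ℝ (fderiv ℝ f) x :=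
    (hf.fderiv_right (m := 1) (by norm_num)).differentiableAt (by simp)
  have e : partialD f i = fun y => fderiv ℝ f y (EuclideanSpace.single i 1) := rfl
  rw [iteratedFDeriv_two_apply, e, partialD, fderiv_clm_apply h (by fun_prop)]
  simp

/-- On its zero set `w` is approximated by the zero map with no error, and at almost every point of
a measurable set the derivative must agree with such a linear approximation. Multiplying by a fixed
unit vector produces a self-map of the space, as this density argument requires; dimension zero is
separate because it has no such vector. -/
lemma ae_fderiv_eq_zero_of_eq_zero {Ω : Set (E d)} (hΩ : IsOpen Ω) {w : E d → ℝ}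
    (hw : DifferentiableOn ℝ w Ω) :
    ∀ᵐ x ∂(volume.restrict Ω), w x = 0 → fderiv ℝ w x = 0 := by
  rcases isEmpty_or_nonempty (Fin d) with hd | ⟨⟨i⟩⟩
  · exact Eventually.of_forall fun x _ => by
      ext y
      rw [Subsingleton.elim y 0]
      simp
  let e : E d := EuclideanSpace.single i 1
  let s : Set (E d) := {x ∈ Ω | w x = 0}
  have hs : MeasurableSet s := by
    have h1 : IsOpen (Ω ∩ w ⁻¹' {0}ᶜ) :=
      hw.continuousOn.isOpen_inter_preimage hΩ isOpen_compl_singleton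
    have : s = Ω \ (Ω ∩ w ⁻¹' {0}ᶜ) := by
      ext x
      simp only [s, mem_sep_iff, Set.mem_sdiff, mem_inter_iff, mem_preimage, mem_compl_iff,
        mem_singleton_iff]
      tauto
    rw [this]
    exact hΩ.measurableSet.diff h1.measurableSet
  have happ : ApproximatesLinearOn (fun x => w x • e) (0 : E d →L[ℝ] E d) s 0 := by
    intro x hx y hy
    simp [hx.2, hy.2]
  have key := happ.norm_fderiv_sub_le volume hs
    (fun x => (fderiv ℝ w x).smulRight e) fun x hx =>
      ((hw.differentiableAt (hΩ.mem_nhds hx.1)).hasFDerivAt.smul_const e).hasFDerivWithinAt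
  rw [ae_restrict_iff' hs] at key
  rw [ae_restrict_iff' hΩ.measurableSet]
  filter_upwards [key] with x hx hxΩ hx0
  have h1 := hx ⟨hxΩ, hx0⟩
  have h2 : (fderiv ℝ w x).smulRight e = 0 := by
    rw [sub_zero] at h1
    exact nnnorm_eq_zero.1 (le_antisymm h1 zero_le)
  ext y
  have h3 := congrArg (fun v : E d => v i) (DFunLike.congr_fun h2 y)
  simpa [e] using h3

/-- A smooth truncation of the identity that vanishes near the origin. -/
def trunc (s : ℝ) : ℝ := s * Real.smoothTransition (s ^ 2 - 1)

lemma contDiff_trunc : ContDiff ℝ ∞ trunc :=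
  contDiff_id.mul (Real.smoothTransition.contDiff.comp (by fun_prop))

lemma trunc_eq_zero {s : ℝ} (hs : |s| ≤ 1) : trunc s = 0 := by
  rw [trunc, Real.smoothTransition.zero_of_nonpos, mul_zero]
  have := pow_le_pow_left₀ (abs_nonneg s) hs 2
  rw [sq_abs] at this
  linarith

lemma trunc_eq_self {s : ℝ} (hs : 2 ≤ |s|) : trunc s = s := by
  rw [trunc, Real.smoothTransition.one_of_one_le, mul_one]
  have := pow_le_pow_left₀ (by norm_num) hs 2
  rw [sq_abs] at this
  linarith

lemma abs_trunc_le (s : ℝ) : |trunc s| ≤ |s| := by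
  rw [trunc, abs_mul, abs_of_nonneg (Real.smoothTransition.nonneg _)]
  exact mul_le_of_le_one_right (abs_nonneg _) (Real.smoothTransition.le_one _)

lemma deriv_trunc_eq_one {s : ℝ} (hs : 2 < |s|) : deriv trunc s = 1 := by
  have : trunc =ᶠ[𝓝 s] id := by
    filter_upwards [continuous_abs.continuousAt.eventually_const_lt hs] with r hr
    exact trunc_eq_self hr.le
  rw [this.deriv_eq]
  simp

lemma exists_deriv_trunc_le : ∃ M : ℝ, 1 ≤ M ∧ ∀ s, |deriv trunc s| ≤ M := by
  have hc : Continuous (deriv trunc) := contDiff_trunc.continuous_deriv (by simp)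
  obtain ⟨M, hM⟩ := (isCompact_Icc (a := (-2 : ℝ)) (b := 2)).exists_bound_of_continuousOn
    hc.continuousOn
  refine ⟨max M 1, le_max_right _ _, fun s => ?_⟩
  by_cases hs : |s| ≤ 2
  · exact le_max_of_le_left (hM s (abs_le.1 hs))
  · rw [deriv_trunc_eq_one (not_le.1 hs)]
    simp

/-- The rescaled truncation. -/
def truncAt (k : ℕ) (s : ℝ) : ℝ := ((k : ℝ) + 1)⁻¹ * trunc (((k : ℝ) + 1) * s)

lemma contDiff_truncAt (k : ℕ) : ContDiff ℝ ∞ (truncAt k) :=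
  contDiff_const.mul (contDiff_trunc.comp (by fun_prop))

/-- The rescaling leaves slopes unchanged, so the derivative bound for `trunc` holds uniformly in
`k`. -/
lemma deriv_truncAt (k : ℕ) (s : ℝ) : deriv (truncAt k) s = deriv trunc (((k : ℝ) + 1) * s) := by
  have hk : (0 : ℝ) < (k : ℝ) + 1 := by positivity
  have h := ((contDiff_trunc.differentiable (by simp)) (((k : ℝ) + 1) * s)).hasDerivAt
  have h2 := (h.comp s ((hasDerivAt_id s).const_mul ((k : ℝ) + 1))).const_mul ((k : ℝ) + 1)⁻¹
  have h3 : deriv (truncAt k) s = _ := h2.deriv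
  rw [h3]
  field_simp

lemma abs_truncAt_le (k : ℕ) (s : ℝ) : |truncAt k s| ≤ |s| := by
  have hk : (0 : ℝ) < (k : ℝ) + 1 := by positivity
  rw [truncAt, abs_mul, abs_of_pos (inv_pos.2 hk), inv_mul_le_iff₀ hk]
  refine (abs_trunc_le _).trans (le_of_eq ?_)
  rw [abs_mul, abs_of_pos hk]

lemma eventually_lt_mul_abs {s : ℝ} (hs : s ≠ 0) : ∀ᶠ k : ℕ in atTop, 2 < |((k : ℝ) + 1) * s| := by
  have h1 : Tendsto (fun k : ℕ => ((k : ℝ) + 1) * |s|) atTop atTop :=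
    (tendsto_natCast_atTop_atTop.atTop_add tendsto_const_nhds).atTop_mul_const (abs_pos.2 hs)
  filter_upwards [h1.eventually_gt_atTop 2] with k hk
  rwa [abs_mul, abs_of_pos (by positivity)]

lemma tendsto_truncAt (s : ℝ) : Tendsto (fun k => truncAt k s) atTop (𝓝 s) := by
  by_cases hs : s = 0
  · subst hs
    simp [truncAt, trunc]
  · refine tendsto_const_nhds.congr' ?_
    filter_upwards [eventually_lt_mul_abs hs] with k hk
    have : (0 : ℝ) < (k : ℝ) + 1 := by positivity
    rw [truncAt, trunc_eq_self hk.le]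
    field_simp

/-- At `s = 0` the derivatives are all zero and the limit fails; in Green's formula this is harmless
because the gradient vanishes almost everywhere on the zero set. -/
lemma tendsto_deriv_truncAt {s : ℝ} (hs : s ≠ 0) :
    Tendsto (fun k => deriv (truncAt k) s) atTop (𝓝 1) := by
  refine tendsto_const_nhds.congr' ?_
  filter_upwards [eventually_lt_mul_abs hs] with k hk
  rw [deriv_truncAt, deriv_trunc_eq_one hk]

/-- Green's formula for a function that is continuous up to the boundary, vanishes there, and
has a square integrable gradient. No regularity of the boundary is needed. -/
lemma setIntegral_green {Ω : Set (E d)} (hΩ : IsOpen Ω) (hb : Bornology.IsBounded Ω)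
    {v w : E d → ℝ} (hv : ContDiffOn ℝ 2 v Ω) (hw : ContDiffOn ℝ 1 w Ω)
    (hwc : ContinuousOn w (closure Ω)) (hw0 : ∀ x ∈ frontier Ω, w x = 0)
    (hi1 : IntegrableOn (fun x => (∑ i, partialD (partialD v i) i x) * w x) Ω)
    (hi2 : ∀ i, IntegrableOn (fun x => partialD v i x * partialD w i x) Ω) :
    ∫ x in Ω, ∑ i, partialD v i x * partialD w i x
      = -∫ x in Ω, (∑ i, partialD (partialD v i) i x) * w x := by
  obtain ⟨M, hM1, hM⟩ := exists_deriv_trunc_le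
  have hΩm := hΩ.measurableSet
  have hpv : ∀ i, ContDiffOn ℝ 1 (partialD v i) Ω := fun i =>
    contDiffOn_partialD hΩ hv (by norm_num) i
  -- Truncation cuts off where `|w| < 1/(k+1)`. Since `w` is continuous and vanishes on the
  -- boundary, the remaining set is compact inside `Ω`, and the divergence theorem applies without
  -- any boundary regularity.
  let K : ℕ → Set (E d) := fun k => {x ∈ closure Ω | 1 ≤ |((k : ℝ) + 1) * w x|}
  have hKc : ∀ k, IsCompact (K k) := fun k => by
    refine hb.isCompact_closure.of_isClosed_subset ?_ (sep_subset _ _)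
    exact isClosed_closure.isClosed_le continuousOn_const (by fun_prop)
  have hKΩ : ∀ k, K k ⊆ Ω := fun k x hx => by
    by_contra h
    have hx' : x ∈ frontier Ω := by
      rw [hΩ.frontier_eq]
      exact ⟨hx.1, h⟩
    have := hx.2
    rw [hw0 x hx'] at this
    norm_num at this
  let W : ℕ → E d → ℝ := fun k => Ω.indicator fun x => truncAt k (w x)
  have hWs : ∀ k, tsupport (W k) ⊆ K k := fun k => by
    refine closure_minimal (fun x hx => ?_) (hKc k).isClosed
    rw [Function.mem_support] at hx
    have hxΩ : x ∈ Ω := by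
      by_contra h
      exact hx (indicator_of_notMem h _)
    refine ⟨subset_closure hxΩ, ?_⟩
    by_contra! h
    refine hx ?_
    rw [show W k x = truncAt k (w x) from indicator_of_mem hxΩ _, truncAt, trunc_eq_zero h.le,
      mul_zero]
  have hWc : ∀ k, ContDiffOn ℝ 1 (W k) Ω := fun k =>
    (((contDiff_truncAt k).of_le (by simp)).comp_contDiffOn hw).congr
      fun x hx => indicator_of_mem hx _
  have hWd : ∀ k i, ∀ x ∈ Ω, partialD (W k) i x = deriv (truncAt k) (w x) * partialD w i x := by
    intro k i x hx
    have h1 : W k =ᶠ[𝓝 x] fun y => truncAt k (w y) := by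
      filter_upwards [hΩ.mem_nhds hx] with y hy using indicator_of_mem hy _
    have h2 := (((contDiff_truncAt k).differentiable (by simp) (w x)).hasDerivAt.comp_hasFDerivAt x
      ((hw.differentiableOn (by simp)).differentiableAt (hΩ.mem_nhds hx)).hasFDerivAt).fderiv
    rw [partialD, h1.fderiv_eq]
    have h3 : fderiv ℝ (fun y => truncAt k (w y)) x = _ := h2
    rw [h3]
    rfl
  have hzero : ∀ k, ∫ x in Ω, ((∑ i, partialD (partialD v i) i x) * truncAt k (w x)
      + deriv (truncAt k) (w x) * ∑ i, partialD v i x * partialD w i x) = 0 := by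
    intro k
    have h1 := setIntegral_sum_partialD_eq_zero hΩ (Y := fun i x => partialD v i x * W k x)
      (hKc k) (hKΩ k) (fun i => (tsupport_mul_subset_right).trans (hWs k))
      (fun i => (hpv i).mul (hWc k))
    rw [← h1]
    refine setIntegral_congr_fun hΩm fun x hx => ?_
    rw [Finset.sum_mul, Finset.mul_sum, ← Finset.sum_add_distrib]
    refine Finset.sum_congr rfl fun i _ => ?_
    have d1 := ((hpv i).differentiableOn (by simp)).differentiableAt (hΩ.mem_nhds hx)
    have d2 := ((hWc k).differentiableOn (by simp)).differentiableAt (hΩ.mem_nhds hx)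
    have e : partialD (fun y => partialD v i y * W k y) i x
        = partialD v i x * partialD (W k) i x + W k x * partialD (partialD v i) i x := by
      rw [partialD, fderiv_fun_mul d1 d2]
      rfl
    rw [e, hWd k i x hx, show W k x = truncAt k (w x) from indicator_of_mem hx _]
    ring
  have hi3 : IntegrableOn (fun x => ∑ i, partialD v i x * partialD w i x) Ω :=
    integrable_finsetSum _ fun i _ => hi2 i
  have hwm : AEStronglyMeasurable w (volume.restrict Ω) :=
    hw.continuousOn.aestronglyMeasurable hΩm
  -- Dominated convergence removes the truncation: `truncAt k` is bounded by the identity and its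
  -- derivative by `M`.
  have hlim : Tendsto (fun k => ∫ x in Ω, ((∑ i, partialD (partialD v i) i x) * truncAt k (w x)
      + deriv (truncAt k) (w x) * ∑ i, partialD v i x * partialD w i x)) atTop
      (𝓝 (∫ x in Ω, ((∑ i, partialD (partialD v i) i x) * w x
        + ∑ i, partialD v i x * partialD w i x))) := by
    refine tendsto_integral_of_dominated_convergence (fun x =>
      ‖(∑ i, partialD (partialD v i) i x) * w x‖ + M * ‖∑ i, partialD v i x * partialD w i x‖)
      ?_ (hi1.norm.add (hi3.norm.const_mul M)) ?_ ?_
    · intro k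
      refine AEStronglyMeasurable.add (AEStronglyMeasurable.mul ?_ ?_)
        (AEStronglyMeasurable.mul ?_ hi3.aestronglyMeasurable)
      · exact (Finset.measurable_sum _ fun i _ =>
          measurable_fderiv_apply_const ℝ _ _).aestronglyMeasurable
      · exact (contDiff_truncAt k).continuous.comp_aestronglyMeasurable hwm
      · exact ((contDiff_truncAt k).continuous_deriv (by simp)).comp_aestronglyMeasurable hwm
    · refine fun k => Eventually.of_forall fun x => (norm_add_le _ _).trans ?_
      rw [norm_mul, norm_mul, norm_mul]
      refine add_le_add (mul_le_mul_of_nonneg_left (abs_truncAt_le k _) (norm_nonneg _))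
        (mul_le_mul_of_nonneg_right ?_ (norm_nonneg _))
      rw [deriv_truncAt]
      exact hM _
    · filter_upwards [ae_fderiv_eq_zero_of_eq_zero hΩ (hw.differentiableOn (by simp))] with x hx
      refine ((tendsto_truncAt _).const_mul _).add ?_
      by_cases h0 : w x = 0
      · have : ∀ i, partialD w i x = 0 := fun i => by rw [partialD, hx h0]; rfl
        simp [this]
      · simpa using (tendsto_deriv_truncAt h0).mul_const
          (∑ i, partialD v i x * partialD w i x)
  simp only [hzero] at hlim
  have := tendsto_nhds_unique hlim tendsto_const_nhds
  rw [integral_add hi1 hi3] at this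
  linarith

end BoundaryValues

/-! ### The Dirichlet energy of a solution -/

section SquareIntegrable

variable {α G : Type*} [MeasurableSpace α] {μ : Measure α} [NormedAddCommGroup G]

lemma integrable_inner_of_sq [InnerProductSpace ℝ G] {f g : α → G} (hf : AEStronglyMeasurable f μ)
    (hg : AEStronglyMeasurable g μ) (hf2 : Integrable (fun x => ‖f x‖ ^ 2) μ)
    (hg2 : Integrable (fun x => ‖g x‖ ^ 2) μ) : Integrable (fun x => inner ℝ (f x) (g x)) μ := by
  refine (hf2.add hg2).mono' (hf.inner hg) (Eventually.of_forall fun x => ?_)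
  have h1 := norm_inner_le_norm (𝕜 := ℝ) (f x) (g x)
  have h2 := two_mul_le_add_sq ‖f x‖ ‖g x‖
  have h3 : 0 ≤ ‖f x‖ * ‖g x‖ := by positivity
  simp only [Pi.add_apply]
  linarith

lemma integrable_norm_sq_add {f g : α → G} (hf : AEStronglyMeasurable f μ)
    (hg : AEStronglyMeasurable g μ) (hf2 : Integrable (fun x => ‖f x‖ ^ 2) μ)
    (hg2 : Integrable (fun x => ‖g x‖ ^ 2) μ) : Integrable (fun x => ‖f x + g x‖ ^ 2) μ := by
  refine ((hf2.add hg2).const_mul 2).mono' ((hf.add hg).norm.pow 2)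
    (Eventually.of_forall fun x => ?_)
  have h1 := norm_add_le (f x) (g x)
  have h2 := two_mul_le_add_sq ‖f x‖ ‖g x‖
  simp only [Pi.add_apply]
  rw [Real.norm_of_nonneg (by positivity)]
  have h3 : ‖f x + g x‖ ^ 2 ≤ (‖f x‖ + ‖g x‖) ^ 2 := pow_le_pow_left₀ (norm_nonneg _) h1 2
  nlinarith

lemma integrable_norm_sq_sub {f g : α → G} (hf : AEStronglyMeasurable f μ)
    (hg : AEStronglyMeasurable g μ) (hf2 : Integrable (fun x => ‖f x‖ ^ 2) μ)
    (hg2 : Integrable (fun x => ‖g x‖ ^ 2) μ) : Integrable (fun x => ‖f x - g x‖ ^ 2) μ := by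
  have := integrable_norm_sq_add hf hg.neg hf2 (by simpa using hg2)
  simpa [sub_eq_add_neg] using this

end SquareIntegrable

lemma isFiniteMeasure_restrict {d : ℕ} {Ω : Set (E d)} (hb : Bornology.IsBounded Ω) :
    IsFiniteMeasure (volume.restrict Ω) := ⟨by simpa using hb.measure_lt_top⟩

section Solution

variable {d n : ℕ} {δ₀ : ℝ} {W : WellPotential n δ₀} {Ω : Set (E d)} {T ε : ℝ}
  {g : E d → E n} {u : ℝ → E d → E n}

lemma gradNorm_sq {G : Type*} [NormedAddCommGroup G] [NormedSpace ℝ G] (v : E d → G) (x : E d) :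
    gradNorm v x ^ 2 = ∑ i, ‖partialD v i x‖ ^ 2 :=
  Real.sq_sqrt (Finset.sum_nonneg fun _ _ => by positivity)

lemma measurable_partialD {G : Type*} [NormedAddCommGroup G] [NormedSpace ℝ G] [CompleteSpace G]
    [MeasurableSpace G] [BorelSpace G] (v : E d → G) (i : Fin d) : Measurable (partialD v i) :=
  measurable_fderiv_apply_const ℝ v _

lemma WellPotential.continuous_gradient_F : Continuous (gradient W.F) := by
  have h : Continuous (fderiv ℝ W.F) := W.F_smooth.continuous_fderiv (by simp)
  exact (LinearIsometryEquiv.continuous _).comp h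

lemma WellPotential.differentiable_F : Differentiable ℝ W.F := W.F_smooth.differentiable (by simp)

namespace IsSolution

lemma hasFDerivAt (hu : IsSolution W Ω T ε g u) (hΩ : IsOpen Ω) {t : ℝ} (ht : t ∈ Ioo 0 T)
    {x : E d} (hx : x ∈ Ω) : HasFDerivAt (fun p : ℝ × E d => u p.1 p.2)
      (fderiv ℝ (fun p : ℝ × E d => u p.1 p.2) (t, x)) (t, x) :=
  ((hu.contDiff_one.differentiableOn (by simp)).differentiableAt
    ((isOpen_Ioo.prod hΩ).mem_nhds ⟨ht, hx⟩)).hasFDerivAt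

lemma continuousOn_fderiv (hu : IsSolution W Ω T ε g u) (hΩ : IsOpen Ω) :
    ContinuousOn (fderiv ℝ (fun p : ℝ × E d => u p.1 p.2)) (Ioo 0 T ×ˢ Ω) :=
  hu.contDiff_one.continuousOn_fderiv_of_isOpen (isOpen_Ioo.prod hΩ) le_rfl

lemma timeD_eq (hu : IsSolution W Ω T ε g u) (hΩ : IsOpen Ω) {t : ℝ} (ht : t ∈ Ioo 0 T)
    {x : E d} (hx : x ∈ Ω) :
    timeD u t x = fderiv ℝ (fun p : ℝ × E d => u p.1 p.2) (t, x) (1, 0) :=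
  (timeD_eq_of_hasFDerivAt (hu.hasFDerivAt hΩ ht hx)).deriv

lemma hasDerivAt_time (hu : IsSolution W Ω T ε g u) (hΩ : IsOpen Ω) {t : ℝ} (ht : t ∈ Ioo 0 T)
    {x : E d} (hx : x ∈ Ω) : HasDerivAt (fun s => u s x) (timeD u t x) t := by
  rw [hu.timeD_eq hΩ ht hx]
  exact timeD_eq_of_hasFDerivAt (hu.hasFDerivAt hΩ ht hx)

lemma continuousOn_timeD (hu : IsSolution W Ω T ε g u) (hΩ : IsOpen Ω) :
    ContinuousOn (fun p : ℝ × E d => timeD u p.1 p.2) (Ioo 0 T ×ˢ Ω) :=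
  ((hu.continuousOn_fderiv hΩ).clm_apply continuousOn_const).congr
    fun _ hp => hu.timeD_eq hΩ hp.1 hp.2

lemma contDiffOn_one (hu : IsSolution W Ω T ε g u) {t : ℝ} (ht : t ∈ Ioo 0 T) :
    ContDiffOn ℝ 1 (u t) Ω := (hu.contDiff_two t ht).of_le (by norm_num)

lemma continuousOn_slice (hu : IsSolution W Ω T ε g u) {t : ℝ} (ht : t ∈ Ioo 0 T) :
    ContinuousOn (u t) (closure Ω) :=
  hu.continuous.comp (f := fun x : E d => ((t, x) : ℝ × E d)) (by fun_prop) fun x hx => ⟨ht, hx⟩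

lemma exists_bound (hu : IsSolution W Ω T ε g u) (hb : Bornology.IsBounded Ω) {a b : ℝ}
    (ha : 0 < a) (hbT : b < T) {G : Type*} [NormedAddCommGroup G] {h : E n → G}
    (hh : Continuous h) :
    ∃ R : ℝ, 0 ≤ R ∧ ∀ t ∈ Icc a b, ∀ x ∈ closure Ω, ‖h (u t x)‖ ≤ R := by
  obtain ⟨R, hR⟩ := (isCompact_Icc.prod hb.isCompact_closure).exists_bound_of_continuousOn
    (f := fun p : ℝ × E d => h (u p.1 p.2)) (hh.comp_continuousOn (hu.continuous.mono
      (prod_mono (fun t (ht : t ∈ Icc a b) => ⟨ha.trans_le ht.1, ht.2.trans_lt hbT⟩) subset_rfl)))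
  exact ⟨max R 0, le_max_right _ _, fun t ht x hx => le_max_of_le_left (hR (t, x) ⟨ht, hx⟩)⟩

lemma laplacian_eq (hu : IsSolution W Ω T ε g u) {t : ℝ} (ht : t ∈ Ioo 0 T)
    {x : E d} (hx : x ∈ Ω) : Laplacian.laplacian (u t) x
      = timeD u t x + (ε ^ 2)⁻¹ • gradient W.F (u t x) := by
  rw [hu.equation t ht x hx]
  abel

lemma aestronglyMeasurable_comp (hu : IsSolution W Ω T ε g u) (hΩ : IsOpen Ω) {t : ℝ}
    (ht : t ∈ Ioo 0 T) {G : Type*} [NormedAddCommGroup G] {h : E n → G} (hh : Continuous h) :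
    AEStronglyMeasurable (fun x => h (u t x)) (volume.restrict Ω) :=
  (hh.comp_continuousOn ((hu.continuousOn_slice ht).mono subset_closure)).aestronglyMeasurable
    hΩ.measurableSet

lemma integrableOn_sq_comp (hu : IsSolution W Ω T ε g u) (hΩ : IsOpen Ω)
    (hb : Bornology.IsBounded Ω) {t : ℝ} (ht : t ∈ Ioo 0 T) {G : Type*} [NormedAddCommGroup G]
    {h : E n → G} (hh : Continuous h) : IntegrableOn (fun x => ‖h (u t x)‖ ^ 2) Ω := by
  obtain ⟨R, hR0, hR⟩ := hu.exists_bound hb ht.1 ht.2 hh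
  have := isFiniteMeasure_restrict hb
  refine Integrable.of_bound ((hu.aestronglyMeasurable_comp hΩ ht hh).norm.pow 2) (R ^ 2) ?_
  filter_upwards [ae_restrict_mem hΩ.measurableSet] with x hx
  rw [Real.norm_of_nonneg (by positivity)]
  exact pow_le_pow_left₀ (norm_nonneg _) (hR t ⟨le_rfl, le_rfl⟩ x (subset_closure hx)) 2

lemma aestronglyMeasurable_timeD (hu : IsSolution W Ω T ε g u) (hΩ : IsOpen Ω) {t : ℝ}
    (ht : t ∈ Ioo 0 T) : AEStronglyMeasurable (timeD u t) (volume.restrict Ω) :=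
  ((hu.continuousOn_timeD hΩ).comp (f := fun x : E d => ((t, x) : ℝ × E d)) (by fun_prop)
    fun x hx => ⟨ht, hx⟩).aestronglyMeasurable hΩ.measurableSet

lemma integrableOn_sq_partialD (hu : IsSolution W Ω T ε g u) {t : ℝ}
    (ht : t ∈ Ioo 0 T) (i : Fin d) : IntegrableOn (fun x => ‖partialD (u t) i x‖ ^ 2) Ω := by
  refine (hu.grad_integrable t ht).mono' ?_ (Eventually.of_forall fun x => ?_)
  · exact ((measurable_partialD _ _).norm.pow_const 2).aestronglyMeasurable
  · rw [Real.norm_of_nonneg (by positivity), gradNorm_sq]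
    exact Finset.single_le_sum (f := fun i => ‖partialD (u t) i x‖ ^ 2)
      (fun _ _ => by positivity) (Finset.mem_univ i)

lemma partialD_sub (hu : IsSolution W Ω T ε g u) (hΩ : IsOpen Ω) {t s : ℝ} (ht : t ∈ Ioo 0 T)
    (hs : s ∈ Ioo 0 T) {x : E d} (hx : x ∈ Ω) (i : Fin d) :
    partialD (u t - u s) i x = partialD (u t) i x - partialD (u s) i x := by
  have h : ∀ {r}, r ∈ Ioo 0 T → DifferentiableAt ℝ (u r) x := fun hr =>
    ((hu.contDiffOn_one hr).differentiableOn (by simp)).differentiableAt (hΩ.mem_nhds hx)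
  rw [partialD, fderiv_sub (h ht) (h hs)]
  rfl

/-- Green's formula for the increments of a solution. -/
lemma green (hu : IsSolution W Ω T ε g u) (hΩ : IsOpen Ω) (hb : Bornology.IsBounded Ω) {t s : ℝ}
    (ht : t ∈ Ioo 0 T) (hs : s ∈ Ioo 0 T) (hgood : IntegrableOn (fun x => ‖timeD u t x‖ ^ 2) Ω) :
    ∫ x in Ω, ∑ i, inner ℝ (partialD (u t) i x) (partialD (u t) i x - partialD (u s) i x)
      = -∫ x in Ω, inner ℝ (timeD u t x + (ε ^ 2)⁻¹ • gradient W.F (u t x)) (u t x - u s x) := by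
  have hΩm := hΩ.measurableSet
  let v : Fin n → E d → ℝ := fun j x => u t x j
  let w : Fin n → E d → ℝ := fun j x => u t x j - u s x j
  have hproj : ∀ j, ContDiff ℝ 2 fun y : E n => y j := fun j => by fun_prop
  have hv : ∀ j, ContDiffOn ℝ 2 (v j) Ω := fun j =>
    (hproj j).comp_contDiffOn (hu.contDiff_two t ht)
  have hvs : ∀ j, ContDiffOn ℝ 2 (fun x => u s x j) Ω := fun j =>
    (hproj j).comp_contDiffOn (hu.contDiff_two s hs)
  have hw : ∀ j, ContDiffOn ℝ 1 (w j) Ω := fun j => ((hv j).sub (hvs j)).of_le (by norm_num)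
  have hwc : ∀ j, ContinuousOn (w j) (closure Ω) := fun j =>
    ((hproj j).continuous.comp_continuousOn (hu.continuousOn_slice ht)).sub
      ((hproj j).continuous.comp_continuousOn (hu.continuousOn_slice hs))
  -- The time-independent boundary datum enters here: increments in time vanish on the boundary.
  have hw0 : ∀ j, ∀ x ∈ frontier Ω, w j x = 0 := fun j x hx => by
    simp [w, hu.boundary t ht x hx, hu.boundary s hs x hx]
  have dt : ∀ {r}, r ∈ Ioo 0 T → ∀ x ∈ Ω, DifferentiableAt ℝ (u r) x := fun hr x hx =>
    ((hu.contDiffOn_one hr).differentiableOn (by simp)).differentiableAt (hΩ.mem_nhds hx)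
  have ev : ∀ j i, ∀ x ∈ Ω, partialD (v j) i x = partialD (u t) i x j := fun j i x hx =>
    (partialD_apply (dt ht x hx) i j).symm
  have ew : ∀ j i, ∀ x ∈ Ω, partialD (w j) i x
      = partialD (u t) i x j - partialD (u s) i x j := fun j i x hx => by
    have h1 : w j = fun y => (u t - u s) y j := rfl
    rw [h1, ← partialD_apply ((dt ht x hx).sub (dt hs x hx)), hu.partialD_sub hΩ ht hs hx]
    rfl
  have elap : ∀ j, ∀ x ∈ Ω, ∑ i, partialD (partialD (v j) i) i x
      = (timeD u t x + (ε ^ 2)⁻¹ • gradient W.F (u t x)) j := fun j x hx => by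
    rw [← hu.laplacian_eq ht hx,
      laplacian_eq_sum_partialD ((hu.contDiff_two t ht).contDiffAt (hΩ.mem_nhds hx))]
    simp only [WithLp.ofLp_sum, Finset.sum_apply]
    refine Finset.sum_congr rfl fun i _ => ?_
    have h1 : partialD (v j) i =ᶠ[𝓝 x] fun y => partialD (u t) i y j := by
      filter_upwards [hΩ.mem_nhds hx] with y hy using ev j i y hy
    have h2 : DifferentiableAt ℝ (partialD (u t) i) x :=
      ((contDiffOn_partialD (k := 1) hΩ (hu.contDiff_two t ht) (by norm_num) i).differentiableOn
        (by simp)).differentiableAt (hΩ.mem_nhds hx)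
    rw [partialD_apply h2, partialD, h1.fderiv_eq]
    rfl
  have sq_le : ∀ (y : E n) (j : Fin n), ‖y j‖ ^ 2 ≤ ‖y‖ ^ 2 := fun y j =>
    pow_le_pow_left₀ (norm_nonneg _) (PiLp.norm_apply_le y j) 2
  have mj : ∀ j, Continuous fun y : E n => y j := fun j => (hproj j).continuous
  have mu : AEStronglyMeasurable (fun x => u t x - u s x) (volume.restrict Ω) :=
    (hu.aestronglyMeasurable_comp hΩ ht continuous_id).sub
      (hu.aestronglyMeasurable_comp hΩ hs continuous_id)
  have iu : IntegrableOn (fun x => ‖u t x - u s x‖ ^ 2) Ω :=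
    integrable_norm_sq_sub (hu.aestronglyMeasurable_comp hΩ ht continuous_id)
      (hu.aestronglyMeasurable_comp hΩ hs continuous_id)
      (hu.integrableOn_sq_comp hΩ hb ht continuous_id)
      (hu.integrableOn_sq_comp hΩ hb hs continuous_id)
  have cF : Continuous fun y => (ε ^ 2)⁻¹ • gradient W.F y :=
    (continuous_const_smul ((ε ^ 2)⁻¹)).comp W.continuous_gradient_F
  have mQ : AEStronglyMeasurable (fun x => timeD u t x + (ε ^ 2)⁻¹ • gradient W.F (u t x))
      (volume.restrict Ω) := (hu.aestronglyMeasurable_timeD hΩ ht).add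
    (hu.aestronglyMeasurable_comp hΩ ht cF)
  have iQ : IntegrableOn (fun x => ‖timeD u t x + (ε ^ 2)⁻¹ • gradient W.F (u t x)‖ ^ 2) Ω :=
    integrable_norm_sq_add (hu.aestronglyMeasurable_timeD hΩ ht)
      (hu.aestronglyMeasurable_comp hΩ ht cF) hgood (hu.integrableOn_sq_comp hΩ hb ht cF)
  have mp : ∀ (r : ℝ) (i : Fin d), AEStronglyMeasurable (partialD (u r) i) (volume.restrict Ω) :=
    fun r i => (measurable_partialD _ _).aestronglyMeasurable
  have ipd : ∀ i, IntegrableOn (fun x => ‖partialD (u t) i x - partialD (u s) i x‖ ^ 2) Ω :=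
    fun i => integrable_norm_sq_sub (mp t i) (mp s i) (hu.integrableOn_sq_partialD ht i)
      (hu.integrableOn_sq_partialD hs i)
  have comp_sq : ∀ {f : E d → E n}, AEStronglyMeasurable f (volume.restrict Ω) →
      IntegrableOn (fun x => ‖f x‖ ^ 2) Ω → ∀ j, IntegrableOn (fun x => ‖f x j‖ ^ 2) Ω :=
    fun {f} hf hi j => hi.mono' (((mj j).comp_aestronglyMeasurable hf).norm.pow 2)
      (Eventually.of_forall fun x => by
        rw [Real.norm_of_nonneg (by positivity)]
        exact sq_le (f x) j)
  have prod_int : ∀ {f h : E d → E n}, AEStronglyMeasurable f (volume.restrict Ω) →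
      AEStronglyMeasurable h (volume.restrict Ω) → IntegrableOn (fun x => ‖f x‖ ^ 2) Ω →
      IntegrableOn (fun x => ‖h x‖ ^ 2) Ω → ∀ j, IntegrableOn (fun x => f x j * h x j) Ω := by
    intro f h hf hh if2 ih2 j
    have := integrable_inner_of_sq ((mj j).comp_aestronglyMeasurable hf)
      ((mj j).comp_aestronglyMeasurable hh) (comp_sq hf if2 j) (comp_sq hh ih2 j)
    simpa [IntegrableOn, mul_comm] using this
  have hi1 : ∀ j, IntegrableOn (fun x => (∑ i, partialD (partialD (v j) i) i x) * w j x) Ω :=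
    fun j => (prod_int mQ mu iQ iu j).congr_fun (fun x hx => by
      rw [elap j x hx]
      rfl) hΩm
  have hi2 : ∀ j i, IntegrableOn (fun x => partialD (v j) i x * partialD (w j) i x) Ω :=
    fun j i => (prod_int (mp t i) ((mp t i).sub (mp s i)) (hu.integrableOn_sq_partialD ht i)
      (ipd i) j).congr_fun (fun x hx => by
        rw [ev j i x hx, ew j i x hx]
        rfl) hΩm
  have key := fun j => setIntegral_green hΩ hb (hv j) (hw j) (hwc j) (hw0 j) (hi1 j) (hi2 j)
  have e1 : ∫ x in Ω, ∑ i, inner ℝ (partialD (u t) i x) (partialD (u t) i x - partialD (u s) i x)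
      = ∫ x in Ω, ∑ j, ∑ i, partialD (v j) i x * partialD (w j) i x := by
    refine setIntegral_congr_fun hΩm fun x hx => ?_
    beta_reduce
    rw [Finset.sum_comm]
    refine Finset.sum_congr rfl fun i _ => ?_
    rw [inner_eq_sum]
    refine Finset.sum_congr rfl fun j _ => ?_
    rw [ev j i x hx, ew j i x hx]
    rfl
  have e2 : ∫ x in Ω, inner ℝ (timeD u t x + (ε ^ 2)⁻¹ • gradient W.F (u t x)) (u t x - u s x)
      = ∫ x in Ω, ∑ j, (∑ i, partialD (partialD (v j) i) i x) * w j x := by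
    refine setIntegral_congr_fun hΩm fun x hx => ?_
    beta_reduce
    rw [inner_eq_sum]
    refine Finset.sum_congr rfl fun j _ => ?_
    rw [elap j x hx]
    rfl
  rw [e1, e2, integral_finsetSum _ fun j _ => integrable_finsetSum _ fun i _ => hi2 j i,
    integral_finsetSum _ fun j _ => hi1 j, ← Finset.sum_neg_distrib]
  exact Finset.sum_congr rfl fun j _ => key j

/-- The Dirichlet energy is convex, hence its increments are bounded by its first variation. -/
lemma dirichlet_sub_le (hu : IsSolution W Ω T ε g u) (hΩ : IsOpen Ω)
    (hb : Bornology.IsBounded Ω) {t s : ℝ} (ht : t ∈ Ioo 0 T) (hs : s ∈ Ioo 0 T)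
    (hgood : IntegrableOn (fun x => ‖timeD u t x‖ ^ 2) Ω) :
    (∫ x in Ω, gradNorm (u t) x ^ 2) - ∫ x in Ω, gradNorm (u s) x ^ 2
      ≤ -2 * ∫ x in Ω, inner ℝ (timeD u t x + (ε ^ 2)⁻¹ • gradient W.F (u t x))
        (u t x - u s x) := by
  have hg := hu.green hΩ hb ht hs hgood
  have mp : ∀ (r : ℝ) (i : Fin d), AEStronglyMeasurable (partialD (u r) i) (volume.restrict Ω) :=
    fun r i => (measurable_partialD _ _).aestronglyMeasurable
  have ipd : ∀ i, IntegrableOn (fun x => ‖partialD (u t) i x - partialD (u s) i x‖ ^ 2) Ω :=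
    fun i => integrable_norm_sq_sub (mp t i) (mp s i) (hu.integrableOn_sq_partialD ht i)
      (hu.integrableOn_sq_partialD hs i)
  have hi : IntegrableOn (fun x => ∑ i, inner ℝ (partialD (u t) i x)
      (partialD (u t) i x - partialD (u s) i x)) Ω :=
    integrable_finsetSum _ fun i _ => integrable_inner_of_sq (mp t i) ((mp t i).sub (mp s i))
      (hu.integrableOn_sq_partialD ht i) (ipd i)
  rw [← integral_sub (hu.grad_integrable t ht) (hu.grad_integrable s hs)]
  -- Convexity of the square, `|p|² - |q|² ≤ 2 p·(p - q)`, is integrated; the right side is linear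
  -- in the increment, so Green's formula applies.
  have : ∫ x in Ω, (gradNorm (u t) x ^ 2 - gradNorm (u s) x ^ 2)
      ≤ ∫ x in Ω, 2 * ∑ i, inner ℝ (partialD (u t) i x)
        (partialD (u t) i x - partialD (u s) i x) := by
    refine integral_mono ((hu.grad_integrable t ht).sub (hu.grad_integrable s hs))
      (hi.const_mul 2) fun x => ?_
    beta_reduce
    rw [gradNorm_sq, gradNorm_sq, ← Finset.sum_sub_distrib, Finset.mul_sum]
    refine Finset.sum_le_sum fun i _ => ?_
    rw [inner_sub_right, real_inner_self_eq_norm_sq]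
    have h1 := norm_sub_sq_real (partialD (u t) i x) (partialD (u s) i x)
    nlinarith [sq_nonneg ‖partialD (u t) i x - partialD (u s) i x‖]
  rw [integral_const_mul, hg] at this
  linarith

end IsSolution

end Solution

/-! ### Difference quotients in time -/

section WeakConvergence

variable {α G : Type*} [MeasurableSpace α] {μ : Measure α} [NormedAddCommGroup G]
  [InnerProductSpace ℝ G]

/-- A sequence that is bounded in `L²` and converges almost everywhere converges weakly. -/
lemma tendsto_integral_inner_of_bounded [IsFiniteMeasure μ] {Q D : α → G} {Dk : ℕ → α → G}
    {M : ENNReal} (hM : M ≠ ⊤) (hQ : MemLp Q 2 μ) (hD : MemLp D 2 μ)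
    (hm : ∀ k, AEStronglyMeasurable (Dk k) μ) (hle : ∀ k, eLpNorm (Dk k) 2 μ ≤ M)
    (hlim : ∀ᵐ x ∂μ, Tendsto (fun k => Dk k x) atTop (𝓝 (D x))) :
    Tendsto (fun k => ∫ x, inner ℝ (Q x) (Dk k x) ∂μ) atTop (𝓝 (∫ x, inner ℝ (Q x) (D x) ∂μ)) := by
  have hDk : ∀ k, MemLp (Dk k) 2 μ := fun k => ⟨hm k, (hle k).trans_lt hM.lt_top⟩
  have hint : ∀ {f : α → G}, MemLp f 2 μ → Integrable (fun x => inner ℝ (Q x) (f x)) μ :=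
    fun hf => integrable_inner_of_sq hQ.1 hf.1 ((memLp_two_iff_integrable_sq_norm hQ.1).1 hQ)
      ((memLp_two_iff_integrable_sq_norm hf.1).1 hf)
  refine tendsto_integral_of_L1' _ (hint hD).1 (Eventually.of_forall fun k => hint (hDk k)) ?_
  -- Vitali's theorem gives convergence of the products in L¹. Uniform integrability follows by
  -- Cauchy-Schwarz from the uniform L² bound on `Dk` and the absolute continuity of the L² norm of
  -- the single function `Q`.
  refine tendsto_Lp_finite_of_tendsto_ae le_rfl ENNReal.one_ne_top (fun k => (hint (hDk k)).1)
    (memLp_one_iff_integrable.2 (hint hD)) ?_ ?_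
  · intro e he
    have hM1 : 0 < M.toReal + 1 := by positivity
    -- The summand 1 in the denominator keeps the tolerance meaningful when the bound `M` is zero.
    obtain ⟨δ, hδ, h⟩ := hQ.eLpNorm_indicator_le (by norm_num) (by norm_num)
      (ε := e / (M.toReal + 1)) (by positivity)
    refine ⟨δ, hδ, fun k s hs hμ => ?_⟩
    have e1 : s.indicator (fun x => inner ℝ (Q x) (Dk k x))
        = fun x => (fun a b : G => (inner ℝ a b : ℝ)) (s.indicator Q x) (Dk k x) := by
      ext x
      by_cases hx : x ∈ s <;> simp [hx]
    rw [e1]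
    refine (eLpNorm_le_eLpNorm_mul_eLpNorm'_of_norm (p := 2) (q := 2) (hQ.1.indicator hs) (hm k)
      (fun a b : G => (inner ℝ a b : ℝ)) 1 (Eventually.of_forall fun x => by
        simpa using norm_inner_le_norm (𝕜 := ℝ) (s.indicator Q x) (Dk k x))).trans ?_
    have h1 := mul_le_mul' (h s hs hμ) (hle k)
    simp only [ENNReal.coe_one, one_mul]
    refine h1.trans ?_
    have e2 : ENNReal.ofReal (e / (M.toReal + 1)) * M
        = ENNReal.ofReal (e / (M.toReal + 1) * M.toReal) := by
      rw [ENNReal.ofReal_mul (by positivity), ENNReal.ofReal_toReal hM]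
    rw [e2]
    refine ENNReal.ofReal_le_ofReal ?_
    rw [div_mul_eq_mul_div, div_le_iff₀ hM1]
    nlinarith
  · filter_upwards [hlim] with x hx
    exact tendsto_const_nhds.inner hx

lemma eLpNorm_two_le_of_lintegral {G : Type*} [NormedAddCommGroup G] {f : α → G} {M : ENNReal} (h : ∫⁻ x, ‖f x‖ₑ ^ 2 ∂μ ≤ M) :
    eLpNorm f 2 μ ≤ M ^ (1 / 2 : ℝ) := by
  rw [eLpNorm_eq_lintegral_rpow_enorm_toReal (by norm_num) (by norm_num)]
  simp only [ENNReal.toReal_ofNat, ENNReal.rpow_ofNat]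
  exact ENNReal.rpow_le_rpow h (by norm_num)

end WeakConvergence

/-- This supplies translation invariance for time shifts and Rademacher's theorem in space-time. -/
instance isAddHaarMeasure_volume_prod {d : ℕ} :
    (volume : Measure (ℝ × E d)).IsAddHaarMeasure :=
  inferInstanceAs ((volume : Measure ℝ).prod (volume : Measure (E d))).IsAddHaarMeasure

section Solution

variable {d n : ℕ} {δ₀ : ℝ} {W : WellPotential n δ₀} {Ω : Set (E d)} {T ε : ℝ}
  {g : E d → E n} {u : ℝ → E d → E n}

namespace IsSolution

/-- The difference quotient is the average of the time derivative over the intermediate times, so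
Jensen's inequality applies. The extended-valued form can be integrated without a priori
integrability. -/
lemma enorm_diffQuot_sq_le (hu : IsSolution W Ω T ε g u) (hΩ : IsOpen Ω) {t h : ℝ} (hh : h ≠ 0)
    (ht : ∀ θ ∈ Icc (0 : ℝ) 1, t - θ * h ∈ Ioo 0 T) {x : E d} (hx : x ∈ Ω) :
    ‖h⁻¹ • (u t x - u (t - h) x)‖ₑ ^ 2
      ≤ ∫⁻ θ in Ioc (0 : ℝ) 1, ‖timeD u (t - θ * h) x‖ₑ ^ 2 := by
  have hcont : ContinuousOn (fun θ : ℝ => timeD u (t - θ * h) x) (Icc 0 1) :=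
    (hu.continuousOn_timeD hΩ).comp (f := fun θ : ℝ => ((t - θ * h, x) : ℝ × E d)) (by fun_prop)
      fun θ hθ => ⟨ht θ hθ, hx⟩
  have hint : IntegrableOn (fun θ : ℝ => timeD u (t - θ * h) x) (Ioc 0 1) :=
    hcont.integrableOn_Icc.mono_set Ioc_subset_Icc_self
  have hint2 : IntegrableOn (fun θ : ℝ => ‖timeD u (t - θ * h) x‖ ^ 2) (Ioc 0 1) :=
    (hcont.norm.pow 2).integrableOn_Icc.mono_set Ioc_subset_Icc_self
  have hd : ∀ θ ∈ uIcc (0 : ℝ) 1, HasDerivAt (fun θ : ℝ => -(h⁻¹ • u (t - θ * h) x))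
      (timeD u (t - θ * h) x) θ := by
    intro θ hθ
    rw [uIcc_of_le zero_le_one] at hθ
    have h1 : HasDerivAt (fun θ : ℝ => t - θ * h) (-h) θ := by
      simpa using ((hasDerivAt_id θ).mul_const h).const_sub t
    have h2 := ((HasDerivAt.scomp θ (hu.hasDerivAt_time hΩ (ht θ hθ) hx) h1).const_smul h⁻¹).neg
    refine h2.congr_deriv ?_
    rw [smul_smul, ← neg_smul]
    field_simp
    simp
  have hftc : ∫ θ in Ioc (0 : ℝ) 1, timeD u (t - θ * h) x = h⁻¹ • (u t x - u (t - h) x) := by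
    rw [← intervalIntegral.integral_of_le zero_le_one,
      intervalIntegral.integral_eq_sub_of_hasDerivAt hd
        ((intervalIntegrable_iff_integrableOn_Ioc_of_le zero_le_one).2 hint)]
    simp [smul_sub]
    abel
  have : IsProbabilityMeasure (volume.restrict (Ioc (0 : ℝ) 1)) := ⟨by simp⟩
  have hj := ConvexOn.map_integral_le (μ := volume.restrict (Ioc (0 : ℝ) 1))
    (f := fun θ : ℝ => timeD u (t - θ * h) x)
    ((convexOn_norm (E := E n) convex_univ).pow (fun _ _ => norm_nonneg _) 2)
    (continuous_norm.pow 2).continuousOn isClosed_univ (by simp) hint hint2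
  rw [hftc] at hj
  have e1 : ‖h⁻¹ • (u t x - u (t - h) x)‖ₑ ^ 2
      = ENNReal.ofReal (‖h⁻¹ • (u t x - u (t - h) x)‖ ^ 2) := by
    rw [ENNReal.ofReal_pow (norm_nonneg _), ofReal_norm]
  rw [e1]
  refine (ENNReal.ofReal_le_ofReal hj).trans (le_of_eq ?_)
  have e2 := ofReal_integral_eq_lintegral_ofReal hint2
    (Eventually.of_forall fun θ => by positivity)
  refine e2.trans (lintegral_congr fun θ => ?_)
  rw [ENNReal.ofReal_pow (norm_nonneg _), ofReal_norm]

/-- This uniform L² bound on the difference quotients yields their weak convergence. The window is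
enlarged by `r` to contain all shifted times. -/
lemma lintegral_diffQuot_le (hu : IsSolution W Ω T ε g u) (hΩ : IsOpen Ω) {a b r h : ℝ}
    (ha : 0 < a - r) (hbT : b + r < T) (hh : h ≠ 0) (hr : |h| ≤ r) :
    ∫⁻ p in Ioo a b ×ˢ Ω, ‖h⁻¹ • (u p.1 p.2 - u (p.1 - h) p.2)‖ₑ ^ 2
      ≤ ∫⁻ p in Ioo (a - r) (b + r) ×ˢ Ω, ‖timeD u p.1 p.2‖ₑ ^ 2 := by
  have hΩm := hΩ.measurableSet
  have hr0 : 0 ≤ r := (abs_nonneg h).trans hr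
  let Z' : Set (ℝ × E d) := Ioo (a - r) (b + r) ×ˢ Ω
  have hZ' : MeasurableSet Z' := measurableSet_Ioo.prod hΩm
  -- The total derivative in the direction `(1, 0)` is measurable on all of space-time and equals
  -- the time derivative on the domain of the solution.
  let H : ℝ × E d → ENNReal :=
    fun p => ‖fderiv ℝ (fun p : ℝ × E d => u p.1 p.2) p (1, 0)‖ₑ ^ 2
  have hH : Measurable H := (measurable_fderiv_apply_const ℝ _ _).enorm.pow_const 2
  have hHeq : ∀ p ∈ Ioo 0 T ×ˢ Ω, ‖timeD u p.1 p.2‖ₑ ^ 2 = H p := fun p hp => by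
    rw [hu.timeD_eq hΩ hp.1 hp.2]
  have hmem : ∀ t ∈ Ioo a b, ∀ θ ∈ Icc (0 : ℝ) 1, t - θ * h ∈ Ioo (a - r) (b + r) := by
    intro t ht θ hθ
    have h1 : |θ * h| ≤ r := by
      rw [abs_mul, abs_of_nonneg hθ.1]
      exact (mul_le_of_le_one_left (abs_nonneg _) hθ.2).trans hr
    have := abs_le.1 h1
    constructor <;> linarith [ht.1, ht.2, this.1, this.2]
  have hsub : Ioo (a - r) (b + r) ⊆ Ioo 0 T := Ioo_subset_Ioo ha.le hbT.le
  -- Extension by zero outside the enlarged window makes the integrand global; Tonelli and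
  -- translation invariance in time then remove the average over `θ`.
  calc ∫⁻ p in Ioo a b ×ˢ Ω, ‖h⁻¹ • (u p.1 p.2 - u (p.1 - h) p.2)‖ₑ ^ 2
      ≤ ∫⁻ p in Ioo a b ×ˢ Ω, ∫⁻ θ in Ioc (0 : ℝ) 1, Z'.indicator H (p - (θ * h, 0)) := by
        refine setLIntegral_mono' (measurableSet_Ioo.prod hΩm) fun p hp => ?_
        refine (hu.enorm_diffQuot_sq_le hΩ hh
          (fun θ hθ => hsub (hmem p.1 hp.1 θ hθ)) hp.2).trans ?_
        refine setLIntegral_mono' measurableSet_Ioc fun θ hθ => ?_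
        have hm := hmem p.1 hp.1 θ ⟨hθ.1.le, hθ.2⟩
        have hz : p - (θ * h, 0) ∈ Z' := ⟨hm, by simpa using hp.2⟩
        rw [indicator_of_mem hz, ← hHeq _ ⟨hsub hz.1, hz.2⟩]
        simp
    _ = ∫⁻ θ in Ioc (0 : ℝ) 1, ∫⁻ p in Ioo a b ×ˢ Ω, Z'.indicator H (p - (θ * h, 0)) := by
        refine lintegral_lintegral_swap (Measurable.aemeasurable ?_)
        exact (hH.indicator hZ').comp (g := Z'.indicator H)
          (f := fun q : (ℝ × E d) × ℝ => q.1 - (q.2 * h, (0 : E d))) (by fun_prop)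
    _ ≤ ∫⁻ _ in Ioc (0 : ℝ) 1, ∫⁻ p in Z', H p := by
        refine lintegral_mono fun θ => ?_
        refine (setLIntegral_le_lintegral _ _).trans ?_
        rw [lintegral_sub_right_eq_self (μ := (volume : Measure (ℝ × E d))) (Z'.indicator H),
          lintegral_indicator hZ']
    _ = ∫⁻ p in Z', H p := by simp
    _ = _ := setLIntegral_congr_fun hZ' fun p hp => (hHeq p ⟨hsub hp.1, hp.2⟩).symm

lemma tendsto_diffQuot (hu : IsSolution W Ω T ε g u) (hΩ : IsOpen Ω) {t : ℝ} (ht : t ∈ Ioo 0 T)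
    {x : E d} (hx : x ∈ Ω) {h : ℕ → ℝ} (h0 : ∀ k, h k ≠ 0) (hlim : Tendsto h atTop (𝓝 0)) :
    Tendsto (fun k => (h k)⁻¹ • (u t x - u (t - h k) x)) atTop (𝓝 (timeD u t x)) := by
  have h1 := (hu.hasDerivAt_time hΩ ht hx).tendsto_slope_zero
  have h2 : Tendsto (fun k => -h k) atTop (𝓝[≠] 0) := by
    refine tendsto_nhdsWithin_iff.2 ⟨by simpa using hlim.neg, Eventually.of_forall fun k => ?_⟩
    simpa using h0 k
  refine (h1.comp h2).congr fun k => ?_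
  simp only [Function.comp_apply, inv_neg, neg_smul, ← smul_neg]
  rw [neg_sub, ← sub_eq_add_neg]

/-- The right-hand side `Δ u` of the Allen-Cahn system. -/
lemma memLp_laplacian (hu : IsSolution W Ω T ε g u) (hΩ : IsOpen Ω) (hb : Bornology.IsBounded Ω)
    {a b : ℝ} (ha : 0 < a) (hab : a < b) (hbT : b < T) :
    MemLp (fun p : ℝ × E d => timeD u p.1 p.2) 2 (volume.restrict (Ioo a b ×ˢ Ω)) ∧
    MemLp (fun p : ℝ × E d => timeD u p.1 p.2 + (ε ^ 2)⁻¹ • gradient W.F (u p.1 p.2)) 2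
      (volume.restrict (Ioo a b ×ˢ Ω)) ∧ volume (Ioo a b ×ˢ Ω) < ⊤ := by
  have hsub : Ioo a b ⊆ Ioo 0 T := Ioo_subset_Ioo ha.le hbT.le
  have hZ : MeasurableSet (Ioo a b ×ˢ Ω) := measurableSet_Ioo.prod hΩ.measurableSet
  have m1 : AEStronglyMeasurable (fun p : ℝ × E d => timeD u p.1 p.2)
      (volume.restrict (Ioo a b ×ˢ Ω)) :=
    ((hu.continuousOn_timeD hΩ).mono (prod_mono hsub subset_rfl)).aestronglyMeasurable hZ
  have h1 : MemLp (fun p : ℝ × E d => timeD u p.1 p.2) 2 (volume.restrict (Ioo a b ×ˢ Ω)) :=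
    (memLp_two_iff_integrable_sq_norm m1).2 (hu.time_integrable a b ha hab hbT)
  have hfin : volume (Ioo a b ×ˢ Ω) < ⊤ :=
    ((Metric.isBounded_Ioo a b).prod hb).measure_lt_top
  have : IsFiniteMeasure (volume.restrict (Ioo a b ×ˢ Ω)) := ⟨by simpa using hfin⟩
  have cF : Continuous fun y => (ε ^ 2)⁻¹ • gradient W.F y :=
    (continuous_const_smul ((ε ^ 2)⁻¹)).comp W.continuous_gradient_F
  refine ⟨h1, h1.add ?_, hfin⟩
  obtain ⟨R, -, hR⟩ := hu.exists_bound hb ha hbT cF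
  refine MemLp.of_bound ((cF.comp_continuousOn (hu.continuous.mono
    (prod_mono hsub subset_closure))).aestronglyMeasurable hZ) R ?_
  filter_upwards [ae_restrict_mem hZ] with p hp
  exact hR p.1 ⟨hp.1.1.le, hp.1.2.le⟩ p.2 (subset_closure hp.2)

/-- Weak convergence of the difference quotients of a solution. -/
lemma tendsto_integral_diffQuot (hu : IsSolution W Ω T ε g u) (hΩ : IsOpen Ω)
    (hb : Bornology.IsBounded Ω) {a b r : ℝ} (hr : 0 < r) (ha : 0 < a - r) (hab : a < b)
    (hbT : b + r < T) {h : ℕ → ℝ} (h0 : ∀ k, h k ≠ 0) (hle : ∀ k, |h k| ≤ r)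
    (hlim : Tendsto h atTop (𝓝 0)) :
    Tendsto (fun k => ∫ p in Ioo a b ×ˢ Ω,
      inner ℝ (timeD u p.1 p.2 + (ε ^ 2)⁻¹ • gradient W.F (u p.1 p.2))
        ((h k)⁻¹ • (u p.1 p.2 - u (p.1 - h k) p.2))) atTop
      (𝓝 (∫ p in Ioo a b ×ˢ Ω,
        inner ℝ (timeD u p.1 p.2 + (ε ^ 2)⁻¹ • gradient W.F (u p.1 p.2)) (timeD u p.1 p.2))) := by
  have hZ : MeasurableSet (Ioo a b ×ˢ Ω) := measurableSet_Ioo.prod hΩ.measurableSet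
  obtain ⟨m1, m2, hfin⟩ := hu.memLp_laplacian hΩ hb (a := a) (b := b) (by linarith) hab
    (by linarith)
  obtain ⟨m3, -, -⟩ := hu.memLp_laplacian hΩ hb ha (b := b + r) (by linarith) hbT
  have : IsFiniteMeasure (volume.restrict (Ioo a b ×ˢ Ω)) := ⟨by simpa using hfin⟩
  have hM : ∫⁻ p in Ioo (a - r) (b + r) ×ˢ Ω, ‖timeD u p.1 p.2‖ₑ ^ 2 ≠ ⊤ := by
    have h1 := m3.2
    rw [eLpNorm_lt_top_iff_lintegral_rpow_enorm_lt_top (by norm_num) (by norm_num)] at h1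
    simpa using h1.ne
  have hIoo : ∀ k, ∀ t ∈ Ioo a b, t ∈ Ioo 0 T ∧ t - h k ∈ Ioo 0 T := fun k t ht => by
    have := abs_le.1 (hle k)
    exact ⟨⟨by linarith [ht.1], by linarith [ht.2]⟩, by linarith [ht.1], by linarith [ht.2]⟩
  refine tendsto_integral_inner_of_bounded (ENNReal.rpow_ne_top_of_nonneg (by norm_num) hM) m2 m1
    ?_ (fun k => eLpNorm_two_le_of_lintegral (hu.lintegral_diffQuot_le hΩ ha hbT (h0 k) (hle k)))
    ?_
  · intro k
    have c1 : ContinuousOn (fun p : ℝ × E d => u p.1 p.2) (Ioo a b ×ˢ Ω) :=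
      hu.continuous.mono (prod_mono (fun t ht => (hIoo k t ht).1) subset_closure)
    have c2 : ContinuousOn (fun p : ℝ × E d => u (p.1 - h k) p.2) (Ioo a b ×ˢ Ω) :=
      hu.continuous.comp (f := fun p : ℝ × E d => ((p.1 - h k, p.2) : ℝ × E d)) (by fun_prop)
        fun p hp => ⟨(hIoo k _ hp.1).2, subset_closure hp.2⟩
    exact ((c1.sub c2).const_smul (h k)⁻¹).aestronglyMeasurable hZ
  · filter_upwards [ae_restrict_mem hZ] with p hp
    exact hu.tendsto_diffQuot hΩ (hIoo 0 _ hp.1).1 hp.2 h0 hlim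

end IsSolution

end Solution

/-! ### The evolution of the Dirichlet energy -/

section Primitive

/-- A function with an integral representation is absolutely continuous. -/
lemma absolutelyContinuousOnInterval_of_integral {f h : ℝ → ℝ} {a b : ℝ} (hab : a ≤ b)
    (hi : IntervalIntegrable h volume a b) (hf : ∀ t ∈ Icc a b, f t - f a = ∫ s in a..t, h s) :
    AbsolutelyContinuousOnInterval f a b := by
  have h1 := hi.absolutelyContinuousOnInterval_intervalIntegral (c := a) (by simp)
  have h2 : AbsolutelyContinuousOnInterval (fun _ => f a) a b :=
    (LipschitzWith.const (f a)).lipschitzOnWith.absolutelyContinuousOnInterval (K := 0)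
  have h3 := h1.add h2
  unfold AbsolutelyContinuousOnInterval at h3 ⊢
  refine h3.congr' ?_
  have hmem : ∀ᶠ E in AbsolutelyContinuousOnInterval.totalLengthFilter ⊓
      𝓟 (AbsolutelyContinuousOnInterval.disjWithin a b),
      E ∈ AbsolutelyContinuousOnInterval.disjWithin a b := mem_inf_of_right (mem_principal_self _)
  filter_upwards [hmem] with E hE
  refine Finset.sum_congr rfl fun i hi' => ?_
  have hm := hE.1 i hi'
  rw [uIcc_of_le hab] at hm
  simp only [Pi.add_apply]
  rw [← hf _ hm.1, ← hf _ hm.2]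
  simp

/-- Lebesgue differentiation is applied on an exhaustion of `(0, T)` by compactly contained
intervals, since `h` is only locally integrable. -/
lemma ae_hasDerivAt_of_integral {f h : ℝ → ℝ} {T : ℝ}
    (hi : ∀ a b, 0 < a → a < b → b < T → IntervalIntegrable h volume a b ∧
      f b - f a = ∫ s in a..b, h s) :
    ∀ᵐ t ∂(volume.restrict (Ioo 0 T)), HasDerivAt f (h t) t := by
  have key : ∀ k : ℕ, ∀ᵐ t, t ∈ Ioo (1 / ((k : ℝ) + 1)) (T - 1 / ((k : ℝ) + 1)) →
      HasDerivAt f (h t) t := by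
    intro k
    set a := 1 / ((k : ℝ) + 1) with ha
    set b := T - 1 / ((k : ℝ) + 1) with hb
    have ha0 : 0 < a := by positivity
    have hbT : b < T := by linarith
    by_cases hab : a < b
    · filter_upwards [(hi a b ha0 hab hbT).1.ae_hasDerivAt_integral] with t ht hmem
      rw [uIcc_of_lt hab] at ht
      have h1 := (ht (Ioo_subset_Icc_self hmem) a (left_mem_Icc.2 hab.le)).const_add (f a)
      refine h1.congr_of_eventuallyEq ?_
      filter_upwards [isOpen_Ioo.mem_nhds hmem] with s hs
      rw [← (hi a s ha0 hs.1 (hs.2.trans hbT)).2]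
      ring
    · exact Eventually.of_forall fun t ht => absurd (ht.1.trans ht.2) hab
  rw [ae_restrict_iff' measurableSet_Ioo]
  filter_upwards [ae_all_iff.2 key] with t ht hmem
  obtain ⟨k, hk⟩ := exists_nat_one_div_lt (lt_min hmem.1 (sub_pos.2 hmem.2))
  exact ht k ⟨hk.trans_le (min_le_left _ _), by linarith [hk.trans_le (min_le_right _ _)]⟩

/-- After a change of variables the integrals over the common part cancel, leaving difference
quotients of the primitive of `f` at `b` and at `a`. Signs of `h k` are unrestricted. -/
lemma tendsto_integral_sub_div {f : ℝ → ℝ} {a b T : ℝ} (ha : 0 < a) (hab : a < b) (hbT : b < T)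
    (hf : ContinuousOn f (Ioo 0 T)) {h : ℕ → ℝ} (h0 : ∀ k, h k ≠ 0)
    (hlim : Tendsto h atTop (𝓝 0)) :
    Tendsto (fun k => (h k)⁻¹ * ∫ t in a..b, (f t - f (t - h k))) atTop (𝓝 (f b - f a)) := by
  have ii : ∀ x ∈ Ioo 0 T, ∀ y ∈ Ioo 0 T, IntervalIntegrable f volume x y := fun x hx y hy =>
    (hf.mono (fun z hz => (ordConnected_Ioo.uIcc_subset hx hy) hz)).intervalIntegrable
  have hmem : ∀ x ∈ Ioo 0 T, HasDerivAt (fun y => ∫ t in a..y, f t) (f x) x := fun x hx =>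
    intervalIntegral.integral_hasDerivAt_right (ii a ⟨ha, by linarith⟩ x hx)
      (hf.stronglyMeasurableAtFilter isOpen_Ioo x hx) (hf.continuousAt (isOpen_Ioo.mem_nhds hx))
  have hev : ∀ x ∈ Ioo 0 T, ∀ᶠ k in atTop, x - h k ∈ Ioo 0 T := fun x hx => by
    have : Tendsto (fun k => x - h k) atTop (𝓝 x) := by simpa using hlim.const_sub x
    exact this.eventually (isOpen_Ioo.mem_nhds hx)
  have h2 : Tendsto (fun k => -h k) atTop (𝓝[≠] 0) := by
    refine tendsto_nhdsWithin_iff.2 ⟨by simpa using hlim.neg, Eventually.of_forall fun k => ?_⟩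
    simpa using h0 k
  have ha' : a ∈ Ioo 0 T := ⟨ha, by linarith⟩
  have hb' : b ∈ Ioo 0 T := ⟨by linarith, hbT⟩
  have l1 := (hmem b hb').tendsto_slope_zero.comp h2
  have l2 := (hmem a ha').tendsto_slope_zero.comp h2
  refine (l1.sub l2).congr' ?_
  filter_upwards [hev a ha', hev b hb'] with k ka kb
  have e1 : ∫ t in a..b, (f t - f (t - h k))
      = (∫ t in a..b, f t) - ∫ t in (a - h k)..(b - h k), f t := by
    rw [intervalIntegral.integral_sub (ii a ha' b hb'),
      intervalIntegral.integral_comp_sub_right (fun t => f t)]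
    simpa using (ii _ ka _ kb).comp_sub_right (h k)
  have e2 : ∫ t in (a - h k)..(b - h k), f t
      = (∫ t in a..(b - h k), f t) - ∫ t in a..(a - h k), f t := by
    rw [intervalIntegral.integral_interval_sub_left (ii _ ha' _ kb) (ii _ ha' _ ka)]
  rw [e1, e2]
  simp only [Function.comp_apply, smul_eq_mul, intervalIntegral.integral_same,
    ← sub_eq_add_neg]
  rw [inv_neg]
  ring

end Primitive

section Solution

variable {d n : ℕ} {δ₀ : ℝ} {W : WellPotential n δ₀} {Ω : Set (E d)} {T ε : ℝ}
  {g : E d → E n} {u : ℝ → E d → E n}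

namespace IsSolution

/-- Continuity in H¹ passes to the squared norm by Young's inequality `| |p|² - |q|² | ≤ (1 + 1/l)|p
- q|² + l|q|²` with a free parameter `l`. -/
lemma continuousOn_dirichlet (hu : IsSolution W Ω T ε g u) (hΩ : IsOpen Ω) :
    ContinuousOn (fun t => ∫ x in Ω, gradNorm (u t) x ^ 2) (Ioo 0 T) := by
  intro s hs
  refine ContinuousAt.continuousWithinAt ?_
  have hG := hu.grad_continuous s hs
  have hI := hu.grad_integrable
  have mp : ∀ (r : ℝ) (i : Fin d), AEStronglyMeasurable (partialD (u r) i) (volume.restrict Ω) :=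
    fun r i => (measurable_partialD _ _).aestronglyMeasurable
  have key : ∀ l : ℝ, 0 < l → ∀ t ∈ Ioo 0 T,
      |(∫ x in Ω, gradNorm (u t) x ^ 2) - ∫ x in Ω, gradNorm (u s) x ^ 2|
        ≤ (1 + 1 / l) * (∫ x in Ω, gradNorm (u t - u s) x ^ 2)
          + l * ∫ x in Ω, gradNorm (u s) x ^ 2 := by
    intro l hl t ht
    have iG : IntegrableOn (fun x => gradNorm (u t - u s) x ^ 2) Ω := by
      have h1 : IntegrableOn (fun x => ∑ i, ‖partialD (u t) i x - partialD (u s) i x‖ ^ 2) Ω :=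
        integrable_finsetSum _ fun i _ => integrable_norm_sq_sub (mp t i) (mp s i)
          (hu.integrableOn_sq_partialD ht i) (hu.integrableOn_sq_partialD hs i)
      refine h1.congr_fun (fun x hx => ?_) hΩ.measurableSet
      beta_reduce
      rw [gradNorm_sq]
      exact Finset.sum_congr rfl fun i _ => by rw [hu.partialD_sub hΩ ht hs hx]
    rw [← integral_sub (hI t ht) (hI s hs), ← integral_const_mul, ← integral_const_mul,
      ← integral_add (iG.const_mul _) ((hI s hs).const_mul _)]
    refine (abs_integral_le_integral_abs).trans (setIntegral_mono_on
      ((hI t ht).sub (hI s hs)).abs ((iG.const_mul _).add ((hI s hs).const_mul _))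
      hΩ.measurableSet fun x hx => ?_)
    rw [gradNorm_sq, gradNorm_sq, gradNorm_sq, ← Finset.sum_sub_distrib, Finset.mul_sum,
      Finset.mul_sum, ← Finset.sum_add_distrib]
    refine (Finset.abs_sum_le_sum_abs _ _).trans (Finset.sum_le_sum fun i _ => ?_)
    rw [hu.partialD_sub hΩ ht hs hx]
    set p := partialD (u t) i x
    set q := partialD (u s) i x
    have h1 : |‖p‖ - ‖q‖| ≤ ‖p - q‖ := abs_norm_sub_norm_le p q
    have h2 : |‖p‖ ^ 2 - ‖q‖ ^ 2| = |‖p‖ - ‖q‖| * (‖p‖ + ‖q‖) := by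
      rw [sq_sub_sq, abs_mul, abs_of_nonneg (by positivity), mul_comm]
    have h3 : ‖p‖ ≤ ‖q‖ + ‖p - q‖ := by
      have := norm_add_le q (p - q)
      simpa using this
    rw [h2]
    have h4 : |‖p‖ - ‖q‖| * (‖p‖ + ‖q‖) ≤ ‖p - q‖ * (2 * ‖q‖ + ‖p - q‖) :=
      mul_le_mul h1 (by linarith) (by positivity) (norm_nonneg _)
    refine h4.trans ?_
    have h5 : 2 * (‖p - q‖ * ‖q‖) ≤ 1 / l * ‖p - q‖ ^ 2 + l * ‖q‖ ^ 2 := by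
      have h6 : 0 ≤ 1 / l * (‖p - q‖ - l * ‖q‖) ^ 2 := by positivity
      have h7 : 1 / l * (‖p - q‖ - l * ‖q‖) ^ 2
          = 1 / l * ‖p - q‖ ^ 2 - 2 * (‖p - q‖ * ‖q‖) + l * ‖q‖ ^ 2 := by
        field_simp
        ring
      linarith
    nlinarith
  rw [Metric.continuousAt_iff']
  intro e he
  set K := ∫ x in Ω, gradNorm (u s) x ^ 2
  have hK : 0 ≤ K := integral_nonneg fun x => by positivity
  -- This choice makes the term `l * K` less than `e / 2`; the 1 allows for `K = 0`.
  set l := e / (2 * (K + 1)) with hl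
  have hl0 : 0 < l := by positivity
  have hlK : l * K < e / 2 := by
    rw [hl, div_mul_eq_mul_div, div_lt_div_iff₀ (by positivity) (by positivity)]
    nlinarith
  have hsm := (hG.const_mul (1 + 1 / l)).eventually_lt_const
    (show (1 + 1 / l) * 0 < e / 2 by rw [mul_zero]; positivity)
  filter_upwards [hsm, isOpen_Ioo.mem_nhds hs] with t h1 ht
  rw [Real.dist_eq]
  linarith [key l hl0 t ht]

lemma ae_integrableOn_sq_timeD (hu : IsSolution W Ω T ε g u) {a b : ℝ} (ha : 0 < a) (hab : a < b)
    (hbT : b < T) : ∀ᵐ t ∂(volume.restrict (Ioo a b)),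
      IntegrableOn (fun x => ‖timeD u t x‖ ^ 2) Ω := by
  have h := hu.time_integrable a b ha hab hbT
  rw [IntegrableOn, Measure.volume_eq_prod, ← Measure.prod_restrict] at h
  exact h.prod_right_ae

/-- The Dirichlet energy has the expected derivative, in integrated form. -/
lemma dirichlet_sub_eq (hu : IsSolution W Ω T ε g u) (hΩ : IsOpen Ω)
    (hb : Bornology.IsBounded Ω) {a b : ℝ} (ha : 0 < a) (hab : a < b) (hbT : b < T) :
    (∫ x in Ω, gradNorm (u b) x ^ 2) - ∫ x in Ω, gradNorm (u a) x ^ 2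
      = -2 * ∫ p in Ioo a b ×ˢ Ω,
        inner ℝ (timeD u p.1 p.2 + (ε ^ 2)⁻¹ • gradient W.F (u p.1 p.2)) (timeD u p.1 p.2) := by
  obtain ⟨r, hr0, hra, hrb⟩ : ∃ r, 0 < r ∧ 0 < a - r ∧ b + r < T := by
    refine ⟨min a (T - b) / 2, ?_, ?_, ?_⟩
    · have := lt_min ha (sub_pos.2 hbT)
      positivity
    · linarith [min_le_left a (T - b)]
    · linarith [min_le_right a (T - b)]
  have hcont := hu.continuousOn_dirichlet hΩ
  set A : ℝ → ℝ := fun t => ∫ x in Ω, gradNorm (u t) x ^ 2 with hA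
  set I : ℝ → ℝ := fun h => ∫ p in Ioo a b ×ˢ Ω,
      inner ℝ (timeD u p.1 p.2 + (ε ^ 2)⁻¹ • gradient W.F (u p.1 p.2))
        (h⁻¹ • (u p.1 p.2 - u (p.1 - h) p.2)) with hI
  have hZ : MeasurableSet (Ioo a b ×ˢ Ω) := measurableSet_Ioo.prod hΩ.measurableSet
  obtain ⟨-, m2, hfin⟩ := hu.memLp_laplacian hΩ hb ha hab hbT
  have : IsFiniteMeasure (volume.restrict (Ioo a b ×ˢ Ω)) := ⟨by simpa using hfin⟩
  -- The convexity inequality at the pair of times `t`, `t - h`, integrated over `t`. It holds for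
  -- either sign of `h`, which is decisive below.
  have step : ∀ h : ℝ, h ≠ 0 → |h| ≤ r → (∫ t in a..b, (A t - A (t - h))) ≤ -2 * (h * I h) := by
    intro h h0 hle
    have habs := abs_le.1 hle
    have hIoo : ∀ t ∈ Icc a b, t ∈ Ioo 0 T ∧ t - h ∈ Ioo 0 T := fun t ht =>
      ⟨⟨by linarith [ht.1], by linarith [ht.2]⟩, by linarith [ht.1, habs.2], by linarith [ht.2, habs.1]⟩
    have cu : ContinuousOn (fun p : ℝ × E d => u p.1 p.2 - u (p.1 - h) p.2)
        (Icc a b ×ˢ closure Ω) :=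
      (hu.continuous.mono (prod_mono (fun t ht => (hIoo t ht).1) subset_rfl)).sub
        (hu.continuous.comp (f := fun p : ℝ × E d => ((p.1 - h, p.2) : ℝ × E d)) (by fun_prop)
          fun p hp => ⟨(hIoo _ hp.1).2, hp.2⟩)
    obtain ⟨R, hR⟩ := (isCompact_Icc.prod hb.isCompact_closure).exists_bound_of_continuousOn cu
    have hsubZ : Ioo a b ×ˢ Ω ⊆ Icc a b ×ˢ closure Ω :=
      prod_mono Ioo_subset_Icc_self subset_closure
    have m3 : MemLp (fun p : ℝ × E d => u p.1 p.2 - u (p.1 - h) p.2) 2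
        (volume.restrict (Ioo a b ×ˢ Ω)) := by
      refine MemLp.of_bound ((cu.mono hsubZ).aestronglyMeasurable hZ) R ?_
      filter_upwards [ae_restrict_mem hZ] with p hp using hR p (hsubZ hp)
    have hint : IntegrableOn (fun p : ℝ × E d =>
        inner ℝ (timeD u p.1 p.2 + (ε ^ 2)⁻¹ • gradient W.F (u p.1 p.2))
          (u p.1 p.2 - u (p.1 - h) p.2)) (Ioo a b ×ˢ Ω) :=
      integrable_inner_of_sq m2.1 m3.1 ((memLp_two_iff_integrable_sq_norm m2.1).1 m2)
        ((memLp_two_iff_integrable_sq_norm m3.1).1 m3)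
    have e1 : h * I h = ∫ t in Ioo a b, ∫ x in Ω,
        inner ℝ (timeD u t x + (ε ^ 2)⁻¹ • gradient W.F (u t x)) (u t x - u (t - h) x) := by
      rw [← setIntegral_prod (μ := volume) (ν := volume) (fun p : ℝ × E d =>
        inner ℝ (timeD u p.1 p.2 + (ε ^ 2)⁻¹ • gradient W.F (u p.1 p.2))
          (u p.1 p.2 - u (p.1 - h) p.2)) hint, hI, ← integral_const_mul]
      refine integral_congr_ae (Eventually.of_forall fun p => ?_)
      beta_reduce
      rw [inner_smul_right, mul_inv_cancel_left₀ h0]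
    have hint2 : IntegrableOn (fun t => ∫ x in Ω,
        inner ℝ (timeD u t x + (ε ^ 2)⁻¹ • gradient W.F (u t x)) (u t x - u (t - h) x))
        (Ioo a b) := by
      rw [IntegrableOn, Measure.volume_eq_prod, ← Measure.prod_restrict] at hint
      exact hint.integral_prod_left
    have cA : ContinuousOn (fun t => A t - A (t - h)) (Icc a b) :=
      (hcont.mono fun t ht => (hIoo t ht).1).sub
        (hcont.comp (f := fun t : ℝ => t - h) (by fun_prop) fun t ht => (hIoo t ht).2)
    rw [intervalIntegral.integral_of_le hab.le, integral_Ioc_eq_integral_Ioo, e1,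
      ← integral_const_mul]
    refine integral_mono_ae (cA.integrableOn_Icc.mono_set Ioo_subset_Icc_self)
      (hint2.const_mul _) ?_
    filter_upwards [hu.ae_integrableOn_sq_timeD ha hab hbT, ae_restrict_mem measurableSet_Ioo]
      with t hgood ht
    exact hu.dirichlet_sub_le hΩ hb (hIoo t (Ioo_subset_Icc_self ht)).1
      (hIoo t (Ioo_subset_Icc_self ht)).2 hgood
  set hp : ℕ → ℝ := fun k => r * (1 / ((k : ℝ) + 1)) with hhp
  have hp_pos : ∀ k, 0 < hp k := fun k => by positivity
  have hp_le : ∀ k, hp k ≤ r := fun k => by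
    refine mul_le_of_le_one_right hr0.le ?_
    rw [div_le_one (by positivity)]
    have : (0 : ℝ) ≤ k := by positivity
    linarith
  have hp_lim : Tendsto hp atTop (𝓝 0) := by
    have := (tendsto_one_div_add_atTop_nhds_zero_nat (𝕜 := ℝ)).const_mul r
    rwa [mul_zero] at this
  have lim1 := tendsto_integral_sub_div ha hab hbT hcont (fun k => (hp_pos k).ne') hp_lim
  have lim2 := hu.tendsto_integral_diffQuot hΩ hb hr0 hra hab hrb (fun k => (hp_pos k).ne')
    (fun k => by rw [abs_of_pos (hp_pos k)]; exact hp_le k) hp_lim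
  have lim3 := tendsto_integral_sub_div ha hab hbT hcont
    (fun k => neg_ne_zero.2 (hp_pos k).ne') (by simpa using hp_lim.neg)
  have lim4 := hu.tendsto_integral_diffQuot hΩ hb hr0 hra hab hrb
    (fun k => neg_ne_zero.2 (hp_pos k).ne')
    (fun k => by rw [abs_neg, abs_of_pos (hp_pos k)]; exact hp_le k) (by simpa using hp_lim.neg)
  -- Division by a positive step gives one inequality and by a negative step the reverse. In the
  -- limit the left sides telescope and the right sides converge weakly to the same integral.
  apply le_antisymm
  · refine le_of_tendsto_of_tendsto lim1 (lim2.const_mul (-2)) (Eventually.of_forall fun k => ?_)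
    have h1 := step (hp k) (hp_pos k).ne' (by rw [abs_of_pos (hp_pos k)]; exact hp_le k)
    have h2 := mul_le_mul_of_nonneg_left h1 (inv_pos.2 (hp_pos k)).le
    refine h2.trans (le_of_eq ?_)
    change _ = -2 * I (hp k)
    have := (hp_pos k).ne'
    generalize I (hp k) = y
    generalize hp k = z at this
    field_simp
  · refine le_of_tendsto_of_tendsto (lim4.const_mul (-2)) lim3 (Eventually.of_forall fun k => ?_)
    have h1 := step (-hp k) (neg_ne_zero.2 (hp_pos k).ne')
      (by rw [abs_neg, abs_of_pos (hp_pos k)]; exact hp_le k)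
    have h2 := mul_le_mul_of_nonpos_left h1 (inv_lt_zero.2 (neg_neg_of_pos (hp_pos k))).le
    refine le_trans (le_of_eq ?_) h2
    change -2 * I (-hp k) = _
    have := (hp_pos k).ne'
    generalize I (-hp k) = y
    generalize hp k = z at this
    field_simp

end IsSolution

end Solution

/-! ### The evolution of the modulated energy -/

/-- A `C¹` map is locally Lipschitz, so Rademacher's theorem applies to the composition on small
neighbourhoods; a locally null set is null. -/
lemma ae_differentiableAt_comp {X : Type*} [NormedAddCommGroup X] [NormedSpace ℝ X]
    [FiniteDimensional ℝ X] [MeasurableSpace X] [BorelSpace X] {μ : Measure X} [μ.IsAddHaarMeasure]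
    {n : ℕ} {Z : Set X} (hZ : IsOpen Z) {u : X → E n} (hu : ContDiffOn ℝ 1 u Z) {Φ : E n → ℝ}
    {C : NNReal} (hΦ : LipschitzWith C Φ) :
    ∀ᵐ p ∂(μ.restrict Z), DifferentiableAt ℝ (fun q => Φ (u q)) p := by
  rw [ae_restrict_iff' hZ.measurableSet, ae_iff]
  refine measure_null_of_locally_null _ fun p hp => ?_
  simp only [Classical.not_imp, mem_ofPred_eq] at hp
  obtain ⟨K, s, hs, hK⟩ := (hu.contDiffAt (hZ.mem_nhds hp.1)).exists_lipschitzOnWith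
  obtain ⟨V, hVs, hV, hpV⟩ := mem_nhds_iff.1 hs
  have h1 := (hΦ.comp_lipschitzOnWith (hK.mono hVs)).ae_differentiableWithinAt_of_mem (μ := μ)
  rw [ae_iff] at h1
  refine ⟨_ ∩ V, inter_mem_nhdsWithin _ (hV.mem_nhds hpV), measure_mono_null ?_ h1⟩
  rintro q ⟨hq, hqV⟩
  simp only [Classical.not_imp, mem_ofPred_eq] at hq ⊢
  exact ⟨hqV, fun h => hq.2 (h.differentiableAt (hV.mem_nhds hqV))⟩

/-- The fundamental theorem of calculus in time, integrated in space. -/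
lemma setIntegral_sub_eq_setIntegral_prod {d : ℕ} {Ω : Set (E d)} (hΩ : MeasurableSet Ω)
    {G : ℝ → E d → ℝ} {g : ℝ × E d → ℝ} {a b : ℝ} (hab : a ≤ b)
    (hac : ∀ x ∈ Ω, AbsolutelyContinuousOnInterval (fun t => G t x) a b)
    (hd : ∀ᵐ p ∂(volume.restrict (Ioo a b ×ˢ Ω)), HasDerivAt (fun t => G t p.2) (g p) p.1)
    (hg : IntegrableOn g (Ioo a b ×ˢ Ω)) (ha : IntegrableOn (G a) Ω) (hb : IntegrableOn (G b) Ω) :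
    (∫ x in Ω, G b x) - ∫ x in Ω, G a x = ∫ p in Ioo a b ×ˢ Ω, g p := by
  rw [Measure.volume_eq_prod, ← Measure.prod_restrict] at hd
  rw [IntegrableOn, Measure.volume_eq_prod, ← Measure.prod_restrict] at hg
  rw [← integral_sub hb ha, Measure.volume_eq_prod, ← Measure.prod_restrict,
    integral_prod_symm _ hg]
  -- The factors are swapped so that for almost every `x` the derivative is known for almost every
  -- `t`; absolute continuity in time then gives the fundamental theorem.
  have h1 := Measure.ae_ae_of_ae_prod
    ((Measure.measurePreserving_swap (μ := volume.restrict Ω)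
      (ν := volume.restrict (Ioo a b))).quasiMeasurePreserving.ae hd)
  refine integral_congr_ae ?_
  filter_upwards [h1, ae_restrict_mem hΩ] with x hx hxΩ
  rw [← (hac x hxΩ).integral_deriv_eq_sub, intervalIntegral.integral_of_le hab,
    integral_Ioc_eq_integral_Ioo]
  refine integral_congr_ae ?_
  filter_upwards [hx] with t ht
  exact ht.deriv

/-! ### Slices and derivatives of smooth space-time fields -/

section SpaceTime

variable {d : ℕ} {T : ℝ} {G : Type*} [NormedAddCommGroup G] [NormedSpace ℝ G]

lemma isOpen_spaceTime (T : ℝ) : IsOpen (Ioo 0 T ×ˢ (univ : Set (E d))) :=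
  isOpen_Ioo.prod isOpen_univ

lemma hasFDerivAt_of_contDiffOn {X : ℝ → E d → G} {m : WithTop ℕ∞} (hm : m ≠ 0)
    (hX : ContDiffOn ℝ m (fun p : ℝ × E d => X p.1 p.2) (Ioo 0 T ×ˢ univ)) {t : ℝ}
    (ht : t ∈ Ioo 0 T) (x : E d) : HasFDerivAt (fun p : ℝ × E d => X p.1 p.2)
      (fderiv ℝ (fun p : ℝ × E d => X p.1 p.2) (t, x)) (t, x) :=
  ((hX.differentiableOn hm).differentiableAt
    ((isOpen_spaceTime T).mem_nhds ⟨ht, mem_univ x⟩)).hasFDerivAt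

lemma contDiff_slice {X : ℝ → E d → G} {m : WithTop ℕ∞}
    (hX : ContDiffOn ℝ m (fun p : ℝ × E d => X p.1 p.2) (Ioo 0 T ×ˢ univ)) {t : ℝ}
    (ht : t ∈ Ioo 0 T) : ContDiff ℝ m (X t) := by
  rw [← contDiffOn_univ]
  exact hX.comp (t := Ioo 0 T ×ˢ univ) (f := fun x : E d => ((t, x) : ℝ × E d))
    (contDiff_prodMk_right t).contDiffOn fun x _ => ⟨ht, mem_univ x⟩

lemma contDiffOn_spaceTime_partialD {X : ℝ → E d → G} {m k : WithTop ℕ∞} (hmk : k + 1 ≤ m)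
    (hX : ContDiffOn ℝ m (fun p : ℝ × E d => X p.1 p.2) (Ioo 0 T ×ˢ univ)) (i : Fin d) :
    ContDiffOn ℝ k (fun p : ℝ × E d => partialD (X p.1) i p.2) (Ioo 0 T ×ˢ univ) := by
  have hm : m ≠ 0 := by
    rintro rfl
    simp at hmk
  refine ((hX.fderiv_of_isOpen (isOpen_spaceTime T) hmk).clm_apply
    (contDiffOn_const (c := ((0, EuclideanSpace.single i 1) : ℝ × E d)))).congr fun p hp => ?_
  exact partialD_eq_of_hasFDerivAt (hasFDerivAt_of_contDiffOn hm hX hp.1 p.2) i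

lemma contDiffOn_spaceTime_timeD {X : ℝ → E d → G} {m k : WithTop ℕ∞} (hmk : k + 1 ≤ m)
    (hX : ContDiffOn ℝ m (fun p : ℝ × E d => X p.1 p.2) (Ioo 0 T ×ˢ univ)) :
    ContDiffOn ℝ k (fun p : ℝ × E d => timeD X p.1 p.2) (Ioo 0 T ×ˢ univ) := by
  have hm : m ≠ 0 := by
    rintro rfl
    simp at hmk
  refine ((hX.fderiv_of_isOpen (isOpen_spaceTime T) hmk).clm_apply
    (contDiffOn_const (c := ((1, 0) : ℝ × E d)))).congr fun p hp => ?_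
  exact (timeD_eq_of_hasFDerivAt (hasFDerivAt_of_contDiffOn hm hX hp.1 p.2)).deriv

lemma contDiffOn_spaceTime_divergence {X : ℝ → E d → E d} {m k : WithTop ℕ∞} (hmk : k + 1 ≤ m)
    (hX : ContDiffOn ℝ m (fun p : ℝ × E d => X p.1 p.2) (Ioo 0 T ×ˢ univ)) :
    ContDiffOn ℝ k (fun p : ℝ × E d => divergence (X p.1) p.2) (Ioo 0 T ×ˢ univ) := by
  unfold divergence
  refine ContDiffOn.sum fun i _ => ?_
  have h := contDiffOn_spaceTime_partialD hmk hX i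
  fun_prop

lemma integrableOn_of_continuousOn_spaceTime {f : ℝ × E d → ℝ} {Ω : Set (E d)}
    (hb : Bornology.IsBounded Ω) {a b : ℝ}
    (hf : ContinuousOn f (Icc a b ×ˢ closure Ω)) : IntegrableOn f (Ioo a b ×ˢ Ω) :=
  (hf.integrableOn_compact (isCompact_Icc.prod hb.isCompact_closure)).mono_set
    (prod_mono Ioo_subset_Icc_self subset_closure)

end SpaceTime

/-! ### Differentiating the modulated energy along a solution -/

section ModulatedEnergy

variable {d n : ℕ} {δ₀ : ℝ}

/-- The modulated energy density for a general field `ξ`. -/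
def relDensity (W : WellPotential n δ₀) (ξ : ℝ → E d → E d) (ε : ℝ) (u : ℝ → E d → E n) (t : ℝ)
    (x : E d) : ℝ :=
  ε / 2 * gradNorm (u t) x ^ 2 + 1 / ε * W.F (u t x) - inner ℝ (ξ t x) (gradient (psi W u t) x)

/-- The density of the time derivative of the modulated energy. -/
def relRate (W : WellPotential n δ₀) (ξ : ℝ → E d → E d) (ε : ℝ) (u : ℝ → E d → E n)
    (p : ℝ × E d) : ℝ :=
  -ε * ‖timeD u p.1 p.2‖ ^ 2
    + (timeD (fun s => divergence (ξ s)) p.1 p.2 * psi W u p.1 p.2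
      + divergence (ξ p.1) p.2 * timeD (psi W u) p.1 p.2)

variable {W : WellPotential n δ₀} {Ω : Set (E d)} {T ε : ℝ} {g : E d → E n} {u : ℝ → E d → E n}
  {ξ : ℝ → E d → E d}

lemma norm_fderiv_apply_le_gradNorm {G : Type*} [NormedAddCommGroup G] [NormedSpace ℝ G]
    (v : E d → G) (x h : E d) : ‖fderiv ℝ v x h‖ ≤ gradNorm v x * ‖h‖ := by
  rw [fderiv_eq_sum_partialD]
  refine (norm_sum_le _ _).trans ?_
  simp only [norm_smul]
  refine (Real.sum_mul_le_sqrt_mul_sqrt _ _ _).trans (le_of_eq ?_)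
  rw [mul_comm, EuclideanSpace.norm_eq]
  rfl

lemma WellPotential.continuous_F : Continuous W.F := W.F_smooth.continuous

lemma WellPotential.continuous_dF (hδ : 0 < δ₀) : Continuous W.dF :=
  (W.exists_lipschitzWith_dF hδ).choose_spec.continuous

lemma WellPotential.continuous_sqrt_F : Continuous fun v => Real.sqrt (2 * W.F v) :=
  (continuous_const.mul W.continuous_F).sqrt

namespace IsSolution

/-- The bound holds at every point: where the time derivative does not exist, its default value is
zero. -/
lemma abs_timeD_psi_le (hu : IsSolution W Ω T ε g u) (hΩ : IsOpen Ω) (hδ : 0 < δ₀) {t : ℝ}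
    (ht : t ∈ Ioo 0 T) {x : E d} (hx : x ∈ Ω) :
    |timeD (psi W u) t x| ≤ Real.sqrt (2 * W.F (u t x)) * ‖timeD u t x‖ := by
  by_cases h : DifferentiableAt ℝ (fun s => psi W u s x) t
  · have := abs_apply_le_of_slope (Φ := W.dF) (u := fun s => u s x) (p := t)
      (fun η hη => W.eventually_abs_dF_sub_le hδ (u t x) hη)
      (hu.hasDerivAt_time hΩ ht hx).hasFDerivAt h.hasDerivAt.hasFDerivAt 1
    simpa [timeD] using this
  · rw [timeD, deriv_zero_of_not_differentiableAt h, abs_zero]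
    positivity

lemma norm_gradient_psi_le (hu : IsSolution W Ω T ε g u) (hΩ : IsOpen Ω) (hδ : 0 < δ₀) {t : ℝ}
    (ht : t ∈ Ioo 0 T) {x : E d} (hx : x ∈ Ω) :
    ‖gradient (psi W u t) x‖ ≤ Real.sqrt (2 * W.F (u t x)) * gradNorm (u t) x := by
  by_cases h : DifferentiableAt ℝ (psi W u t) x
  · have h1 := fun v => abs_apply_le_of_slope (Φ := W.dF) (u := u t) (p := x)
      (fun η hη => W.eventually_abs_dF_sub_le hδ (u t x) hη)
      ((hu.contDiffOn_one ht).differentiableOn (by simp)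
        |>.differentiableAt (hΩ.mem_nhds hx)).hasFDerivAt h.hasFDerivAt v
    rw [gradient, LinearIsometryEquiv.norm_map]
    refine ContinuousLinearMap.opNorm_le_bound _
      (mul_nonneg (Real.sqrt_nonneg _) (Real.sqrt_nonneg _)) fun v => (h1 v).trans ?_
    rw [mul_assoc]
    exact mul_le_mul_of_nonneg_left (norm_fderiv_apply_le_gradNorm _ _ _) (Real.sqrt_nonneg _)
  · rw [gradient, fderiv_zero_of_not_differentiableAt h, map_zero, norm_zero]
    exact mul_nonneg (Real.sqrt_nonneg _) (Real.sqrt_nonneg _)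

lemma ae_differentiableAt_psi (hu : IsSolution W Ω T ε g u) (hΩ : IsOpen Ω) (hδ : 0 < δ₀) :
    ∀ᵐ p ∂(volume.restrict (Ioo 0 T ×ˢ Ω)),
      DifferentiableAt ℝ (fun p : ℝ × E d => psi W u p.1 p.2) p :=
  ae_differentiableAt_comp (isOpen_Ioo.prod hΩ) hu.contDiff_one
    (W.exists_lipschitzWith_dF hδ).choose_spec

lemma continuousOn_comp (hu : IsSolution W Ω T ε g u) {G : Type*} [TopologicalSpace G]
    {h : E n → G} (hh : Continuous h) {a b : ℝ} (ha : 0 < a) (hbT : b < T) :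
    ContinuousOn (fun p : ℝ × E d => h (u p.1 p.2)) (Icc a b ×ˢ closure Ω) :=
  hh.comp_continuousOn (hu.continuous.mono
    (prod_mono (fun t (ht : t ∈ Icc a b) => ⟨ha.trans_le ht.1, ht.2.trans_lt hbT⟩) subset_rfl))

lemma integrableOn_comp (hu : IsSolution W Ω T ε g u)
    (hb : Bornology.IsBounded Ω) {t : ℝ} (ht : t ∈ Ioo 0 T) {h : E n → ℝ} (hh : Continuous h) :
    IntegrableOn (fun x => h (u t x)) Ω :=
  ((hh.comp_continuousOn (hu.continuousOn_slice ht)).integrableOn_compact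
    hb.isCompact_closure).mono_set subset_closure

lemma measurable_gradient (f : E d → ℝ) : Measurable (gradient f) :=
  (LinearIsometryEquiv.continuous _).measurable.comp (measurable_fderiv ℝ f)

lemma integrableOn_sq_gradient_psi (hu : IsSolution W Ω T ε g u) (hΩ : IsOpen Ω)
    (hb : Bornology.IsBounded Ω) (hδ : 0 < δ₀) {t : ℝ} (ht : t ∈ Ioo 0 T) :
    IntegrableOn (fun x => ‖gradient (psi W u t) x‖ ^ 2) Ω := by
  obtain ⟨R, hR0, hR⟩ := hu.exists_bound hb ht.1 ht.2 W.continuous_sqrt_F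
  refine ((hu.grad_integrable t ht).const_mul (R ^ 2)).mono'
    ((measurable_gradient _).norm.pow_const 2).aestronglyMeasurable ?_
  filter_upwards [ae_restrict_mem hΩ.measurableSet] with x hx
  rw [Real.norm_of_nonneg (by positivity), ← mul_pow]
  have h1 := hR t ⟨le_rfl, le_rfl⟩ x (subset_closure hx)
  rw [Real.norm_of_nonneg (Real.sqrt_nonneg _)] at h1
  exact pow_le_pow_left₀ (norm_nonneg _) ((hu.norm_gradient_psi_le hΩ hδ ht hx).trans
    (mul_le_mul_of_nonneg_right h1 (Real.sqrt_nonneg _))) 2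

lemma integrableOn_inner_gradient_psi (hu : IsSolution W Ω T ε g u) (hΩ : IsOpen Ω)
    (hb : Bornology.IsBounded Ω) (hδ : 0 < δ₀) {t : ℝ} (ht : t ∈ Ioo 0 T) {X : E d → E d}
    (hX : Continuous X) :
    IntegrableOn (fun x => inner ℝ (X x) (gradient (psi W u t) x)) Ω :=
  integrable_inner_of_sq hX.aestronglyMeasurable (measurable_gradient _).aestronglyMeasurable
    (((hX.norm.pow 2).continuousOn.integrableOn_compact hb.isCompact_closure).mono_set
      subset_closure) (hu.integrableOn_sq_gradient_psi hΩ hb hδ ht)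

lemma integrableOn_relDensity (hu : IsSolution W Ω T ε g u) (hΩ : IsOpen Ω)
    (hb : Bornology.IsBounded Ω) (hδ : 0 < δ₀) {t : ℝ} (ht : t ∈ Ioo 0 T)
    (hξ : Continuous (ξ t)) : IntegrableOn (relDensity W ξ ε u t) Ω :=
  (((hu.grad_integrable t ht).const_mul _).add
    ((hu.integrableOn_comp hb ht W.continuous_F).const_mul _)).sub
      (hu.integrableOn_inner_gradient_psi hΩ hb hδ ht hξ)

lemma integral_inner_gradient_psi (hu : IsSolution W Ω T ε g u) (hΩ : IsOpen Ω) (hδ : 0 < δ₀)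
    {t : ℝ} (ht : t ∈ Ioo 0 T) {X : E d → E d} (hX : ContDiff ℝ 1 X) (hc : HasCompactSupport X)
    (hs : tsupport X ⊆ Ω) :
    ∫ x in Ω, inner ℝ (X x) (gradient (psi W u t) x)
      = -∫ x in Ω, divergence X x * psi W u t x :=
  setIntegral_inner_gradient_comp hΩ hc hs (hu.contDiffOn_one ht)
    (W.exists_lipschitzWith_dF hδ).choose_spec hX subset_rfl

lemma integrableOn_relRate_sub (hu : IsSolution W Ω T ε g u) (hΩ : IsOpen Ω)
    (hb : Bornology.IsBounded Ω) (hδ : 0 < δ₀)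
    (hξ : ContDiffOn ℝ ∞ (fun p : ℝ × E d => ξ p.1 p.2) (Ioo 0 T ×ˢ univ))
    {a b : ℝ} (ha : 0 < a) (hab : a < b) (hbT : b < T) :
    IntegrableOn (fun p : ℝ × E d => timeD (fun s => divergence (ξ s)) p.1 p.2 * psi W u p.1 p.2
      + divergence (ξ p.1) p.2 * timeD (psi W u) p.1 p.2) (Ioo a b ×ˢ Ω) := by
  have hc := contDiffOn_spaceTime_divergence (k := 2) (by norm_cast) hξ
  have hct := contDiffOn_spaceTime_timeD (X := fun s => divergence (ξ s)) (k := 1)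
    (by norm_num) hc
  have hsub : Icc a b ×ˢ closure Ω ⊆ Ioo 0 T ×ˢ univ :=
    prod_mono (fun t (ht : t ∈ Icc a b) => ⟨ha.trans_le ht.1, ht.2.trans_lt hbT⟩) (subset_univ _)
  have hZ : Ioo a b ×ˢ Ω ⊆ Ioo 0 T ×ˢ Ω := prod_mono (Ioo_subset_Ioo ha.le hbT.le) subset_rfl
  have hZm : MeasurableSet (Ioo a b ×ˢ Ω) := measurableSet_Ioo.prod hΩ.measurableSet
  refine Integrable.add ?_ ?_
  · exact integrableOn_of_continuousOn_spaceTime hb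
      ((hct.continuousOn.mono hsub).mul (hu.continuousOn_comp (W.continuous_dF hδ) ha hbT))
  · obtain ⟨R, hR0, hR⟩ := hu.exists_bound hb ha hbT W.continuous_sqrt_F
    -- The time derivative of ψ agrees almost everywhere with the total derivative in direction `(1,
    -- 0)`, and derivatives are always measurable.
    have hm : AEStronglyMeasurable (fun p : ℝ × E d => timeD (psi W u) p.1 p.2)
        (volume.restrict (Ioo a b ×ˢ Ω)) := by
      refine (measurable_fderiv_apply_const ℝ (fun p : ℝ × E d => psi W u p.1 p.2)
        ((1, 0) : ℝ × E d)).aestronglyMeasurable.congr ?_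
      filter_upwards [ae_restrict_of_ae_restrict_of_subset hZ (hu.ae_differentiableAt_psi hΩ hδ)]
        with p hp
      exact (timeD_eq_of_hasFDerivAt hp.hasFDerivAt).deriv.symm
    have hcc := hc.continuousOn.mono hsub
    have := integrable_inner_of_sq (μ := volume.restrict (Ioo a b ×ˢ Ω)) hm
      ((hcc.mono (prod_mono Ioo_subset_Icc_self subset_closure)).aestronglyMeasurable hZm) ?_
      (integrableOn_of_continuousOn_spaceTime hb (hcc.norm.pow 2))
    · simpa [IntegrableOn] using this
    · refine ((hu.time_integrable a b ha hab hbT).const_mul (R ^ 2)).mono' (hm.norm.pow 2) ?_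
      filter_upwards [ae_restrict_mem hZm] with p hp
      rw [Real.norm_of_nonneg (by positivity), ← mul_pow]
      have h1 := hR p.1 (Ioo_subset_Icc_self hp.1) p.2 (subset_closure hp.2)
      rw [Real.norm_of_nonneg (Real.sqrt_nonneg _)] at h1
      exact pow_le_pow_left₀ (norm_nonneg _) ((hu.abs_timeD_psi_le hΩ hδ (hZ hp).1 hp.2).trans
        (mul_le_mul_of_nonneg_right h1 (norm_nonneg _))) 2

lemma integrableOn_relRate (hu : IsSolution W Ω T ε g u) (hΩ : IsOpen Ω)
    (hb : Bornology.IsBounded Ω) (hδ : 0 < δ₀)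
    (hξ : ContDiffOn ℝ ∞ (fun p : ℝ × E d => ξ p.1 p.2) (Ioo 0 T ×ˢ univ))
    {a b : ℝ} (ha : 0 < a) (hab : a < b) (hbT : b < T) :
    IntegrableOn (relRate W ξ ε u) (Ioo a b ×ˢ Ω) :=
  ((hu.time_integrable a b ha hab hbT).const_mul _).add
    (hu.integrableOn_relRate_sub hΩ hb hδ hξ ha hab hbT)

/-- Moving the divergence onto ξ turns the energy into the Dirichlet energy plus the integral of a
density `G` free of derivatives of `u`. That density is absolutely continuous in time at every fixed
point, and the Dirichlet part is `dirichlet_sub_eq`. -/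
lemma relEnergy_sub_eq (hu : IsSolution W Ω T ε g u) (hΩ : IsOpen Ω)
    (hb : Bornology.IsBounded Ω) (hδ : 0 < δ₀) (hε : 0 < ε)
    (hξ : ContDiffOn ℝ ∞ (fun p : ℝ × E d => ξ p.1 p.2) (Ioo 0 T ×ˢ univ))
    (hξc : ∀ t ∈ Ioo 0 T, HasCompactSupport (ξ t)) (hξs : ∀ t ∈ Ioo 0 T, tsupport (ξ t) ⊆ Ω)
    {a b : ℝ} (ha : 0 < a) (hab : a < b) (hbT : b < T) :
    (∫ x in Ω, relDensity W ξ ε u b x) - ∫ x in Ω, relDensity W ξ ε u a x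
      = ∫ p in Ioo a b ×ˢ Ω, relRate W ξ ε u p := by
  have hc := contDiffOn_spaceTime_divergence (k := 2) (by norm_cast) hξ
  have hIcc : ∀ t ∈ Icc a b, t ∈ Ioo 0 T := fun t ht => ⟨ha.trans_le ht.1, ht.2.trans_lt hbT⟩
  have hZ : Ioo a b ×ˢ Ω ⊆ Ioo 0 T ×ˢ Ω := prod_mono (Ioo_subset_Ioo ha.le hbT.le) subset_rfl
  have hZm : MeasurableSet (Ioo a b ×ˢ Ω) := measurableSet_Ioo.prod hΩ.measurableSet
  set G : ℝ → E d → ℝ := fun t x => 1 / ε * W.F (u t x) + divergence (ξ t) x * psi W u t x with hG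
  have hi1 : ∀ t ∈ Ioo 0 T, IntegrableOn (fun x => divergence (ξ t) x * psi W u t x) Ω := by
    intro t ht
    have h1 : Continuous (fun x => divergence (ξ t) x) := by
      rw [← continuousOn_univ]
      exact hc.continuousOn.comp (f := fun x : E d => ((t, x) : ℝ × E d)) (by fun_prop)
        fun x _ => ⟨ht, mem_univ x⟩
    exact ((h1.continuousOn.mul ((W.continuous_dF hδ).comp_continuousOn
      (hu.continuousOn_slice ht))).integrableOn_compact hb.isCompact_closure).mono_set
        subset_closure
  have hiF : ∀ t ∈ Ioo 0 T, IntegrableOn (fun x => 1 / ε * W.F (u t x)) Ω := fun t ht =>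
    (hu.integrableOn_comp hb ht W.continuous_F).const_mul _
  have hE : ∀ t ∈ Ioo 0 T, ∫ x in Ω, relDensity W ξ ε u t x
      = ε / 2 * (∫ x in Ω, gradNorm (u t) x ^ 2) + ∫ x in Ω, G t x := by
    intro t ht
    have hcd : ContDiff ℝ 1 (ξ t) := (contDiff_slice hξ ht).of_le (by norm_cast)
    have hi2 : IntegrableOn (fun x => ε / 2 * gradNorm (u t) x ^ 2 + 1 / ε * W.F (u t x)) Ω :=
      ((hu.grad_integrable t ht).const_mul _).add (hiF t ht)
    unfold relDensity
    rw [integral_sub hi2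
      (hu.integrableOn_inner_gradient_psi hΩ hb hδ ht hcd.continuous),
      integral_add ((hu.grad_integrable t ht).const_mul _) (hiF t ht), integral_const_mul,
      hu.integral_inner_gradient_psi hΩ hδ ht hcd (hξc t ht) (hξs t ht), hG,
      integral_add (hiF t ht) (hi1 t ht)]
    ring
  have hrate := hu.integrableOn_relRate_sub hΩ hb hδ hξ ha hab hbT
  have hFt : IntegrableOn (fun p : ℝ × E d =>
      inner ℝ (gradient W.F (u p.1 p.2)) (timeD u p.1 p.2)) (Ioo a b ×ˢ Ω) :=
    integrable_inner_of_sq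
      (((hu.continuousOn_comp W.continuous_gradient_F ha hbT).mono
        (prod_mono Ioo_subset_Icc_self subset_closure)).aestronglyMeasurable hZm)
      (((hu.continuousOn_timeD hΩ).mono hZ).aestronglyMeasurable hZm)
      (integrableOn_of_continuousOn_spaceTime hb
        ((hu.continuousOn_comp W.continuous_gradient_F ha hbT).norm.pow 2))
      (hu.time_integrable a b ha hab hbT)
  have hGd := setIntegral_sub_eq_setIntegral_prod (Ω := Ω) hΩ.measurableSet (G := G)
    (g := fun p => 1 / ε * inner ℝ (gradient W.F (u p.1 p.2)) (timeD u p.1 p.2)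
      + (timeD (fun s => divergence (ξ s)) p.1 p.2 * psi W u p.1 p.2
        + divergence (ξ p.1) p.2 * timeD (psi W u) p.1 p.2)) hab.le ?_ ?_
    ((hFt.const_mul _).add hrate)
    ((hiF a (hIcc a ⟨le_rfl, hab.le⟩)).add (hi1 a (hIcc a ⟨le_rfl, hab.le⟩)))
    ((hiF b (hIcc b ⟨hab.le, le_rfl⟩)).add (hi1 b (hIcc b ⟨hab.le, le_rfl⟩)))
  · have hdir := hu.dirichlet_sub_eq hΩ hb ha hab hbT
    have e1 : ∫ p in Ioo a b ×ˢ Ω, inner ℝ (timeD u p.1 p.2 + (ε ^ 2)⁻¹ • gradient W.F (u p.1 p.2))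
        (timeD u p.1 p.2) = (∫ p in Ioo a b ×ˢ Ω, ‖timeD u p.1 p.2‖ ^ 2) + (ε ^ 2)⁻¹ *
          ∫ p in Ioo a b ×ˢ Ω, inner ℝ (gradient W.F (u p.1 p.2)) (timeD u p.1 p.2) := by
      rw [← integral_const_mul, ← integral_add (hu.time_integrable a b ha hab hbT)
        (hFt.const_mul _)]
      refine integral_congr_ae (Eventually.of_forall fun p => ?_)
      beta_reduce
      rw [inner_add_left, inner_smul_left, real_inner_self_eq_norm_sq]
      rfl
    rw [integral_add (hFt.const_mul _) hrate, integral_const_mul] at hGd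
    unfold relRate
    rw [hE b (hIcc b ⟨hab.le, le_rfl⟩), hE a (hIcc a ⟨le_rfl, hab.le⟩),
      integral_add ((hu.time_integrable a b ha hab hbT).const_mul _) hrate, integral_const_mul]
    rw [e1] at hdir
    -- The potential part of `Δu · ∂ₜu` is the opposite of the time derivative of `F(u)/ε`, so only
    -- `-ε|∂ₜu|²` survives.
    have : ε / 2 * (-2 * ((∫ p in Ioo a b ×ˢ Ω, ‖timeD u p.1 p.2‖ ^ 2) + (ε ^ 2)⁻¹ *
          ∫ p in Ioo a b ×ˢ Ω, inner ℝ (gradient W.F (u p.1 p.2)) (timeD u p.1 p.2)))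
        = -ε * (∫ p in Ioo a b ×ˢ Ω, ‖timeD u p.1 p.2‖ ^ 2) - 1 / ε *
          ∫ p in Ioo a b ×ˢ Ω, inner ℝ (gradient W.F (u p.1 p.2)) (timeD u p.1 p.2) := by
      field_simp
      ring
    rw [← hdir] at this
    linarith
  · intro x hx
    have cu : ContDiffOn ℝ 1 (fun t => u t x) (uIcc a b) := by
      refine hu.contDiff_one.comp (f := fun t : ℝ => ((t, x) : ℝ × E d))
        (contDiff_prodMk_left x).contDiffOn fun t ht => ?_
      rw [uIcc_of_le hab.le] at ht
      exact ⟨hIcc t ht, hx⟩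
    have cc : ContDiffOn ℝ 1 (fun t => divergence (ξ t) x) (uIcc a b) := by
      refine (hc.of_le (by norm_num)).comp (f := fun t : ℝ => ((t, x) : ℝ × E d))
        (contDiff_prodMk_left x).contDiffOn fun t ht => ?_
      rw [uIcc_of_le hab.le] at ht
      exact ⟨hIcc t ht, mem_univ x⟩
    have cF : ContDiffOn ℝ 1 (fun t => W.F (u t x)) (uIcc a b) :=
      (W.F_smooth.of_le (by norm_num)).comp_contDiffOn cu
    obtain ⟨K, hK⟩ := cu.exists_lipschitzOnWith (by decide) (convex_Icc _ _) isCompact_Icc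
    have cψ : AbsolutelyContinuousOnInterval (fun t => psi W u t x) a b :=
      ((W.exists_lipschitzWith_dF hδ).choose_spec.comp_lipschitzOnWith
        hK).absolutelyContinuousOnInterval
    exact (cF.absolutelyContinuousOnInterval.const_mul _).add
      (cc.absolutelyContinuousOnInterval.mul cψ)
  · filter_upwards [ae_restrict_of_ae_restrict_of_subset hZ (hu.ae_differentiableAt_psi hΩ hδ),
      ae_restrict_mem hZm] with p hp hpZ
    have ht : p.1 ∈ Ioo 0 T := (hZ hpZ).1
    have d1 := hu.hasDerivAt_time hΩ ht hpZ.2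
    have d2 : HasDerivAt (fun s => W.F (u s p.2))
        (inner ℝ (gradient W.F (u p.1 p.2)) (timeD u p.1 p.2)) p.1 := by
      have := (W.differentiable_F (u p.1 p.2)).hasFDerivAt.comp_hasDerivAt p.1 d1
      rwa [← inner_gradient, real_inner_comm] at this
    have d3 : HasDerivAt (fun s => psi W u s p.2) (timeD (psi W u) p.1 p.2) p.1 := by
      have := timeD_eq_of_hasFDerivAt (u := psi W u) (t := p.1) (x := p.2) hp.hasFDerivAt
      rw [timeD, this.deriv]
      exact this
    have d4 : HasDerivAt (fun s => divergence (ξ s) p.2)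
        (timeD (fun s => divergence (ξ s)) p.1 p.2) p.1 := by
      have := timeD_eq_of_hasFDerivAt (u := fun s => divergence (ξ s))
        (hasFDerivAt_of_contDiffOn (X := fun s => divergence (ξ s)) (by simp) hc ht p.2)
      rw [timeD, this.deriv]
      exact this
    exact (d2.const_mul _).add (d4.mul d3)

/-- The modulated energy is absolutely continuous and its time derivative is the integral of the
rate density. -/
lemma relEnergy_evolution (hu : IsSolution W Ω T ε g u) (hΩ : IsOpen Ω)
    (hb : Bornology.IsBounded Ω) (hδ : 0 < δ₀) (hε : 0 < ε)
    (hξ : ContDiffOn ℝ ∞ (fun p : ℝ × E d => ξ p.1 p.2) (Ioo 0 T ×ˢ univ))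
    (hξc : ∀ t ∈ Ioo 0 T, HasCompactSupport (ξ t)) (hξs : ∀ t ∈ Ioo 0 T, tsupport (ξ t) ⊆ Ω) :
    (∀ a b, 0 < a → a ≤ b → b < T →
      AbsolutelyContinuousOnInterval (fun t => ∫ x in Ω, relDensity W ξ ε u t x) a b) ∧
    ∀ᵐ t ∂(volume.restrict (Ioo 0 T)), HasDerivAt (fun t => ∫ x in Ω, relDensity W ξ ε u t x)
      (∫ x in Ω, relRate W ξ ε u (t, x)) t := by
  have key : ∀ a b, 0 < a → a < b → b < T →
      IntervalIntegrable (fun t => ∫ x in Ω, relRate W ξ ε u (t, x)) volume a b ∧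
      (∫ x in Ω, relDensity W ξ ε u b x) - ∫ x in Ω, relDensity W ξ ε u a x
        = ∫ t in a..b, ∫ x in Ω, relRate W ξ ε u (t, x) := by
    intro a b ha hab hbT
    have hi := hu.integrableOn_relRate hΩ hb hδ hξ ha hab hbT
    rw [hu.relEnergy_sub_eq hΩ hb hδ hε hξ hξc hξs ha hab hbT,
      intervalIntegrable_iff_integrableOn_Ioo_of_le hab.le, intervalIntegral.integral_of_le hab.le,
      integral_Ioc_eq_integral_Ioo]
    refine ⟨?_, setIntegral_prod (μ := volume) (ν := volume) _ hi⟩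
    rw [IntegrableOn, Measure.volume_eq_prod, ← Measure.prod_restrict] at hi
    exact hi.integral_prod_left
  refine ⟨fun a b ha hab hbT => ?_, ae_hasDerivAt_of_integral key⟩
  rcases hab.eq_or_lt with rfl | hlt
  · refine absolutelyContinuousOnInterval_of_integral (h := 0) le_rfl (by simp) fun t ht => ?_
    rw [le_antisymm ht.2 ht.1]
    simp
  · refine absolutelyContinuousOnInterval_of_integral hab (key a b ha hlt hbT).1 fun t ht => ?_
    rcases ht.1.eq_or_lt with rfl | hlt'
    · simp
    · exact (key a t ha hlt' (ht.2.trans_lt hbT)).2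

end IsSolution

end ModulatedEnergy

/-! ### Calibrated fields and integral identities at a fixed time -/

section SecondDerivatives

variable {d : ℕ} {G : Type*} [NormedAddCommGroup G] [NormedSpace ℝ G]

lemma hasDerivAt_line {f : E d → G} {x : E d} (hf : DifferentiableAt ℝ f x) (j : Fin d) :
    HasDerivAt (fun s : ℝ => f (x + s • EuclideanSpace.single j 1)) (partialD f j x) 0 := by
  have h := hf.hasFDerivAt.hasLineDerivAt (EuclideanSpace.single j (1 : ℝ))
  exact h

lemma hasDerivAt_coord {f : ℝ → E d} {f' : E d} {s : ℝ} (hf : HasDerivAt f f' s) (i : Fin d) :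
    HasDerivAt (fun r => f r i) (f' i) s :=
  (EuclideanSpace.proj (𝕜 := ℝ) i : E d →L[ℝ] ℝ).hasFDerivAt.comp_hasDerivAt s hf

/-- Partial derivatives of long expressions are computed below by one-variable calculus along
coordinate lines. -/
lemma partialD_eq_of_hasDerivAt_line {f : E d → G} {x : E d} (hf : DifferentiableAt ℝ f x)
    {j : Fin d} {f' : G}
    (h : HasDerivAt (fun s : ℝ => f (x + s • EuclideanSpace.single j 1)) f' 0) :
    partialD f j x = f' := (hasDerivAt_line hf j).unique h

lemma partialD_comm {f : E d → G} {x : E d} (hf : ContDiffAt ℝ 2 f x) (i j : Fin d) :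
    partialD (partialD f i) j x = partialD (partialD f j) i x := by
  have h : DifferentiableAt ℝ (fderiv ℝ f) x :=
    (hf.fderiv_right (m := 1) (by norm_num)).differentiableAt (by simp)
  have e : ∀ i : Fin d, partialD f i = fun y => fderiv ℝ f y (EuclideanSpace.single i 1) :=
    fun _ => rfl
  have e2 : ∀ i j : Fin d, partialD (partialD f i) j x
      = fderiv ℝ (fderiv ℝ f) x (EuclideanSpace.single j 1) (EuclideanSpace.single i 1) := by
    intro i j
    rw [e, partialD, fderiv_clm_apply h (by fun_prop)]
    simp
  rw [e2, e2]
  exact (hf.isSymmSndFDerivAt (by simp)).eq _ _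

/-- Time and space derivatives are entries of the second derivative in space-time, which is
symmetric. -/
lemma fderiv_timeD_comm {X : ℝ → E d → G} {t : ℝ} {x : E d}
    (h2 : ContDiffAt ℝ 2 (fun p : ℝ × E d => X p.1 p.2) (t, x)) (v : E d) :
    HasDerivAt (fun s => fderiv ℝ (X s) x v) (fderiv ℝ (timeD X t) x v) t := by
  have h : HasFDerivAt (fderiv ℝ fun p : ℝ × E d => X p.1 p.2)
      (fderiv ℝ (fderiv ℝ fun p : ℝ × E d => X p.1 p.2) (t, x)) (t, x) :=
    ((h2.fderiv_right (m := 1) (by norm_num)).differentiableAt (by simp)).hasFDerivAt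
  have hsl : ∀ᶠ p : ℝ × E d in 𝓝 (t, x), HasFDerivAt (fun p : ℝ × E d => X p.1 p.2)
      (fderiv ℝ (fun p : ℝ × E d => X p.1 p.2) (p.1, p.2)) (p.1, p.2) := by
    filter_upwards [h2.eventually (by simp)] with p hp
    exact (hp.differentiableAt (by simp)).hasFDerivAt
  have e1 : timeD X t =ᶠ[𝓝 x] fun y => fderiv ℝ (fun p : ℝ × E d => X p.1 p.2) (t, y) (1, 0) := by
    have c : Tendsto (fun y : E d => ((t, y) : ℝ × E d)) (𝓝 x) (𝓝 (t, x)) :=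
      (Continuous.prodMk_right t).tendsto x
    filter_upwards [c.eventually hsl] with y hy
    exact (timeD_eq_of_hasFDerivAt hy).deriv
  have e2 : (fun s => fderiv ℝ (X s) x v) =ᶠ[𝓝 t]
      fun s => fderiv ℝ (fun p : ℝ × E d => X p.1 p.2) (s, x) (0, v) := by
    have c : Tendsto (fun s : ℝ => ((s, x) : ℝ × E d)) (𝓝 t) (𝓝 (t, x)) :=
      (Continuous.prodMk_left x).tendsto t
    filter_upwards [c.eventually hsl] with s hs
    rw [(hasFDerivAt_slice hs).fderiv]
    simp
  have h1 := hasFDerivAt_slice (u := fun s y => fderiv ℝ (fun p : ℝ × E d => X p.1 p.2) (s, y)) h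
  have h3 := timeD_eq_of_hasFDerivAt
    (u := fun s y => fderiv ℝ (fun p : ℝ × E d => X p.1 p.2) (s, y)) h
  refine ((h3.clm_apply (hasDerivAt_const t ((0, v) : ℝ × E d))).congr_of_eventuallyEq
    e2).congr_deriv ?_
  rw [e1.fderiv_eq, (h1.clm_apply (hasFDerivAt_const ((1, 0) : ℝ × E d) x)).fderiv]
  simp only [add_apply, ContinuousLinearMap.comp_apply,
    ContinuousLinearMap.flip_apply, ContinuousLinearMap.inr_apply, map_zero, zero_add, add_zero,
    zero_apply]
  exact (h2.isSymmSndFDerivAt (by simp)).eq _ _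

lemma divergence_timeD {T : ℝ} {X : ℝ → E d → E d}
    (hX : ContDiffOn ℝ ∞ (fun p : ℝ × E d => X p.1 p.2) (Ioo 0 T ×ˢ univ)) {t : ℝ}
    (ht : t ∈ Ioo 0 T) (x : E d) :
    divergence (timeD X t) x = timeD (fun s => divergence (X s)) t x := by
  have h2 : ContDiffAt ℝ 2 (fun p : ℝ × E d => X p.1 p.2) (t, x) :=
    (hX.of_le (by norm_cast)).contDiffAt ((isOpen_spaceTime T).mem_nhds ⟨ht, mem_univ x⟩)
  have hD : ∀ i, HasDerivAt (fun s => partialD (X s) i x i) (partialD (timeD X t) i x i) t :=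
    fun i => hasDerivAt_coord (fderiv_timeD_comm h2 _) i
  have h4 := HasDerivAt.fun_sum (u := Finset.univ) fun i _ => hD i
  rw [timeD]
  simp only [divergence]
  rw [h4.deriv]

/-- The commutator field `∇ · (ξ ⊗ H - H ⊗ ξ)`. -/
def commField (ξ H : E d → E d) (x : E d) : E d :=
  fderiv ℝ ξ x (H x) + divergence H x • ξ x - fderiv ℝ H x (ξ x) - divergence ξ x • H x

lemma contDiff_divergence {X : E d → E d} {m k : WithTop ℕ∞} (hX : ContDiff ℝ m X)
    (hk : k + 1 ≤ m) : ContDiff ℝ k (divergence X) := by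
  unfold divergence
  refine ContDiff.sum fun i _ => ?_
  have : ContDiff ℝ k (partialD X i) := (hX.fderiv_right hk).clm_apply contDiff_const
  fun_prop

lemma contDiff_commField {ξ H : E d → E d} (hξ : ContDiff ℝ 2 ξ) (hH : ContDiff ℝ 2 H) :
    ContDiff ℝ 1 (commField ξ H) := by
  have h1 := contDiff_divergence (k := 1) hξ (by norm_num)
  have h2 := contDiff_divergence (k := 1) hH (by norm_num)
  have h3 := hξ.fderiv_right (m := 1) (by norm_num)
  have h4 := hH.fderiv_right (m := 1) (by norm_num)
  have h5 := hξ.of_le (m := 1) (by norm_num)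
  have h6 := hH.of_le (m := 1) (by norm_num)
  unfold commField
  exact (((h3.clm_apply h6).add (h2.smul h5)).sub (h4.clm_apply h5)).sub (h1.smul h6)

lemma tsupport_commField_subset (ξ H : E d → E d) : tsupport (commField ξ H) ⊆ tsupport ξ := by
  refine closure_minimal (fun x hx => ?_) (isClosed_tsupport ξ)
  by_contra h
  refine hx ?_
  have h0 := image_eq_zero_of_notMem_tsupport h
  have h1 := fderiv_of_notMem_tsupport ℝ h
  have h2 : divergence ξ x = 0 := by
    simp [divergence, partialD_of_notMem_tsupport h]
  simp [commField, h0, h1, h2]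

/-- The commutator field is the row-wise divergence of the antisymmetric matrix `A`, and a double
divergence contracts `A` with symmetric second derivatives. -/
lemma divergence_commField {ξ H : E d → E d} (hξ : ContDiff ℝ 2 ξ) (hH : ContDiff ℝ 2 H)
    (x : E d) : divergence (commField ξ H) x = 0 := by
  let A : Fin d → Fin d → E d → ℝ := fun i j y => H y j * ξ y i - ξ y j * H y i
  have hA : ∀ i j, ContDiff ℝ 2 (A i j) := fun i j => by
    have h1 : ∀ i, ContDiff ℝ 2 (fun y => H y i) := fun i => by fun_prop
    have h2 : ∀ i, ContDiff ℝ 2 (fun y => ξ y i) := fun i => by fun_prop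
    exact ((h1 j).mul (h2 i)).sub ((h2 j).mul (h1 i))
  have dH := hH.differentiable (by simp)
  have dξ := hξ.differentiable (by simp)
  have hline : ∀ {X : E d → E d}, Differentiable ℝ X → ∀ (y : E d) (i j : Fin d),
      HasDerivAt (fun s : ℝ => X (y + s • EuclideanSpace.single j 1) i) (partialD X j y i) 0 :=
    fun hX y i j => hasDerivAt_coord (hasDerivAt_line (hX y) j) i
  have hpA : ∀ i j y, partialD (A i j) j y
      = partialD H j y j * ξ y i + H y j * partialD ξ j y i
        - (partialD ξ j y j * H y i + ξ y j * partialD H j y i) := by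
    intro i j y
    refine partialD_eq_of_hasDerivAt_line ((hA i j).differentiable (by simp) y) ?_
    have := ((hline dH y j j).mul (hline dξ y i j)).sub ((hline dξ y j j).mul (hline dH y i j))
    exact this.congr_deriv (by simp)
  have hV : ∀ i, (fun y => commField ξ H y i) = fun y => ∑ j, partialD (A i j) j y := by
    intro i
    funext y
    simp only [hpA, commField, fderiv_eq_sum_partialD, PiLp.sub_apply, PiLp.add_apply,
      PiLp.smul_apply, smul_eq_mul, divergence, WithLp.ofLp_sum, Finset.sum_apply, WithLp.ofLp_smul,
      Pi.smul_apply, Finset.sum_add_distrib, Finset.sum_sub_distrib, Finset.sum_mul]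
    ring
  rw [divergence_eq ((contDiff_commField hξ hH).differentiable (by simp) x)]
  have h1 : ∀ i, partialD (fun y => commField ξ H y i) i x
      = ∑ j, partialD (partialD (A i j) j) i x := by
    intro i
    rw [hV i, partialD, fderiv_fun_sum fun j _ => ?_]
    · simp [partialD]
    · have : ContDiff ℝ 1 (partialD (A i j) j) :=
        ((hA i j).fderiv_right (m := 1) (by norm_num)).clm_apply contDiff_const
      exact this.differentiable (by simp) x
  simp only [h1]
  have h2 : ∑ i, ∑ j, partialD (partialD (A i j) j) i x
      = -∑ i, ∑ j, partialD (partialD (A i j) j) i x := by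
    conv_lhs => rw [Finset.sum_comm]
    rw [← Finset.sum_neg_distrib]
    refine Finset.sum_congr rfl fun i _ => ?_
    rw [← Finset.sum_neg_distrib]
    refine Finset.sum_congr rfl fun j _ => ?_
    have h3 : A j i = fun y => -A i j y := by
      funext y
      simp only [A]
      ring
    rw [partialD_comm (hA i j).contDiffAt, h3]
    have h4 : ∀ (f : E d → ℝ) k, partialD (fun y => -f y) k = fun y => -partialD f k y := by
      intro f k
      funext y
      simp [partialD, fderiv_fun_neg]
    rw [h4, h4]
  linarith

end SecondDerivatives

/-! ### The energy-stress field and vanishing integrals at a fixed time -/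

section FixedTime

variable {d n : ℕ} {δ₀ : ℝ} {W : WellPotential n δ₀} {Ω : Set (E d)} {T ε : ℝ} {g : E d → E n}
  {u : ℝ → E d → E n}

/-- The energy-stress vector field of a solution in the direction `H`. -/
def stressField (W : WellPotential n δ₀) (ε : ℝ) (v : E d → E n) (H : E d → E d) (j : Fin d)
    (x : E d) : ℝ :=
  ε * ∑ i, H x i * inner ℝ (partialD v i x) (partialD v j x)
    - H x j * (ε / 2 * ∑ i, ‖partialD v i x‖ ^ 2 + 1 / ε * W.F (v x))

lemma tsupport_stressField_subset (v : E d → E n) (H : E d → E d) (j : Fin d) :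
    tsupport (stressField W ε v H j) ⊆ tsupport H := by
  refine closure_mono fun x hx h => hx ?_
  simp only [stressField, h]
  simp

namespace IsSolution

lemma contDiffOn_stressField (hu : IsSolution W Ω T ε g u) (hΩ : IsOpen Ω) {t : ℝ}
    (ht : t ∈ Ioo 0 T) {H : E d → E d} (hH : ContDiff ℝ 1 H) (j : Fin d) :
    ContDiffOn ℝ 1 (stressField W ε (u t) H j) Ω := by
  have hq : ∀ i, ContDiffOn ℝ 1 (partialD (u t) i) Ω := fun i =>
    contDiffOn_partialD hΩ (hu.contDiff_two t ht) (by norm_num) i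
  have hHi : ∀ i, ContDiffOn ℝ 1 (fun x => H x i) Ω := fun i => by
    have : ContDiff ℝ 1 (fun x => H x i) := by fun_prop
    exact this.contDiffOn
  have hF : ContDiffOn ℝ 1 (fun x => W.F (u t x)) Ω :=
    (W.F_smooth.of_le (by norm_num)).comp_contDiffOn (hu.contDiffOn_one ht)
  exact (contDiffOn_const.mul (ContDiffOn.sum fun i _ => (hHi i).mul ((hq i).inner ℝ (hq j)))).sub
    ((hHi j).mul ((contDiffOn_const.mul (ContDiffOn.sum fun i _ => (hq i).norm_sq ℝ)).add
      (contDiffOn_const.mul hF)))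

/-- The stress identity: the mixed second derivatives cancel against the gradient of the Dirichlet
density, and the Laplacian combines with the derivative of the potential into `∂ₜu` through the
equation. First derivatives of `u` and `H` remain. -/
lemma sum_partialD_stressField (hu : IsSolution W Ω T ε g u) (hΩ : IsOpen Ω) (hε : 0 < ε) {t : ℝ}
    (ht : t ∈ Ioo 0 T) {H : E d → E d} (hH : ContDiff ℝ 1 H) {x : E d} (hx : x ∈ Ω) :
    ∑ j, partialD (stressField W ε (u t) H j) j x
      = ε * ∑ j, ∑ i, partialD H j x i * inner ℝ (partialD (u t) i x) (partialD (u t) j x)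
        + ε * ∑ i, H x i * inner ℝ (timeD u t x) (partialD (u t) i x)
        - divergence H x * (ε / 2 * gradNorm (u t) x ^ 2 + 1 / ε * W.F (u t x)) := by
  have hc2 : ContDiffAt ℝ 2 (u t) x := (hu.contDiff_two t ht).contDiffAt (hΩ.mem_nhds hx)
  have hqd : ∀ i, DifferentiableAt ℝ (partialD (u t) i) x := fun i =>
    ((contDiffOn_partialD hΩ (hu.contDiff_two t ht) (k := 1) (by norm_num) i).differentiableOn
      (by simp)).differentiableAt (hΩ.mem_nhds hx)
  set q : Fin d → E n := fun i => partialD (u t) i x with hq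
  set Q : Fin d → Fin d → E n := fun i j => partialD (partialD (u t) i) j x with hQ
  have hsymm : ∀ i j, Q i j = Q j i := fun i j => partialD_comm hc2 i j
  have lq : ∀ i j, HasDerivAt (fun s : ℝ => partialD (u t) i (x + s • EuclideanSpace.single j 1))
      (Q i j) 0 := fun i j => hasDerivAt_line (hqd i) j
  have lH : ∀ i j, HasDerivAt (fun s : ℝ => H (x + s • EuclideanSpace.single j 1) i)
      (partialD H j x i) 0 := fun i j =>
    hasDerivAt_coord (hasDerivAt_line (hH.differentiable (by simp) x) j) i
  have lF : ∀ j, HasDerivAt (fun s : ℝ => W.F (u t (x + s • EuclideanSpace.single j 1)))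
      (inner ℝ (gradient W.F (u t x)) (q j)) 0 := by
    intro j
    have h1 := hasDerivAt_line (f := u t) (hc2.differentiableAt (by simp)) j
    have h2 : HasFDerivAt W.F (fderiv ℝ W.F (u t x))
        (u t (x + (0 : ℝ) • EuclideanSpace.single j 1)) := by
      simpa using (W.differentiable_F (u t x)).hasFDerivAt
    have := h2.comp_hasDerivAt 0 h1
    rwa [← inner_gradient, real_inner_comm] at this
  have hder : ∀ j, partialD (stressField W ε (u t) H j) j x
      = ε * ∑ i, (partialD H j x i * inner ℝ (q i) (q j)
          + H x i * (inner ℝ (q i) (Q j j) + inner ℝ (Q i j) (q j)))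
        - (partialD H j x j * (ε / 2 * ∑ i, ‖q i‖ ^ 2 + 1 / ε * W.F (u t x))
          + H x j * (ε / 2 * ∑ i, 2 * inner ℝ (q i) (Q i j)
            + 1 / ε * inner ℝ (gradient W.F (u t x)) (q j))) := by
    intro j
    refine partialD_eq_of_hasDerivAt_line
      (((hu.contDiffOn_stressField hΩ ht hH j).differentiableOn (by simp)).differentiableAt
        (hΩ.mem_nhds hx)) ?_
    have h1 := (HasDerivAt.fun_sum (u := Finset.univ) fun i _ =>
      (lH i j).mul ((lq i j).inner ℝ (lq j j))).const_mul ε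
    have h2 := (lH j j).mul (((HasDerivAt.fun_sum (u := Finset.univ) fun i _ =>
      (lq i j).norm_sq).const_mul (ε / 2)).add ((lF j).const_mul (1 / ε)))
    have h3 := h1.sub h2
    exact h3.congr_deriv (by simp [hq])
  have hv : timeD u t x = ∑ j, Q j j - (ε ^ 2)⁻¹ • gradient W.F (u t x) := by
    rw [hu.equation t ht x hx, laplacian_eq_sum_partialD hc2]
  -- Symmetry of second derivatives matches the cross terms with the derivative of `|∇u|²/2` along
  -- `H`.
  have hcross : ∑ j, ∑ i, H x i * inner ℝ (Q i j) (q j)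
      = ∑ j, H x j * ∑ i, inner ℝ (q i) (Q i j) := by
    rw [Finset.sum_comm]
    refine Finset.sum_congr rfl fun i _ => ?_
    rw [Finset.mul_sum]
    exact Finset.sum_congr rfl fun j _ => by rw [hsymm i j, real_inner_comm]
  have hlap : ∑ j, ∑ i, H x i * inner ℝ (q i) (Q j j)
      = ∑ i, H x i * inner ℝ (∑ j, Q j j) (q i) := by
    rw [Finset.sum_comm]
    refine Finset.sum_congr rfl fun i _ => ?_
    rw [sum_inner, Finset.mul_sum]
    exact Finset.sum_congr rfl fun j _ => by rw [real_inner_comm]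
  have hvq : ∑ i, H x i * inner ℝ (timeD u t x) (q i)
      = ∑ i, H x i * inner ℝ (∑ j, Q j j) (q i)
        - (ε ^ 2)⁻¹ * ∑ i, H x i * inner ℝ (gradient W.F (u t x)) (q i) := by
    rw [hv, Finset.mul_sum, ← Finset.sum_sub_distrib]
    refine Finset.sum_congr rfl fun i _ => ?_
    rw [inner_sub_left, real_inner_smul_left]
    ring
  have hε2 : ε * (ε ^ 2)⁻¹ = 1 / ε := by
    field_simp
  simp only [hder]
  rw [Finset.sum_sub_distrib, ← Finset.mul_sum, Finset.sum_add_distrib, ← Finset.sum_mul,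
    gradNorm_sq, hvq, ← hlap]
  simp only [Finset.sum_add_distrib, mul_add]
  rw [hcross]
  have e1 : ∑ j, H x j * (ε / 2 * ∑ i, 2 * inner ℝ (q i) (Q i j))
      = ε * ∑ j, H x j * ∑ i, inner ℝ (q i) (Q i j) := by
    rw [Finset.mul_sum]
    refine Finset.sum_congr rfl fun j _ => ?_
    rw [← Finset.mul_sum]
    ring
  have e2 : ∑ j, H x j * (1 / ε * inner ℝ (gradient W.F (u t x)) (q j))
      = 1 / ε * ∑ j, H x j * inner ℝ (gradient W.F (u t x)) (q j) := by
    rw [Finset.mul_sum]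
    exact Finset.sum_congr rfl fun j _ => by ring
  rw [e1, e2, ← hε2]
  simp only [divergence]
  ring

lemma setIntegral_sum_partialD_stressField (hu : IsSolution W Ω T ε g u) (hΩ : IsOpen Ω) {t : ℝ}
    (ht : t ∈ Ioo 0 T) {H : E d → E d} (hH : ContDiff ℝ 1 H) (hc : HasCompactSupport H)
    (hs : tsupport H ⊆ Ω) :
    IntegrableOn (fun x => ∑ j, partialD (stressField W ε (u t) H j) j x) Ω ∧
    ∫ x in Ω, ∑ j, partialD (stressField W ε (u t) H j) j x = 0 := by
  refine ⟨integrable_finsetSum _ fun j _ => Integrable.integrableOn ?_,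
    setIntegral_sum_partialD_eq_zero hΩ hc hs (fun j => tsupport_stressField_subset _ _ j)
      fun j => hu.contDiffOn_stressField hΩ ht hH j⟩
  have h1 := contDiff_of_tsupport_subset hΩ (hu.contDiffOn_stressField (H := H) hΩ ht hH j)
    ((tsupport_stressField_subset _ _ j).trans hs)
  exact (continuous_partialD h1 j).integrable_of_hasCompactSupport
    (hasCompactSupport_partialD (hc.mono' ((subset_tsupport _).trans
      (tsupport_stressField_subset _ _ j))) j)

lemma setIntegral_commField (hu : IsSolution W Ω T ε g u) (hΩ : IsOpen Ω) (hδ : 0 < δ₀) {t : ℝ}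
    (ht : t ∈ Ioo 0 T) {ξ H : E d → E d} (hξ : ContDiff ℝ 2 ξ) (hH : ContDiff ℝ 2 H)
    (hc : HasCompactSupport ξ) (hs : tsupport ξ ⊆ Ω) :
    ∫ x in Ω, inner ℝ (commField ξ H x) (gradient (psi W u t) x) = 0 := by
  have hsub := tsupport_commField_subset ξ H
  rw [hu.integral_inner_gradient_psi hΩ hδ ht (contDiff_commField hξ hH)
    (hc.mono' ((subset_tsupport _).trans hsub)) (hsub.trans hs)]
  simp [divergence_commField hξ hH]

/-- This trades the term `∂ₜ(∇·ξ) ψ` in the energy rate for `∂ₜξ · ∇ψ`, to which the transport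
equation for ξ applies. -/
lemma setIntegral_inner_timeD (hu : IsSolution W Ω T ε g u) (hΩ : IsOpen Ω) (hδ : 0 < δ₀) {t : ℝ}
    (ht : t ∈ Ioo 0 T) {ξ : ℝ → E d → E d}
    (hξ : ContDiffOn ℝ ∞ (fun p : ℝ × E d => ξ p.1 p.2) (Ioo 0 T ×ˢ univ))
    {K : Set (E d)} (hK : IsCompact K) (hKΩ : K ⊆ Ω)
    (hs : ∀ x ∉ K, timeD ξ t x = 0) :
    ∫ x in Ω, inner ℝ (timeD ξ t x) (gradient (psi W u t) x)
      = -∫ x in Ω, timeD (fun s => divergence (ξ s)) t x * psi W u t x := by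
  have hsub : tsupport (timeD ξ t) ⊆ K := closure_minimal
    (fun x hx => by_contra fun h => hx (hs x h)) hK.isClosed
  have hcd : ContDiff ℝ 1 (timeD ξ t) :=
    contDiff_slice (contDiffOn_spaceTime_timeD (by norm_cast) hξ) ht
  rw [hu.integral_inner_gradient_psi hΩ hδ ht hcd
    (hK.of_isClosed_subset (isClosed_tsupport _) hsub) (hsub.trans hKΩ)]
  simp only [divergence_timeD hξ ht]

end IsSolution

end FixedTime

/-! ### The modulated energy inequality for a calibrated field -/

section Pointwise

variable {d : ℕ} {V : Type*} [NormedAddCommGroup V] [InnerProductSpace ℝ V]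

lemma sum_sum_mul_inner_le {C : ℝ} (hC : 0 ≤ C) {M : Fin d → Fin d → ℝ} (hM : ∀ i j, |M i j| ≤ C)
    (r : Fin d → V) : |∑ i, ∑ j, M i j * inner ℝ (r i) (r j)| ≤ C * d * ∑ i, ‖r i‖ ^ 2 := by
  have h1 : ∀ i j, |M i j * inner ℝ (r i) (r j)| ≤ C * ((‖r i‖ ^ 2 + ‖r j‖ ^ 2) / 2) := by
    intro i j
    rw [abs_mul]
    refine mul_le_mul (hM i j) ((abs_real_inner_le_norm _ _).trans ?_) (abs_nonneg _) hC
    linarith [two_mul_le_add_sq ‖r i‖ ‖r j‖]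
  calc |∑ i, ∑ j, M i j * inner ℝ (r i) (r j)|
      ≤ ∑ i, ∑ j, |M i j * inner ℝ (r i) (r j)| :=
        (Finset.abs_sum_le_sum_abs _ _).trans
          (Finset.sum_le_sum fun i _ => Finset.abs_sum_le_sum_abs _ _)
    _ ≤ ∑ i, ∑ j, C * ((‖r i‖ ^ 2 + ‖r j‖ ^ 2) / 2) :=
        Finset.sum_le_sum fun i _ => Finset.sum_le_sum fun j _ => h1 i j
    _ = C * d * ∑ i, ‖r i‖ ^ 2 := by
        simp only [← Finset.mul_sum, ← Finset.sum_div, Finset.sum_add_distrib, Finset.sum_const,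
          Finset.card_univ, Fintype.card_fin, nsmul_eq_mul]
        ring

lemma norm_sum_smul_sq_le (H : E d) (r : Fin d → V) :
    ‖∑ i, H i • r i‖ ^ 2 ≤ ‖H‖ ^ 2 * ∑ i, ‖r i‖ ^ 2 := by
  have h1 : ‖∑ i, H i • r i‖ ≤ ∑ i, ‖H i‖ * ‖r i‖ := by
    refine (norm_sum_le _ _).trans (le_of_eq ?_)
    simp only [norm_smul]
  have h2 := Finset.sum_mul_sq_le_sq_mul_sq Finset.univ (fun i => ‖H i‖) (fun i => ‖r i‖)
  rw [EuclideanSpace.norm_sq_eq]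
  exact (pow_le_pow_left₀ (norm_nonneg _) h1 2).trans h2

/-- The coercivity estimates and the quadratic estimate of the modulated energy density, with
`ε = 1`. -/
lemma quadratic_estimate {a : Fin d → V} {ζ : V} {ξ H : E d} {M : Fin d → Fin d → ℝ}
    {c Φ C : ℝ} (hC : 0 ≤ C) (hζ : ‖ζ‖ ^ 2 ≤ 2 * Φ) (hξ : ‖ξ‖ ≤ 1)
    (hH : ‖H‖ ≤ C) (hM : ∀ i j, |M i j| ≤ C) (halign : ‖H‖ ^ 2 • ξ = (inner ℝ H ξ : ℝ) • H)
    (hstretch : ∑ i, ∑ j, M i j * (ξ i * ξ j) = 0)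
    (hdiv : (c + inner ℝ H ξ) ^ 2 ≤ C * (1 - ‖ξ‖)) :
    ∑ i, ∑ j, M i j * (inner ℝ ζ (a i) * ξ j + ξ i * inner ℝ ζ (a j) - inner ℝ (a i) (a j))
      + c * ∑ i, H i * inner ℝ ζ (a i)
      + (∑ i, M i i) * (1 / 2 * ∑ i, ‖a i‖ ^ 2 + Φ - ∑ i, ξ i * inner ℝ ζ (a i))
      + 1 / 2 * (∑ i, ‖a i‖ ^ 2) * ‖H‖ ^ 2 + 1 / 2 * c ^ 2 * ‖ζ‖ ^ 2
    ≤ (3 * d * C + 2 * C + 2 * C ^ 2)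
      * (1 / 2 * ∑ i, ‖a i‖ ^ 2 + Φ - ∑ i, ξ i * inner ℝ ζ (a i)) := by
  -- The defect from the optimal profile `aᵢ = ξᵢ ζ`; every quantity is expanded in `r` and `ζ`.
  set r : Fin d → V := fun i => a i - ξ i • ζ with hr
  set R := ∑ i, ‖r i‖ ^ 2 with hR
  set h : ℝ := inner ℝ H ξ with hh
  set S := ∑ i, H i • r i with hS
  set Q := ∑ i, ξ i • r i with hQ
  have ha : ∀ i, a i = r i + ξ i • ζ := fun i => by simp [hr]
  have hξ2 : ∑ i, ξ i * ξ i = ‖ξ‖ ^ 2 := by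
    rw [EuclideanSpace.norm_sq_eq]
    exact Finset.sum_congr rfl fun i _ => by rw [Real.norm_eq_abs, sq_abs, sq]
  have hHξ : ∑ i, H i * ξ i = h := by rw [hh, inner_eq_sum]
  have hia : ∀ i, inner ℝ ζ (a i) = inner ℝ ζ (r i) + ξ i * ‖ζ‖ ^ 2 := fun i => by
    rw [ha, inner_add_right, real_inner_smul_right, real_inner_self_eq_norm_sq]
  have eH : ∑ i, H i * inner ℝ ζ (a i) = inner ℝ ζ S + h * ‖ζ‖ ^ 2 := by
    rw [hS, inner_sum, ← hHξ, Finset.sum_mul, ← Finset.sum_add_distrib]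
    exact Finset.sum_congr rfl fun i _ => by rw [hia, real_inner_smul_right]; ring
  have eξ : ∑ i, ξ i * inner ℝ ζ (a i) = inner ℝ ζ Q + ‖ξ‖ ^ 2 * ‖ζ‖ ^ 2 := by
    rw [hQ, inner_sum, ← hξ2, Finset.sum_mul, ← Finset.sum_add_distrib]
    exact Finset.sum_congr rfl fun i _ => by rw [hia, real_inner_smul_right]; ring
  have eA : ∑ i, ‖a i‖ ^ 2 = R + 2 * inner ℝ ζ Q + ‖ξ‖ ^ 2 * ‖ζ‖ ^ 2 := by
    rw [hQ, inner_sum, ← hξ2, Finset.sum_mul, Finset.mul_sum, hR, ← Finset.sum_add_distrib,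
      ← Finset.sum_add_distrib]
    refine Finset.sum_congr rfl fun i _ => ?_
    rw [ha, norm_add_sq_real, real_inner_smul_right, real_inner_smul_right, norm_smul,
      Real.norm_eq_abs, mul_pow, sq_abs, real_inner_comm]
    ring
  have hR0 : 0 ≤ R := Finset.sum_nonneg fun i _ => by positivity
  set e := 1 / 2 * ∑ i, ‖a i‖ ^ 2 + Φ - ∑ i, ξ i * inner ℝ ζ (a i) with he
  have ee : e = 1 / 2 * R - 1 / 2 * ‖ξ‖ ^ 2 * ‖ζ‖ ^ 2 + Φ := by
    rw [he, eA, eξ]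
    ring
  have hΦ : 0 ≤ Φ := by nlinarith [sq_nonneg ‖ζ‖]
  have hn := norm_nonneg ξ
  have hξ1 : ‖ξ‖ ^ 2 ≤ ‖ξ‖ := by nlinarith
  -- Coercivity: the density controls both the squared defect and the potential weighted by `1 -
  -- |ξ|`. The sharp bound on `ζ` and `|ξ| ≤ 1` are needed.
  have c0 : 1 / 2 * R + (1 - ‖ξ‖) * Φ ≤ e := by
    rw [ee]
    have h1 : ‖ξ‖ ^ 2 * ‖ζ‖ ^ 2 ≤ ‖ξ‖ ^ 2 * (2 * Φ) :=
      mul_le_mul_of_nonneg_left hζ (by positivity)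
    nlinarith
  have c1 : R ≤ 2 * e := by nlinarith
  have c2 : (1 - ‖ξ‖) * Φ ≤ e := by linarith
  have he0 : 0 ≤ e := by linarith
  -- Completing the product leaves `-M : r ⊗ r` and a multiple of `M : ξ ⊗ ξ`, which vanishes by
  -- `hstretch`.
  have t1 : ∑ i, ∑ j, M i j * (inner ℝ ζ (a i) * ξ j + ξ i * inner ℝ ζ (a j) - inner ℝ (a i) (a j))
      = -∑ i, ∑ j, M i j * inner ℝ (r i) (r j) := by
    have h2 : ∑ i, ∑ j, M i j * (inner ℝ ζ (a i) * ξ j + ξ i * inner ℝ ζ (a j)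
        - inner ℝ (a i) (a j)) + ∑ i, ∑ j, M i j * inner ℝ (r i) (r j)
        = ‖ζ‖ ^ 2 * ∑ i, ∑ j, M i j * (ξ i * ξ j) := by
      rw [← Finset.sum_add_distrib, Finset.mul_sum]
      refine Finset.sum_congr rfl fun i _ => ?_
      rw [← Finset.sum_add_distrib, Finset.mul_sum]
      refine Finset.sum_congr rfl fun j _ => ?_
      simp only [hr, inner_sub_left, inner_sub_right, real_inner_smul_left, real_inner_smul_right,
        real_inner_self_eq_norm_sq]
      rw [real_inner_comm ζ (a i)]
      ring
    rw [hstretch, mul_zero] at h2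
    linarith
  have t1' : ∑ i, ∑ j, M i j * (inner ℝ ζ (a i) * ξ j + ξ i * inner ℝ ζ (a j) - inner ℝ (a i) (a j))
      ≤ C * d * (2 * e) := by
    rw [t1]
    refine (neg_le_abs _).trans ((sum_sum_mul_inner_le hC hM r).trans ?_)
    exact mul_le_mul_of_nonneg_left c1 (by positivity)
  have t2 : (∑ i, M i i) * e ≤ d * C * e := by
    refine mul_le_mul_of_nonneg_right ?_ he0
    calc ∑ i, M i i ≤ ∑ _i : Fin d, C := Finset.sum_le_sum fun i _ => (le_abs_self _).trans (hM i i)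
      _ = d * C := by simp
  have hHQ : ‖H‖ ^ 2 • Q = h • S := by
    rw [hQ, hS, Finset.smul_sum, Finset.smul_sum]
    refine Finset.sum_congr rfl fun i _ => ?_
    rw [smul_smul, smul_smul]
    congr 1
    have := congrArg (fun v : E d => v i) halign
    simpa using this
  have hHQ' : ‖H‖ ^ 2 * inner ℝ ζ Q = h * inner ℝ ζ S := by
    rw [← real_inner_smul_right, hHQ, real_inner_smul_right]
  have hHξ2 : ‖H‖ ^ 2 * ‖ξ‖ ^ 2 = h ^ 2 := by
    have := congrArg (fun v : E d => inner ℝ v ξ) halign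
    simp only [real_inner_smul_left, real_inner_self_eq_norm_sq] at this
    rw [this, ← hh, sq]
  -- The alignment of `H` and `ξ` converts all contractions with `ξ` into contractions with `H`, so
  -- that `c` appears only in the combination `c + h`.
  have t3 : c * ∑ i, H i * inner ℝ ζ (a i) + 1 / 2 * (∑ i, ‖a i‖ ^ 2) * ‖H‖ ^ 2
      + 1 / 2 * c ^ 2 * ‖ζ‖ ^ 2
      = 1 / 2 * (c + h) ^ 2 * ‖ζ‖ ^ 2 + (c + h) * inner ℝ ζ S + 1 / 2 * ‖H‖ ^ 2 * R := by
    rw [eH, eA]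
    linear_combination hHQ' + 1 / 2 * ‖ζ‖ ^ 2 * hHξ2
  have hS2 : ‖S‖ ^ 2 ≤ ‖H‖ ^ 2 * R := norm_sum_smul_sq_le H r
  have t4 : (c + h) * inner ℝ ζ S ≤ 1 / 2 * (c + h) ^ 2 * ‖ζ‖ ^ 2 + 1 / 2 * ‖S‖ ^ 2 := by
    have h1 := norm_sub_sq_real ((c + h) • ζ) S
    rw [real_inner_smul_left, norm_smul, Real.norm_eq_abs, mul_pow, sq_abs] at h1
    have h2 := sq_nonneg ‖(c + h) • ζ - S‖
    rw [h1] at h2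
    linarith
  have hH2 : ‖H‖ ^ 2 ≤ C ^ 2 := pow_le_pow_left₀ (norm_nonneg _) hH 2
  have t5 : ‖H‖ ^ 2 * R ≤ C ^ 2 * (2 * e) := mul_le_mul hH2 c1 hR0 (by positivity)
  -- The divergence error is paid for by the weighted potential part of the density.
  have t6 : (c + h) ^ 2 * ‖ζ‖ ^ 2 ≤ 2 * C * e := by
    calc (c + h) ^ 2 * ‖ζ‖ ^ 2 ≤ (C * (1 - ‖ξ‖)) * (2 * Φ) :=
          mul_le_mul hdiv hζ (by positivity) (mul_nonneg hC (by linarith))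
      _ = 2 * C * ((1 - ‖ξ‖) * Φ) := by ring
      _ ≤ 2 * C * e := mul_le_mul_of_nonneg_left c2 (by positivity)
  -- The constant collects `2dC` from the quadratic form in `r`, `dC` from the trace, `2C` from the
  -- divergence error and `2C²` from the two terms in `|H|² R`.
  linarith

/-- The quadratic estimate of the modulated energy density. -/
lemma quadratic_estimate_scaled {q : Fin d → V} {w : V} {ξ H : E d} {M : Fin d → Fin d → ℝ}
    {c F C ε : ℝ} (hε : 0 < ε) (hC : 0 ≤ C) (hw : ‖w‖ ^ 2 ≤ 2 * F) (hξ : ‖ξ‖ ≤ 1)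
    (hH : ‖H‖ ≤ C) (hM : ∀ i j, |M i j| ≤ C) (halign : ‖H‖ ^ 2 • ξ = (inner ℝ H ξ : ℝ) • H)
    (hstretch : ∑ i, ∑ j, M i j * (ξ i * ξ j) = 0)
    (hdiv : (c + inner ℝ H ξ) ^ 2 ≤ C * (1 - ‖ξ‖)) :
    ∑ i, ∑ j, M i j * (inner ℝ w (q i) * ξ j + ξ i * inner ℝ w (q j) - ε * inner ℝ (q i) (q j))
      + c * ∑ i, H i * inner ℝ w (q i)
      + (∑ i, M i i) * (ε / 2 * ∑ i, ‖q i‖ ^ 2 + 1 / ε * F - ∑ i, ξ i * inner ℝ w (q i))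
      + ε / 2 * (∑ i, ‖q i‖ ^ 2) * ‖H‖ ^ 2 + 1 / (2 * ε) * c ^ 2 * ‖w‖ ^ 2
    ≤ (3 * d * C + 2 * C + 2 * C ^ 2)
      * (ε / 2 * ∑ i, ‖q i‖ ^ 2 + 1 / ε * F - ∑ i, ξ i * inner ℝ w (q i)) := by
  -- The equipartition scaling `a = √ε q`, `ζ = w/√ε` leaves the mixed products unchanged and
  -- reduces to `ε = 1`.
  set s := Real.sqrt ε with hs
  have hs0 : 0 < s := Real.sqrt_pos.2 hε
  have hs2 : s * s = ε := Real.mul_self_sqrt hε.le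
  have key := quadratic_estimate (a := fun i => s • q i) (ζ := s⁻¹ • w) (Φ := 1 / ε * F) (c := c)
    hC ?_ hξ hH hM halign hstretch hdiv
  · have e1 : ∀ i, inner ℝ (s⁻¹ • w) (s • q i) = inner ℝ w (q i) := fun i => by
      rw [real_inner_smul_left, real_inner_smul_right, ← mul_assoc, inv_mul_cancel₀ hs0.ne',
        one_mul]
    have e2 : ∀ i j, inner ℝ (s • q i) (s • q j) = ε * inner ℝ (q i) (q j) := fun i j => by
      rw [real_inner_smul_left, real_inner_smul_right, ← mul_assoc, hs2]
    have e3 : ∀ i, ‖s • q i‖ ^ 2 = ε * ‖q i‖ ^ 2 := fun i => by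
      rw [norm_smul, mul_pow, Real.norm_eq_abs, sq_abs, sq, hs2]
    have e4 : ‖s⁻¹ • w‖ ^ 2 = 1 / ε * ‖w‖ ^ 2 := by
      rw [norm_smul, mul_pow, Real.norm_eq_abs, sq_abs, inv_pow, sq, hs2, one_div]
    simp only [e1, e2, e3, e4, ← Finset.mul_sum] at key
    refine (le_of_eq ?_).trans (key.trans (le_of_eq ?_))
    · field_simp
    · ring
  · rw [norm_smul, mul_pow, Real.norm_eq_abs, sq_abs, inv_pow, sq s, hs2, inv_eq_one_div]
    calc 1 / ε * ‖w‖ ^ 2 ≤ 1 / ε * (2 * F) := mul_le_mul_of_nonneg_left hw (by positivity)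
      _ = 2 * (1 / ε * F) := by ring

end Pointwise

/-- The properties of the fields `ξ` (extended normal) and `H` (extended mean curvature vector)
that are responsible for the stability of the modulated energy. -/
structure IsCalibration {d : ℕ} (T C : ℝ) (ξ H : ℝ → E d → E d) : Prop where
  nonneg : 0 ≤ C
  smooth : ContDiffOn ℝ ∞ (fun p : ℝ × E d => ξ p.1 p.2) (Ioo 0 T ×ˢ univ)
  smooth_curv : ∀ t ∈ Ioo 0 T, ContDiff ℝ 2 (H t)
  compact : ∀ t ∈ Ioo 0 T, HasCompactSupport (ξ t)
  compact_curv : ∀ t ∈ Ioo 0 T, HasCompactSupport (H t)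
  norm_le : ∀ t ∈ Ioo 0 T, ∀ x, ‖ξ t x‖ ≤ 1
  norm_curv_le : ∀ t ∈ Ioo 0 T, ∀ x, ‖H t x‖ ≤ C
  norm_partialD_curv_le : ∀ t ∈ Ioo 0 T, ∀ i x, ‖partialD (H t) i x‖ ≤ C
  align : ∀ t ∈ Ioo 0 T, ∀ x, ‖H t x‖ ^ 2 • ξ t x = (inner ℝ (H t x) (ξ t x) : ℝ) • H t x
  stretch : ∀ t ∈ Ioo 0 T, ∀ x, inner ℝ (fderiv ℝ (H t) x (ξ t x)) (ξ t x) = 0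
  transport : ∀ t ∈ Ioo 0 T, ∀ x v, inner ℝ (timeD ξ t x) v
    = -inner ℝ (fderiv ℝ (ξ t) x (H t x)) v - inner ℝ (fderiv ℝ (H t) x v) (ξ t x)
  div_le : ∀ t ∈ Ioo 0 T, ∀ x,
    (divergence (ξ t) x + inner ℝ (H t x) (ξ t x)) ^ 2 ≤ C * (1 - ‖ξ t x‖)

lemma inner_fderiv_apply {d : ℕ} (H : E d → E d) (x v y : E d) :
    inner ℝ (fderiv ℝ H x v) y = ∑ i, ∑ j, partialD H i x j * (v i * y j) := by
  rw [fderiv_eq_sum_partialD, sum_inner]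
  refine Finset.sum_congr rfl fun i _ => ?_
  rw [real_inner_smul_left, inner_eq_sum, Finset.mul_sum]
  exact Finset.sum_congr rfl fun j _ => by ring

/-- Weak measurability of the squared norm of a family of vectors that represent measurable
functionals on the ranges of measurable operators. -/
lemma aemeasurable_norm_sq_of_representing {α X : Type*} [MeasurableSpace α] {μ : Measure α}
    [NormedAddCommGroup X] [NormedSpace ℝ X] [TopologicalSpace.SeparableSpace X] {n : ℕ}
    {A : α → X →L[ℝ] E n} {B : α → X →L[ℝ] ℝ} (hA : ∀ h, AEMeasurable (fun x => A x h) μ)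
    (hB : ∀ h, AEMeasurable (fun x => B x h) μ) {w : α → E n}
    (hw : ∀ᵐ x ∂μ, (∀ h, inner ℝ (w x) (A x h) = B x h) ∧ w x ∈ LinearMap.range (A x : X →ₗ[ℝ] E n)) :
    AEMeasurable (fun x => ‖w x‖ ^ 2) μ := by
  have : Nonempty X := ⟨0⟩
  -- Since `w` lies in the range of `A`, `|w|²` is the supremum of `2 B h - |A h|² = |w|² - |w - A
  -- h|²` over `h`. By continuity a dense sequence suffices, so `w` need not be known to be
  -- measurable.
  refine AEMeasurable.isLUB (ι := ℕ) (f := fun k x =>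
    2 * B x (TopologicalSpace.denseSeq X k) - ‖A x (TopologicalSpace.denseSeq X k)‖ ^ 2)
    (fun k => ((hB _).const_mul 2).sub ((hA _).norm.pow_const 2)) ?_
  filter_upwards [hw] with x ⟨h1, h2⟩
  constructor
  · rintro _ ⟨k, rfl⟩
    beta_reduce
    rw [← h1]
    nlinarith [norm_sub_sq_real (w x) (A x (TopologicalSpace.denseSeq X k)),
      sq_nonneg ‖w x - A x (TopologicalSpace.denseSeq X k)‖]
  · intro m hm
    obtain ⟨h, hh⟩ := h2
    have hcl : IsClosed {h : X | 2 * B x h - ‖A x h‖ ^ 2 ≤ m} :=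
      isClosed_le (by fun_prop) continuous_const
    have hall : ∀ h : X, 2 * B x h - ‖A x h‖ ^ 2 ≤ m := fun h =>
      (TopologicalSpace.denseRange_denseSeq X).induction_on h hcl fun k => hm ⟨k, rfl⟩
    have h3 := hall h
    have hh' : A x h = w x := hh
    rw [← h1, hh', real_inner_self_eq_norm_sq] at h3
    linarith

lemma ae_Ioo_of_forall {P : ℝ → Prop} {T : ℝ} (h : ∀ a b, 0 < a → a < b → b < T →
    ∀ᵐ t ∂(volume.restrict (Ioo a b)), P t) : ∀ᵐ t ∂(volume.restrict (Ioo 0 T)), P t := by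
  have key : ∀ k : ℕ, ∀ᵐ t, t ∈ Ioo (1 / ((k : ℝ) + 1)) (T - 1 / ((k : ℝ) + 1)) → P t := by
    intro k
    have ha0 : 0 < 1 / ((k : ℝ) + 1) := by positivity
    by_cases hab : 1 / ((k : ℝ) + 1) < T - 1 / ((k : ℝ) + 1)
    · exact (ae_restrict_iff' measurableSet_Ioo).1 (h _ _ ha0 hab (by linarith))
    · exact Eventually.of_forall fun t ht => absurd (ht.1.trans ht.2) hab
  rw [ae_restrict_iff' measurableSet_Ioo]
  filter_upwards [ae_all_iff.2 key] with t ht hmem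
  obtain ⟨k, hk⟩ := exists_nat_one_div_lt (lt_min hmem.1 (sub_pos.2 hmem.2))
  exact ht k ⟨hk.trans_le (min_le_left _ _), by linarith [hk.trans_le (min_le_right _ _)]⟩

/-! ### The dissipation inequality, pointwise and integrated -/

section Dissipation

variable {d n : ℕ} {δ₀ : ℝ} {W : WellPotential n δ₀} {Ω : Set (E d)} {T ε C : ℝ} {g : E d → E n}
  {u : ℝ → E d → E n} {ξ H : ℝ → E d → E d} {t : ℝ}

namespace IsSolution

lemma genGradient_dF_spec (hu : IsSolution W Ω T ε g u) (hΩ : IsOpen Ω) (hδ : 0 < δ₀)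
    (ht : t ∈ Ioo 0 T) {x : E d} (hx : x ∈ Ω)
    (hψ : DifferentiableAt ℝ (fun p : ℝ × E d => psi W u p.1 p.2) (t, x)) :
    (∀ h, inner ℝ (genGradient W.dF u t x) (fderiv ℝ (fun p : ℝ × E d => u p.1 p.2) (t, x) h)
      = fderiv ℝ (fun p : ℝ × E d => psi W u p.1 p.2) (t, x) h) ∧
    genGradient W.dF u t x ∈ LinearMap.range
      (fderiv ℝ (fun p : ℝ × E d => u p.1 p.2) (t, x) : ℝ × E d →ₗ[ℝ] E n) ∧
    ‖genGradient W.dF u t x‖ ≤ Real.sqrt (2 * W.F (u t x)) :=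
  genGradient_spec (hu.hasFDerivAt hΩ ht hx) (W.exists_lipschitzWith_dF hδ).choose_spec
    (Real.sqrt_nonneg _) (fun _ hη => W.eventually_abs_dF_sub_le hδ _ hη) hψ.hasFDerivAt

lemma inner_genGradient_timeD (hu : IsSolution W Ω T ε g u) (hΩ : IsOpen Ω) (hδ : 0 < δ₀)
    (ht : t ∈ Ioo 0 T) {x : E d} (hx : x ∈ Ω)
    (hψ : DifferentiableAt ℝ (fun p : ℝ × E d => psi W u p.1 p.2) (t, x)) :
    inner ℝ (genGradient W.dF u t x) (timeD u t x) = timeD (psi W u) t x := by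
  rw [hu.timeD_eq hΩ ht hx, (hu.genGradient_dF_spec hΩ hδ ht hx hψ).1]
  exact (timeD_eq_of_hasFDerivAt hψ.hasFDerivAt).deriv.symm

lemma inner_genGradient_partialD (hu : IsSolution W Ω T ε g u) (hΩ : IsOpen Ω) (hδ : 0 < δ₀)
    (ht : t ∈ Ioo 0 T) {x : E d} (hx : x ∈ Ω)
    (hψ : DifferentiableAt ℝ (fun p : ℝ × E d => psi W u p.1 p.2) (t, x)) (i : Fin d) :
    inner ℝ (genGradient W.dF u t x) (partialD (u t) i x) = gradient (psi W u t) x i := by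
  rw [partialD_eq_of_hasFDerivAt (hu.hasFDerivAt hΩ ht hx),
    (hu.genGradient_dF_spec hΩ hδ ht hx hψ).1, gradient_apply]
  exact (partialD_eq_of_hasFDerivAt hψ.hasFDerivAt i).symm

/-- The equation identifies `ε Δu - ε⁻¹ ∂F(u)` with `ε ∂ₜu`. Division by zero being zero, the
formula also covers critical points. -/
lemma curvHeps_apply (hu : IsSolution W Ω T ε g u) (hε : 0 < ε)
    (ht : t ∈ Ioo 0 T) {x : E d} (hx : x ∈ Ω) (i : Fin d) :
    curvHeps W ε u t x i
      = -(ε * inner ℝ (timeD u t x) (partialD (u t) i x)) / gradNorm (u t) x := by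
  unfold curvHeps
  split_ifs with h
  · simp [h]
  · have : ε • Laplacian.laplacian (u t) x - ε⁻¹ • gradient W.F (u t x) = ε • timeD u t x := by
      have h2 : ε * (ε ^ 2)⁻¹ = ε⁻¹ := by field_simp
      rw [hu.laplacian_eq ht hx, smul_add, smul_smul, h2, add_sub_cancel_right]
    simp only [this, real_inner_smul_left]

/-- The factor `|∇u|` removes the quotient: where it vanishes, all partial derivatives do, and both
sides are zero. -/
lemma gradNorm_mul_inner_curvHeps (hu : IsSolution W Ω T ε g u) (hε : 0 < ε)
    (ht : t ∈ Ioo 0 T) {x : E d} (hx : x ∈ Ω) (v : E d) :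
    gradNorm (u t) x * inner ℝ (curvHeps W ε u t x) v
      = -ε * ∑ i, v i * inner ℝ (timeD u t x) (partialD (u t) i x) := by
  rw [inner_eq_sum, Finset.mul_sum, Finset.mul_sum]
  refine Finset.sum_congr rfl fun i _ => ?_
  rw [hu.curvHeps_apply hε ht hx]
  by_cases h : gradNorm (u t) x = 0
  · have h1 : ‖partialD (u t) i x‖ ^ 2 ≤ gradNorm (u t) x ^ 2 := by
      rw [gradNorm_sq]
      exact Finset.single_le_sum (f := fun i => ‖partialD (u t) i x‖ ^ 2)
        (fun _ _ => by positivity) (Finset.mem_univ i)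
    have h2 : partialD (u t) i x = 0 := by
      rw [h] at h1
      have := norm_nonneg (partialD (u t) i x)
      exact norm_eq_zero.1 (by nlinarith)
    simp [h, h2]
  · field_simp

lemma norm_curvHeps_le (hu : IsSolution W Ω T ε g u) (hε : 0 < ε)
    (ht : t ∈ Ioo 0 T) {x : E d} (hx : x ∈ Ω) :
    ‖curvHeps W ε u t x‖ ≤ ε * ‖timeD u t x‖ := by
  by_cases h : gradNorm (u t) x = 0
  · unfold curvHeps
    rw [if_pos h, norm_zero]
    positivity
  · have hg : 0 < gradNorm (u t) x := lt_of_le_of_ne (Real.sqrt_nonneg _) (Ne.symm h)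
    refine le_of_sq_le_sq ?_ (by positivity)
    rw [EuclideanSpace.norm_sq_eq]
    calc ∑ i, ‖curvHeps W ε u t x i‖ ^ 2
        ≤ ∑ i, (ε * ‖timeD u t x‖) ^ 2 / gradNorm (u t) x ^ 2 * ‖partialD (u t) i x‖ ^ 2 := by
          refine Finset.sum_le_sum fun i _ => ?_
          rw [hu.curvHeps_apply hε ht hx, Real.norm_eq_abs, sq_abs, div_pow, neg_sq, mul_pow,
            div_mul_eq_mul_div]
          refine div_le_div_of_nonneg_right ?_ (by positivity)
          rw [mul_pow, mul_assoc, ← mul_pow ‖timeD u t x‖]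
          refine mul_le_mul_of_nonneg_left ?_ (by positivity)
          rw [← sq_abs (inner ℝ _ _)]
          exact pow_le_pow_left₀ (abs_nonneg _) (abs_real_inner_le_norm _ _) 2
      _ = (ε * ‖timeD u t x‖) ^ 2 := by
          rw [← Finset.mul_sum, ← gradNorm_sq]
          field_simp

lemma aestronglyMeasurable_curvHeps (hu : IsSolution W Ω T ε g u) (hΩ : IsOpen Ω) (hε : 0 < ε)
    (ht : t ∈ Ioo 0 T) : AEStronglyMeasurable (curvHeps W ε u t) (volume.restrict Ω) := by
  have mv := hu.aestronglyMeasurable_timeD hΩ ht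
  have mg : Measurable (gradNorm (u t)) :=
    (Finset.measurable_sum _ fun i _ => (measurable_partialD (u t) i).norm.pow_const 2).sqrt
  have h1 : AEMeasurable (fun x => WithLp.toLp 2 fun i : Fin d =>
      -(ε * inner ℝ (timeD u t x) (partialD (u t) i x)) / gradNorm (u t) x)
      (volume.restrict Ω) := by
    refine (WithLp.measurable_toLp 2 (Fin d → ℝ)).comp_aemeasurable
      (aemeasurable_pi_lambda _ fun i => ?_)
    exact (((mv.inner (measurable_partialD (u t) i).aestronglyMeasurable).aemeasurable.const_mul
      ε).neg).div mg.aemeasurable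
  refine h1.aestronglyMeasurable.congr ?_
  filter_upwards [ae_restrict_mem hΩ.measurableSet] with x hx
  ext i
  rw [hu.curvHeps_apply hε ht hx]

lemma integrableOn_sq_timeD_psi (hu : IsSolution W Ω T ε g u) (hΩ : IsOpen Ω)
    (hb : Bornology.IsBounded Ω) (hδ : 0 < δ₀) (ht : t ∈ Ioo 0 T)
    (hv : IntegrableOn (fun x => ‖timeD u t x‖ ^ 2) Ω)
    (hψ : ∀ᵐ x ∂(volume.restrict Ω),
      DifferentiableAt ℝ (fun p : ℝ × E d => psi W u p.1 p.2) (t, x)) :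
    AEStronglyMeasurable (timeD (psi W u) t) (volume.restrict Ω) ∧
    IntegrableOn (fun x => ‖timeD (psi W u) t x‖ ^ 2) Ω := by
  have hm : AEStronglyMeasurable (timeD (psi W u) t) (volume.restrict Ω) := by
    refine ((measurable_fderiv_apply_const ℝ (fun p : ℝ × E d => psi W u p.1 p.2)
      ((1, 0) : ℝ × E d)).comp (measurable_prodMk_left (x := t))).aestronglyMeasurable.congr ?_
    filter_upwards [hψ] with x hx
    exact (timeD_eq_of_hasFDerivAt hx.hasFDerivAt).deriv.symm
  refine ⟨hm, ?_⟩
  obtain ⟨R, hR0, hR⟩ := hu.exists_bound hb ht.1 ht.2 W.continuous_sqrt_F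
  refine (hv.const_mul (R ^ 2)).mono' (hm.norm.pow 2) ?_
  filter_upwards [ae_restrict_mem hΩ.measurableSet] with x hx
  rw [Real.norm_of_nonneg (by positivity), ← mul_pow]
  have h1 := hR t ⟨le_rfl, le_rfl⟩ x (subset_closure hx)
  rw [Real.norm_of_nonneg (Real.sqrt_nonneg _)] at h1
  exact pow_le_pow_left₀ (norm_nonneg _) ((hu.abs_timeD_psi_le hΩ hδ ht hx).trans
    (mul_le_mul_of_nonneg_right h1 (norm_nonneg _))) 2

/-- Only the squared norm of the generalized gradient is shown to be measurable. This suffices,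
since in the expanded third square the mixed term is a multiple of `∂ₜψ`. -/
lemma integrableOn_sq_genGradient (hu : IsSolution W Ω T ε g u) (hΩ : IsOpen Ω)
    (hb : Bornology.IsBounded Ω) (hδ : 0 < δ₀) (ht : t ∈ Ioo 0 T)
    (hψ : ∀ᵐ x ∂(volume.restrict Ω),
      DifferentiableAt ℝ (fun p : ℝ × E d => psi W u p.1 p.2) (t, x))
    {c : E d → ℝ} (hc : Continuous c) :
    IntegrableOn (fun x => c x ^ 2 * ‖genGradient W.dF u t x‖ ^ 2) Ω := by
  have hm : AEMeasurable (fun x => ‖genGradient W.dF u t x‖ ^ 2) (volume.restrict Ω) := by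
    refine aemeasurable_norm_sq_of_representing
      (A := fun x => fderiv ℝ (fun p : ℝ × E d => u p.1 p.2) (t, x))
      (B := fun x => fderiv ℝ (fun p : ℝ × E d => psi W u p.1 p.2) (t, x))
      (fun h => ((measurable_fderiv_apply_const ℝ _ h).comp measurable_prodMk_left).aemeasurable)
      (fun h => ((measurable_fderiv_apply_const ℝ _ h).comp measurable_prodMk_left).aemeasurable) ?_
    filter_upwards [hψ, ae_restrict_mem hΩ.measurableSet] with x hx hxΩ
    have := hu.genGradient_dF_spec hΩ hδ ht hxΩ hx
    exact ⟨this.1, this.2.1⟩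
  have hi : IntegrableOn (fun x => c x ^ 2 * (2 * W.F (u t x))) Ω :=
    (((hc.pow 2).continuousOn.mul (continuousOn_const.mul (W.continuous_F.comp_continuousOn
      (hu.continuousOn_slice ht)))).integrableOn_compact hb.isCompact_closure).mono_set
        subset_closure
  refine hi.mono' ((hc.pow 2).aestronglyMeasurable.mul hm.aestronglyMeasurable) ?_
  filter_upwards [hψ, ae_restrict_mem hΩ.measurableSet] with x hx hxΩ
  rw [Real.norm_of_nonneg (by positivity)]
  refine mul_le_mul_of_nonneg_left ?_ (by positivity)
  have := pow_le_pow_left₀ (norm_nonneg _) (hu.genGradient_dF_spec hΩ hδ ht hxΩ hx).2.2 2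
  rwa [Real.sq_sqrt (by linarith [W.F_nonneg (u t x)])] at this

/-- The pointwise form of the modulated energy inequality. -/
lemma pointwise_dissipation_le (hu : IsSolution W Ω T ε g u) (hΩ : IsOpen Ω) (hδ : 0 < δ₀)
    (hε : 0 < ε) (hcal : IsCalibration T C ξ H) (ht : t ∈ Ioo 0 T) {x : E d} (hx : x ∈ Ω)
    (hψ : DifferentiableAt ℝ (fun p : ℝ × E d => psi W u p.1 p.2) (t, x)) :
    relRate W ξ ε u (t, x)
      + 1 / (2 * ε) * (ε ^ 2 * ‖timeD u t x‖ ^ 2 - ‖curvHeps W ε u t x‖ ^ 2)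
      + 1 / (2 * ε) * ‖curvHeps W ε u t x - (ε * gradNorm (u t) x) • H t x‖ ^ 2
      + 1 / (2 * ε) * ‖ε • timeD u t x - divergence (ξ t) x • genGradient W.dF u t x‖ ^ 2
      - (inner ℝ (timeD ξ t x) (gradient (psi W u t) x)
        + timeD (fun s => divergence (ξ s)) t x * psi W u t x)
      - inner ℝ (commField (ξ t) (H t) x) (gradient (psi W u t) x)
      - ∑ j, partialD (stressField W ε (u t) (H t) j) j x
    ≤ (3 * d * C + 2 * C + 2 * C ^ 2) * relDensity W ξ ε u t x := by
  set w := genGradient W.dF u t x with hw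
  set p := gradient (psi W u t) x with hp
  have hp_eq : ∀ i, p i = inner ℝ w (partialD (u t) i x) := fun i =>
    (hu.inner_genGradient_partialD hΩ hδ ht hx hψ i).symm
  have hwv := hu.inner_genGradient_timeD hΩ hδ ht hx hψ
  have hw2 : ‖w‖ ^ 2 ≤ 2 * W.F (u t x) := by
    have := pow_le_pow_left₀ (norm_nonneg _) (hu.genGradient_dF_spec hΩ hδ ht hx hψ).2.2 2
    rwa [Real.sq_sqrt (by linarith [W.F_nonneg (u t x)])] at this
  have hstretch : ∑ i, ∑ j, partialD (H t) i x j * (ξ t x i * ξ t x j) = 0 := by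
    rw [← inner_fderiv_apply]
    exact hcal.stretch t ht x
  have hM : ∀ i j, |partialD (H t) i x j| ≤ C := fun i j =>
    (PiLp.norm_apply_le _ j).trans (hcal.norm_partialD_curv_le t ht i x)
  have key := quadratic_estimate_scaled (q := fun i => partialD (u t) i x) (w := w)
    (F := W.F (u t x)) (c := divergence (ξ t) x)
    hε hcal.nonneg hw2 (hcal.norm_le t ht x) (hcal.norm_curv_le t ht x) hM
    (hcal.align t ht x) hstretch (hcal.div_le t ht x)
  simp only [← hp_eq] at key
  have eξ : ∑ i, ξ t x i * p i = inner ℝ (ξ t x) p := (inner_eq_sum _ _).symm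
  have eH : ∑ i, H t x i * p i = inner ℝ (H t x) p := (inner_eq_sum _ _).symm
  -- The matrix form splits into the two derivative terms of `H` against `∇ψ`, supplied by the
  -- transport law and the commutator field, and the stress term.
  have e1 : ∑ i, ∑ j, partialD (H t) i x j * (p i * ξ t x j + ξ t x i * p j
        - ε * inner ℝ (partialD (u t) i x) (partialD (u t) j x))
      = inner ℝ (fderiv ℝ (H t) x p) (ξ t x) + inner ℝ (fderiv ℝ (H t) x (ξ t x)) p
        - ε * ∑ j, ∑ i, partialD (H t) j x i * inner ℝ (partialD (u t) i x) (partialD (u t) j x) := by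
    rw [inner_fderiv_apply, inner_fderiv_apply, Finset.mul_sum, ← Finset.sum_add_distrib,
      ← Finset.sum_sub_distrib]
    refine Finset.sum_congr rfl fun i _ => ?_
    rw [Finset.mul_sum, ← Finset.sum_add_distrib, ← Finset.sum_sub_distrib]
    refine Finset.sum_congr rfl fun j _ => ?_
    rw [real_inner_comm (partialD (u t) i x)]
    ring
  rw [eξ, eH, e1, ← gradNorm_sq] at key
  -- With the squares expanded and the three null terms subtracted, the left side equals the
  -- quadratic form exactly; all inequality is in `quadratic_estimate_scaled`.
  refine (le_of_eq ?_).trans (key.trans (le_of_eq rfl))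
  have f1 := hcal.transport t ht x p
  have f2 : inner ℝ (commField (ξ t) (H t) x) p
      = inner ℝ (fderiv ℝ (ξ t) x (H t x)) p + divergence (H t) x * inner ℝ (ξ t x) p
        - inner ℝ (fderiv ℝ (H t) x (ξ t x)) p - divergence (ξ t) x * inner ℝ (H t x) p := by
    simp only [commField, inner_add_left, inner_sub_left, real_inner_smul_left]
  have f3 := hu.sum_partialD_stressField hΩ hε ht
    ((hcal.smooth_curv t ht).of_le (by norm_num : (1 : WithTop ℕ∞) ≤ 2)) hx
  have f4 := hu.gradNorm_mul_inner_curvHeps hε ht hx (H t x)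
  have f5 : ‖curvHeps W ε u t x - (ε * gradNorm (u t) x) • H t x‖ ^ 2
      = ‖curvHeps W ε u t x‖ ^ 2
        + 2 * ε ^ 2 * ∑ i, H t x i * inner ℝ (timeD u t x) (partialD (u t) i x)
        + ε ^ 2 * gradNorm (u t) x ^ 2 * ‖H t x‖ ^ 2 := by
    rw [norm_sub_sq_real, real_inner_smul_right, norm_smul, mul_pow, Real.norm_eq_abs, sq_abs,
      mul_assoc ε, f4]
    ring
  have f6 : ‖ε • timeD u t x - divergence (ξ t) x • w‖ ^ 2
      = ε ^ 2 * ‖timeD u t x‖ ^ 2 - 2 * ε * divergence (ξ t) x * timeD (psi W u) t x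
        + divergence (ξ t) x ^ 2 * ‖w‖ ^ 2 := by
    rw [norm_sub_sq_real, real_inner_smul_right, real_inner_smul_left, norm_smul, norm_smul,
      mul_pow, mul_pow, Real.norm_eq_abs, Real.norm_eq_abs, sq_abs, sq_abs, ← hwv,
      real_inner_comm w]
    ring
  have f7 : ∑ i, partialD (H t) i x i = divergence (H t) x := rfl
  rw [f1, f2, f3, f5, f6, f7]
  unfold relRate
  field_simp
  ring

/-- The modulated energy inequality at a fixed time. -/
lemma dissipation_le (hu : IsSolution W Ω T ε g u) (hΩ : IsOpen Ω) (hb : Bornology.IsBounded Ω)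
    (hδ : 0 < δ₀) (hε : 0 < ε) (hcal : IsCalibration T C ξ H) (ht : t ∈ Ioo 0 T)
    (hξs : tsupport (ξ t) ⊆ Ω) (hHs : tsupport (H t) ⊆ Ω)
    (hv : IntegrableOn (fun x => ‖timeD u t x‖ ^ 2) Ω)
    (hψ : ∀ᵐ x ∂(volume.restrict Ω),
      DifferentiableAt ℝ (fun p : ℝ × E d => psi W u p.1 p.2) (t, x)) :
    IntegrableOn (fun x => ε ^ 2 * ‖timeD u t x‖ ^ 2 - ‖curvHeps W ε u t x‖ ^ 2) Ω ∧
    IntegrableOn (fun x =>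
      ‖curvHeps W ε u t x - (ε * gradNorm (u t) x) • H t x‖ ^ 2) Ω ∧
    IntegrableOn (fun x =>
      ‖ε • timeD u t x - divergence (ξ t) x • genGradient W.dF u t x‖ ^ 2) Ω ∧
    (∫ x in Ω, relRate W ξ ε u (t, x))
      + 1 / (2 * ε) * (∫ x in Ω, (ε ^ 2 * ‖timeD u t x‖ ^ 2 - ‖curvHeps W ε u t x‖ ^ 2))
      + 1 / (2 * ε) * (∫ x in Ω,
          ‖curvHeps W ε u t x - (ε * gradNorm (u t) x) • H t x‖ ^ 2)
      + 1 / (2 * ε) * (∫ x in Ω,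
          ‖ε • timeD u t x - divergence (ξ t) x • genGradient W.dF u t x‖ ^ 2)
    ≤ (3 * d * C + 2 * C + 2 * C ^ 2) * ∫ x in Ω, relDensity W ξ ε u t x := by
  have hΩm := hΩ.measurableSet
  have hξ2 : ContDiff ℝ 2 (ξ t) := (contDiff_slice hcal.smooth ht).of_le (by norm_cast)
  have hH2 := hcal.smooth_curv t ht
  have hc : Continuous (divergence (ξ t)) := (contDiff_divergence (k := 1) hξ2 (by norm_num)).continuous
  have mv := hu.aestronglyMeasurable_timeD hΩ ht
  have mH := hu.aestronglyMeasurable_curvHeps hΩ hε ht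
  have mg : Measurable (gradNorm (u t)) :=
    (Finset.measurable_sum _ fun i _ => (measurable_partialD (u t) i).norm.pow_const 2).sqrt
  have iv2 : IntegrableOn (fun x => ε ^ 2 * ‖timeD u t x‖ ^ 2) Ω := hv.const_mul _
  have iH : IntegrableOn (fun x => ‖curvHeps W ε u t x‖ ^ 2) Ω := by
    refine iv2.mono' (mH.norm.pow 2) ?_
    filter_upwards [ae_restrict_mem hΩm] with x hx
    rw [Real.norm_of_nonneg (by positivity), ← mul_pow]
    exact pow_le_pow_left₀ (norm_nonneg _) (hu.norm_curvHeps_le hε ht hx) 2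
  have igH : IntegrableOn (fun x => ‖(ε * gradNorm (u t) x) • H t x‖ ^ 2) Ω := by
    refine ((hu.grad_integrable t ht).const_mul (ε ^ 2 * C ^ 2)).mono'
      ((((mg.const_mul ε).smul hH2.continuous.measurable).norm.pow_const 2).aestronglyMeasurable) ?_
    refine Eventually.of_forall fun x => ?_
    rw [Real.norm_of_nonneg (by positivity), norm_smul, Real.norm_eq_abs, mul_pow, sq_abs, mul_pow]
    have := pow_le_pow_left₀ (norm_nonneg _) (hcal.norm_curv_le t ht x) 2
    have h3 := mul_le_mul_of_nonneg_left this
      (show 0 ≤ ε ^ 2 * gradNorm (u t) x ^ 2 by positivity)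
    linarith
  have i1 : IntegrableOn (fun x => ε ^ 2 * ‖timeD u t x‖ ^ 2 - ‖curvHeps W ε u t x‖ ^ 2) Ω :=
    iv2.sub iH
  have i2 : IntegrableOn (fun x =>
      ‖curvHeps W ε u t x - (ε * gradNorm (u t) x) • H t x‖ ^ 2) Ω :=
    integrable_norm_sq_sub mH
      ((mg.const_mul ε).smul hH2.continuous.measurable).aestronglyMeasurable iH igH
  obtain ⟨mb, ib⟩ := hu.integrableOn_sq_timeD_psi hΩ hb hδ ht hv hψ
  have icb : IntegrableOn (fun x => divergence (ξ t) x * timeD (psi W u) t x) Ω := by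
    have := integrable_inner_of_sq (μ := volume.restrict Ω) mb hc.aestronglyMeasurable ib
      (((hc.norm.pow 2).continuousOn.integrableOn_compact hb.isCompact_closure).mono_set
        subset_closure)
    simpa [IntegrableOn] using this
  have i3 : IntegrableOn (fun x =>
      ‖ε • timeD u t x - divergence (ξ t) x • genGradient W.dF u t x‖ ^ 2) Ω := by
    refine ((iv2.sub (icb.const_mul (2 * ε))).add
      (hu.integrableOn_sq_genGradient hΩ hb hδ ht hψ hc)).congr ?_
    filter_upwards [hψ, ae_restrict_mem hΩm] with x hx hxΩ
    simp only [Pi.add_apply, Pi.sub_apply]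
    rw [norm_sub_sq_real, real_inner_smul_right, real_inner_smul_left, norm_smul, norm_smul,
      mul_pow, mul_pow, Real.norm_eq_abs, Real.norm_eq_abs, sq_abs, sq_abs,
      ← hu.inner_genGradient_timeD hΩ hδ ht hxΩ hx, real_inner_comm (genGradient W.dF u t x)]
    ring
  have hct : Continuous (fun x => timeD (fun s => divergence (ξ s)) t x) := by
    have h1 := contDiffOn_spaceTime_divergence (k := 2) (by norm_cast) hcal.smooth
    exact (contDiff_slice (contDiffOn_spaceTime_timeD (X := fun s => divergence (ξ s)) (k := 1)
      (by norm_num) h1) ht).continuous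
  have ict : IntegrableOn (fun x => timeD (fun s => divergence (ξ s)) t x * psi W u t x) Ω :=
    ((hct.continuousOn.mul ((W.continuous_dF hδ).comp_continuousOn
      (hu.continuousOn_slice ht))).integrableOn_compact hb.isCompact_closure).mono_set
        subset_closure
  have irate : IntegrableOn (fun x => relRate W ξ ε u (t, x)) Ω :=
    (hv.const_mul (-ε)).add (ict.add icb)
  have hξt : Continuous (timeD ξ t) :=
    (contDiff_slice (contDiffOn_spaceTime_timeD (k := 1) (by norm_cast) hcal.smooth) ht).continuous
  have iξt := hu.integrableOn_inner_gradient_psi hΩ hb hδ ht hξt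
  have iV := hu.integrableOn_inner_gradient_psi hΩ hb hδ ht (contDiff_commField hξ2 hH2).continuous
  obtain ⟨iZ, zZ⟩ := hu.setIntegral_sum_partialD_stressField hΩ ht
    (hH2.of_le (by norm_num : (1 : WithTop ℕ∞) ≤ 2)) (hcal.compact_curv t ht) hHs
  have zV := hu.setIntegral_commField hΩ hδ ht hξ2 hH2 (hcal.compact t ht) hξs
  -- The transport identity tested with `∂ₜξ` itself shows that `∂ₜξ` vanishes off the support of ξ
  -- at the same time.
  have zA := hu.setIntegral_inner_timeD hΩ hδ ht hcal.smooth (hcal.compact t ht) hξs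
    fun x hx => by
      have h := hcal.transport t ht x (timeD ξ t x)
      rw [image_eq_zero_of_notMem_tsupport hx, fderiv_of_notMem_tsupport ℝ hx] at h
      simpa using h
  refine ⟨i1, i2, i3, ?_⟩
  set k := 1 / (2 * ε)
  have j1 : IntegrableOn (fun x => relRate W ξ ε u (t, x)
      + k * (ε ^ 2 * ‖timeD u t x‖ ^ 2 - ‖curvHeps W ε u t x‖ ^ 2)) Ω := irate.add (i1.const_mul k)
  have j2 : IntegrableOn (fun x => relRate W ξ ε u (t, x)
      + k * (ε ^ 2 * ‖timeD u t x‖ ^ 2 - ‖curvHeps W ε u t x‖ ^ 2)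
      + k * ‖curvHeps W ε u t x - (ε * gradNorm (u t) x) • H t x‖ ^ 2) Ω := j1.add (i2.const_mul k)
  have j3 : IntegrableOn (fun x => relRate W ξ ε u (t, x)
      + k * (ε ^ 2 * ‖timeD u t x‖ ^ 2 - ‖curvHeps W ε u t x‖ ^ 2)
      + k * ‖curvHeps W ε u t x - (ε * gradNorm (u t) x) • H t x‖ ^ 2
      + k * ‖ε • timeD u t x - divergence (ξ t) x • genGradient W.dF u t x‖ ^ 2) Ω :=
    j2.add (i3.const_mul k)
  have j4 : IntegrableOn (fun x => inner ℝ (timeD ξ t x) (gradient (psi W u t) x)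
      + timeD (fun s => divergence (ξ s)) t x * psi W u t x) Ω := iξt.add ict
  have j5 : IntegrableOn (fun x => relRate W ξ ε u (t, x)
      + k * (ε ^ 2 * ‖timeD u t x‖ ^ 2 - ‖curvHeps W ε u t x‖ ^ 2)
      + k * ‖curvHeps W ε u t x - (ε * gradNorm (u t) x) • H t x‖ ^ 2
      + k * ‖ε • timeD u t x - divergence (ξ t) x • genGradient W.dF u t x‖ ^ 2
      - (inner ℝ (timeD ξ t x) (gradient (psi W u t) x)
        + timeD (fun s => divergence (ξ s)) t x * psi W u t x)) Ω := j3.sub j4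
  have j6 : IntegrableOn (fun x => relRate W ξ ε u (t, x)
      + k * (ε ^ 2 * ‖timeD u t x‖ ^ 2 - ‖curvHeps W ε u t x‖ ^ 2)
      + k * ‖curvHeps W ε u t x - (ε * gradNorm (u t) x) • H t x‖ ^ 2
      + k * ‖ε • timeD u t x - divergence (ξ t) x • genGradient W.dF u t x‖ ^ 2
      - (inner ℝ (timeD ξ t x) (gradient (psi W u t) x)
        + timeD (fun s => divergence (ξ s)) t x * psi W u t x)
      - inner ℝ (commField (ξ t) (H t) x) (gradient (psi W u t) x)) Ω := j5.sub iV
  have eq : (∫ x in Ω, relRate W ξ ε u (t, x))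
      + k * (∫ x in Ω, (ε ^ 2 * ‖timeD u t x‖ ^ 2 - ‖curvHeps W ε u t x‖ ^ 2))
      + k * (∫ x in Ω, ‖curvHeps W ε u t x - (ε * gradNorm (u t) x) • H t x‖ ^ 2)
      + k * (∫ x in Ω,
          ‖ε • timeD u t x - divergence (ξ t) x • genGradient W.dF u t x‖ ^ 2)
      = ∫ x in Ω, (relRate W ξ ε u (t, x)
      + k * (ε ^ 2 * ‖timeD u t x‖ ^ 2 - ‖curvHeps W ε u t x‖ ^ 2)
      + k * ‖curvHeps W ε u t x - (ε * gradNorm (u t) x) • H t x‖ ^ 2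
      + k * ‖ε • timeD u t x - divergence (ξ t) x • genGradient W.dF u t x‖ ^ 2
      - (inner ℝ (timeD ξ t x) (gradient (psi W u t) x)
        + timeD (fun s => divergence (ξ s)) t x * psi W u t x)
      - inner ℝ (commField (ξ t) (H t) x) (gradient (psi W u t) x)
      - ∑ j, partialD (stressField W ε (u t) (H t) j) j x) := by
    rw [integral_sub j6 iZ, integral_sub j5 iV, integral_sub j3 j4,
      integral_add iξt ict, zA, zV, zZ, integral_add j2 (i3.const_mul k),
      integral_add j1 (i2.const_mul k), integral_add irate (i1.const_mul k), integral_const_mul,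
      integral_const_mul, integral_const_mul]
    ring
  rw [eq, ← integral_const_mul]
  refine integral_mono_ae (j6.sub iZ)
    ((hu.integrableOn_relDensity hΩ hb hδ ht hξ2.continuous).const_mul _) ?_
  filter_upwards [hψ, ae_restrict_mem hΩm] with x hx hxΩ
  exact hu.pointwise_dissipation_le hΩ hδ hε hcal ht hxΩ hx

/-- The modulated energy inequality for a calibrated field. -/
theorem modulated_energy_inequality (hu : IsSolution W Ω T ε g u) (hΩ : IsOpen Ω)
    (hb : Bornology.IsBounded Ω) (hδ : 0 < δ₀) (hε : 0 < ε) (hcal : IsCalibration T C ξ H)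
    (hξs : ∀ t ∈ Ioo 0 T, tsupport (ξ t) ⊆ Ω) (hHs : ∀ t ∈ Ioo 0 T, tsupport (H t) ⊆ Ω) :
    ∀ᵐ t ∂(volume.restrict (Ioo 0 T)),
      DifferentiableAt ℝ (fun t => ∫ x in Ω, relDensity W ξ ε u t x) t ∧
      IntegrableOn (fun x => ε ^ 2 * ‖timeD u t x‖ ^ 2 - ‖curvHeps W ε u t x‖ ^ 2) Ω ∧
      IntegrableOn (fun x =>
        ‖curvHeps W ε u t x - (ε * gradNorm (u t) x) • H t x‖ ^ 2) Ω ∧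
      IntegrableOn (fun x =>
        ‖ε • timeD u t x - divergence (ξ t) x • genGradient W.dF u t x‖ ^ 2) Ω ∧
      deriv (fun t => ∫ x in Ω, relDensity W ξ ε u t x) t
        + 1 / (2 * ε) * (∫ x in Ω, (ε ^ 2 * ‖timeD u t x‖ ^ 2 - ‖curvHeps W ε u t x‖ ^ 2))
        + 1 / (2 * ε) * (∫ x in Ω,
            ‖curvHeps W ε u t x - (ε * gradNorm (u t) x) • H t x‖ ^ 2)
        + 1 / (2 * ε) * (∫ x in Ω,
            ‖ε • timeD u t x - divergence (ξ t) x • genGradient W.dF u t x‖ ^ 2)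
      ≤ (3 * d * C + 2 * C + 2 * C ^ 2) * ∫ x in Ω, relDensity W ξ ε u t x := by
  have h1 := (hu.relEnergy_evolution hΩ hb hδ hε hcal.smooth hcal.compact hξs).2
  have h2 : ∀ᵐ t ∂(volume.restrict (Ioo 0 T)), IntegrableOn (fun x => ‖timeD u t x‖ ^ 2) Ω :=
    ae_Ioo_of_forall fun a b ha hab hbT => hu.ae_integrableOn_sq_timeD ha hab hbT
  have h3 := hu.ae_differentiableAt_psi hΩ hδ
  rw [Measure.volume_eq_prod, ← Measure.prod_restrict] at h3
  filter_upwards [h1, h2, Measure.ae_ae_of_ae_prod h3, ae_restrict_mem measurableSet_Ioo]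
    with t h1 h2 h3 ht
  rw [h1.deriv]
  exact ⟨h1.differentiableAt,
    hu.dissipation_le hΩ hb hδ hε hcal ht (hξs t ht) (hHs t ht) h2 h3⟩

end IsSolution

end Dissipation

/-! ### The signed distance in a tubular neighbourhood -/

section UnitGradient

variable {d : ℕ} {s : E d → ℝ} {V : Set (E d)}

lemma contDiffOn_gradient (hV : IsOpen V) (hs : ContDiffOn ℝ ∞ s V) :
    ContDiffOn ℝ ∞ (gradient s) V := by
  rw [contDiffOn_euclidean]
  intro i
  simp only [gradient_apply]
  exact contDiffOn_partialD hV hs (by norm_cast) i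

lemma hasFDerivAt_gradient (hV : IsOpen V) (hs : ContDiffOn ℝ ∞ s V) {x : E d} (hx : x ∈ V) :
    HasFDerivAt (gradient s) (fderiv ℝ (gradient s) x) x :=
  (((contDiffOn_gradient hV hs).differentiableOn (by simp)).differentiableAt
    (hV.mem_nhds hx)).hasFDerivAt

lemma hasFDerivAt_of_contDiffOn_isOpen {G : Type*} [NormedAddCommGroup G] [NormedSpace ℝ G]
    {s : E d → G} (hV : IsOpen V) (hs : ContDiffOn ℝ ∞ s V) {x : E d} (hx : x ∈ V) :
    HasFDerivAt s (fderiv ℝ s x) x :=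
  ((hs.differentiableOn (by simp)).differentiableAt (hV.mem_nhds hx)).hasFDerivAt

lemma inner_fderiv_gradient_comm (hV : IsOpen V) (hs : ContDiffOn ℝ ∞ s V) {x : E d} (hx : x ∈ V)
    (v w : E d) : inner ℝ (fderiv ℝ (gradient s) x v) w = inner ℝ (fderiv ℝ (gradient s) x w) v := by
  have hc : ContDiffAt ℝ 2 s x := (hs.contDiffAt (hV.mem_nhds hx)).of_le (by norm_cast)
  have h : HasFDerivAt (fderiv ℝ s) (fderiv ℝ (fderiv ℝ s) x) x :=
    ((hc.fderiv_right (m := 1) (by norm_num)).differentiableAt (by simp)).hasFDerivAt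
  have key : ∀ v w : E d, inner ℝ (fderiv ℝ (gradient s) x v) w = fderiv ℝ (fderiv ℝ s) x v w := by
    intro v w
    have h1 := (hasFDerivAt_const w x).inner ℝ (hasFDerivAt_gradient hV hs hx)
    have h2 := h.clm_apply (hasFDerivAt_const w x)
    have h3 : (fun y => inner ℝ w (gradient s y)) = fun y => fderiv ℝ s y w := by
      funext y
      exact inner_gradient s y w
    rw [h3] at h1
    have := congrArg (fun L => L v) (h1.unique h2)
    simp only [ContinuousLinearMap.comp_apply, fderivInnerCLM_apply, ContinuousLinearMap.prod_apply,
      zero_apply, inner_zero_left, add_zero, add_apply, map_zero, zero_add,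
      ContinuousLinearMap.flip_apply] at this
    rw [real_inner_comm]
    exact this
  rw [key, key]
  exact (hc.isSymmSndFDerivAt (by simp)).eq _ _

/-- Differentiation of the eikonal equation `|∇s|² = 1`. -/
lemma inner_fderiv_gradient_self (hV : IsOpen V) (hs : ContDiffOn ℝ ∞ s V)
    (h1 : ∀ x ∈ V, ‖gradient s x‖ = 1) {x : E d} (hx : x ∈ V) (v : E d) :
    inner ℝ (fderiv ℝ (gradient s) x v) (gradient s x) = 0 := by
  have hg := hasFDerivAt_gradient hV hs hx
  have h2 := hg.norm_sq
  have h3 : (fun y => ‖gradient s y‖ ^ 2) =ᶠ[𝓝 x] fun _ => (1 : ℝ) := by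
    filter_upwards [hV.mem_nhds hx] with y hy
    rw [h1 y hy, one_pow]
  have h4 := congrArg (fun L => L v) (h2.unique ((hasFDerivAt_const (1 : ℝ) x).congr_of_eventuallyEq h3))
  rw [real_inner_comm]
  simpa using h4

/-- By symmetry of the Hessian the previous identity says that the normal is constant along normal
lines. -/
lemma fderiv_gradient_apply_gradient (hV : IsOpen V) (hs : ContDiffOn ℝ ∞ s V)
    (h1 : ∀ x ∈ V, ‖gradient s x‖ = 1) {x : E d} (hx : x ∈ V) :
    fderiv ℝ (gradient s) x (gradient s x) = 0 := by
  refine ext_inner_right ℝ fun v => ?_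
  rw [inner_fderiv_gradient_comm hV hs hx, inner_fderiv_gradient_self hV hs h1 hx, inner_zero_left]

lemma fderiv_apply_gradient (h1 : ∀ x ∈ V, ‖gradient s x‖ = 1) {x : E d} (hx : x ∈ V) :
    fderiv ℝ s x (gradient s x) = 1 := by
  rw [← inner_gradient, real_inner_self_eq_norm_sq, h1 x hx, one_pow]

/-- The foot point map is constant in normal directions. -/
lemma hasFDerivAt_foot (hV : IsOpen V) (hs : ContDiffOn ℝ ∞ s V)
    (h1 : ∀ x ∈ V, ‖gradient s x‖ = 1) {x : E d} (hx : x ∈ V) :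
    ∃ L : E d →L[ℝ] E d, HasFDerivAt (fun y => y - s y • gradient s y) L x ∧
      L (gradient s x) = 0 := by
  refine ⟨_, (hasFDerivAt_id x).sub ((hasFDerivAt_of_contDiffOn_isOpen hV hs hx).smul
    (hasFDerivAt_gradient hV hs hx)), ?_⟩
  simp [fderiv_gradient_apply_gradient hV hs h1 hx, fderiv_apply_gradient h1 hx]

end UnitGradient

section Tube

variable {d : ℕ} {U : Set (E d)} {r : ℝ}

lemma isOpen_tube : IsOpen {x | |signedDist U x| < r} :=
  isOpen_lt (lipschitzWith_signedDist.continuous.abs) continuous_const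

lemma norm_gradient_signedDist_le (x : E d) : ‖gradient (signedDist U) x‖ ≤ 1 := by
  rw [gradient, LinearIsometryEquiv.norm_map]
  exact norm_fderiv_le_of_lipschitz ℝ lipschitzWith_signedDist

/-- Along the segment to a nearest frontier point, the 1-Lipschitz bounds from the two endpoints
leave only one possible value of the signed distance. -/
lemma exists_normal_segment (hne : (frontier U).Nonempty) (x : E d) :
    ∃ v : E d, ‖v‖ = |signedDist U x| ∧
      ∀ l ∈ Icc (0 : ℝ) 1, signedDist U (x + l • v) = (1 - l) * signedDist U x := by
  obtain ⟨y, hy, hd⟩ := isClosed_frontier.exists_infDist_eq_dist hne x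
  have hv : ‖y - x‖ = |signedDist U x| := by rw [abs_signedDist, hd, dist_eq_norm, norm_sub_rev]
  refine ⟨y - x, hv, fun l hl => ?_⟩
  have h0 := (mem_frontier_iff_signedDist_eq_zero hne).1 hy
  have h1 := abs_signedDist_sub_le (U := U) (x + l • (y - x)) x
  have h2 := abs_signedDist_sub_le (U := U) (x + l • (y - x)) y
  have e1 : dist (x + l • (y - x)) x = l * |signedDist U x| := by
    rw [dist_eq_norm, add_sub_cancel_left, norm_smul, hv, Real.norm_of_nonneg hl.1]
  have e2 : dist (x + l • (y - x)) y = (1 - l) * |signedDist U x| := by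
    have : x + l • (y - x) - y = (1 - l) • (x - y) := by module
    rw [dist_eq_norm, this, norm_smul, norm_sub_rev x y, hv,
      Real.norm_of_nonneg (by linarith [hl.2])]
  rw [e1] at h1
  rw [e2, h0, sub_zero] at h2
  rw [abs_le] at h1 h2
  rcases abs_cases (signedDist U x) with ⟨h, -⟩ | ⟨h, -⟩ <;> rw [h] at h1 h2 <;> linarith

/-- The derivative along `v` is `-s` while `|v| = |s|` and the gradient has norm at most 1: this is
equality in Cauchy-Schwarz. Only a one-sided derivative at the start of the segment is compared. -/
lemma normal_segment_eq {x v : E d} (hx : DifferentiableAt ℝ (signedDist U) x)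
    (hv : ‖v‖ = |signedDist U x|)
    (hl : ∀ l ∈ Icc (0 : ℝ) 1, signedDist U (x + l • v) = (1 - l) * signedDist U x) :
    v = -(signedDist U x • gradient (signedDist U) x) := by
  have h1 : HasDerivAt (fun l : ℝ => signedDist U (x + l • v)) (fderiv ℝ (signedDist U) x v) 0 :=
    hx.hasFDerivAt.hasLineDerivAt v
  have h2 : HasDerivWithinAt (fun l : ℝ => signedDist U (x + l • v)) (-signedDist U x) (Icc 0 1) 0 := by
    have : HasDerivAt (fun l : ℝ => (1 - l) * signedDist U x) (-signedDist U x) 0 := by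
      simpa using ((hasDerivAt_const (0 : ℝ) (1 : ℝ)).sub (hasDerivAt_id 0)).mul_const
        (signedDist U x)
    exact this.hasDerivWithinAt.congr hl (hl 0 ⟨le_rfl, zero_le_one⟩)
  have h3 := (uniqueDiffOn_Icc zero_lt_one 0 ⟨le_rfl, zero_le_one⟩).eq_deriv _
    h1.hasDerivWithinAt h2
  rw [← inner_gradient] at h3
  have hN := norm_gradient_signedDist_le (U := U) x
  have h4 := norm_add_sq_real v (signedDist U x • gradient (signedDist U) x)
  rw [real_inner_smul_right, h3, hv, norm_smul, mul_pow, Real.norm_eq_abs, sq_abs] at h4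
  have hN2 : ‖gradient (signedDist U) x‖ ^ 2 ≤ 1 := pow_le_one₀ (norm_nonneg _) hN
  have h5 : ‖v + signedDist U x • gradient (signedDist U) x‖ ^ 2 ≤ 0 := by
    rw [h4]
    nlinarith [sq_nonneg (signedDist U x)]
  have h6 : v + signedDist U x • gradient (signedDist U) x = 0 := by
    rw [← norm_eq_zero]
    exact pow_eq_zero_iff two_ne_zero |>.1 (le_antisymm h5 (by positivity))
  exact eq_neg_of_add_eq_zero_left h6

lemma signedDist_sub_smul_gradient (hne : (frontier U).Nonempty) {x : E d}
    (hx : DifferentiableAt ℝ (signedDist U) x) {l : ℝ} (hl : l ∈ Icc (0 : ℝ) 1) :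
    signedDist U (x - l • signedDist U x • gradient (signedDist U) x)
      = (1 - l) * signedDist U x := by
  obtain ⟨v, hv, h⟩ := exists_normal_segment hne x
  have := h l hl
  rwa [normal_segment_eq hx hv h, smul_neg, ← sub_eq_add_neg] at this

lemma norm_gradient_signedDist (hU : IsOpen U) (hne : (frontier U).Nonempty)
    (hs : ContDiffOn ℝ ∞ (signedDist U) {x | |signedDist U x| < r}) {x : E d}
    (hx : |signedDist U x| < r) : ‖gradient (signedDist U) x‖ = 1 := by
  have key : ∀ y, |signedDist U y| < r → signedDist U y ≠ 0 →
      ‖gradient (signedDist U) y‖ = 1 := by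
    intro y hy h0
    obtain ⟨v, hv, h⟩ := exists_normal_segment hne y
    rw [normal_segment_eq (hasFDerivAt_of_contDiffOn_isOpen isOpen_tube hs hy).differentiableAt hv h,
      norm_neg, norm_smul, Real.norm_eq_abs] at hv
    have : |signedDist U y| ≠ 0 := abs_ne_zero.2 h0
    exact mul_left_cancel₀ this (by rw [hv, mul_one])
  -- On the frontier the nearest-point segment degenerates. There the norm is found by continuity,
  -- approaching from inside `U`, where the signed distance is nonzero.
  by_cases h0 : signedDist U x = 0
  · by_contra hcon
    have hcont : ContinuousAt (fun y => ‖gradient (signedDist U) y‖) x :=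
      (hasFDerivAt_gradient isOpen_tube hs hx).continuousAt.norm
    have hev : ∀ᶠ y in 𝓝 x, ‖gradient (signedDist U) y‖ ≠ 1 := hcont.eventually_ne hcon
    have hfr : ∃ᶠ y in 𝓝 x, y ∈ U := mem_closure_iff_frequently.1
      (frontier_subset_closure ((mem_frontier_iff_signedDist_eq_zero hne).2 h0))
    obtain ⟨y, hyU, hy1, hyr⟩ := (hfr.and_eventually
      (hev.and (isOpen_tube.mem_nhds hx))).exists
    exact hy1 (key y hyr (signedDist_pos hU hne hyU).ne')
  · exact key x hx h0

end Tube

/-! ### The space-time tube -/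

section SliceCalculus

variable {d : ℕ} {G : Type*} [NormedAddCommGroup G] [NormedSpace ℝ G] {S : Set (ℝ × E d)}

lemma hasFDerivAt_slice_of_within {f : ℝ → E d → G} {p : ℝ × E d}
    (hSo : ∀ᶠ y in 𝓝 p.2, (p.1, y) ∈ S)
    (hf : DifferentiableWithinAt ℝ (fun q : ℝ × E d => f q.1 q.2) S p) :
    HasFDerivAt (f p.1) ((fderivWithin ℝ (fun q : ℝ × E d => f q.1 q.2) S p).comp
      (ContinuousLinearMap.inr ℝ ℝ (E d))) p.2 := by
  have h1 : HasFDerivAt (fun y : E d => (p.1, y)) (ContinuousLinearMap.inr ℝ ℝ (E d)) p.2 :=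
    hasFDerivAt_prodMk_right p.1 p.2
  have h2 : HasFDerivWithinAt (f p.1) _ {y | (p.1, y) ∈ S} p.2 :=
    hf.hasFDerivWithinAt.comp (x := p.2) (f := fun y : E d => (p.1, y)) h1.hasFDerivWithinAt
      fun y hy => hy
  exact h2.hasFDerivAt hSo

/-- At the endpoint times the tube is only a relative neighbourhood, so space-time derivatives are
taken within it; the spatial slices are open, which makes the slice derivative an ordinary one.
Smoothness up to the endpoints is what yields uniform bounds. -/
lemma contDiffOn_slice_fderiv (hS : UniqueDiffOn ℝ S)
    (hSo : ∀ p ∈ S, ∀ᶠ y in 𝓝 p.2, (p.1, y) ∈ S) {f : ℝ → E d → G}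
    (hf : ContDiffOn ℝ ∞ (fun q : ℝ × E d => f q.1 q.2) S) :
    ContDiffOn ℝ ∞ (fun q : ℝ × E d => fderiv ℝ (f q.1) q.2) S := by
  refine ((hf.fderivWithin hS (m := ∞) (by norm_cast)).clm_comp
    (contDiffOn_const (c := ContinuousLinearMap.inr ℝ ℝ (E d)))).congr fun p hp => ?_
  exact (hasFDerivAt_slice_of_within (hSo p hp) (hf.differentiableOn (by simp) p hp)).fderiv

lemma contDiffOn_slice_partialD (hS : UniqueDiffOn ℝ S)
    (hSo : ∀ p ∈ S, ∀ᶠ y in 𝓝 p.2, (p.1, y) ∈ S) {f : ℝ → E d → G}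
    (hf : ContDiffOn ℝ ∞ (fun q : ℝ × E d => f q.1 q.2) S) (i : Fin d) :
    ContDiffOn ℝ ∞ (fun q : ℝ × E d => partialD (f q.1) i q.2) S :=
  (contDiffOn_slice_fderiv hS hSo hf).clm_apply contDiffOn_const

lemma contDiffOn_slice {f : ℝ → E d → G} (hf : ContDiffOn ℝ ∞ (fun q : ℝ × E d => f q.1 q.2) S)
    (t : ℝ) : ContDiffOn ℝ ∞ (f t) {x | (t, x) ∈ S} :=
  hf.comp (f := fun x : E d => ((t, x) : ℝ × E d)) (contDiff_prodMk_right t).contDiffOn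
    fun _ hx => hx

end SliceCalculus

/-- The space-time tube of width `r` around the evolving interface. -/
def tube {d : ℕ} (T r : ℝ) (D : ℝ → Set (E d)) : Set (ℝ × E d) :=
  {p | p.1 ∈ Icc 0 T ∧ |signedDist (D p.1) p.2| < r}

/-- The mean curvature of the interface, extended constantly in normal directions. -/
def normalCurvature {d : ℕ} (D : ℝ → Set (E d)) (t : ℝ) (x : E d) : ℝ :=
  -Laplacian.laplacian (signedDist (D t)) (proj D t x)

namespace IsMeanCurvatureFlow

variable {d : ℕ} {T δ₀ r : ℝ} {D : ℝ → Set (E d)}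

lemma exists_isOpen_tube_eq (hD : IsMeanCurvatureFlow T δ₀ D) (r : ℝ) :
    ∃ V : Set (ℝ × E d), IsOpen V ∧ tube T r D = V ∩ (Icc 0 T ×ˢ univ) := by
  obtain ⟨V, hV, h⟩ := continuousOn_iff'.1 hD.continuous.abs (Iio r) isOpen_Iio
  refine ⟨V, hV, ?_⟩
  rw [← h]
  ext p
  simp [tube, and_comm]

lemma uniqueDiffOn_tube (hD : IsMeanCurvatureFlow T δ₀ D) (hT : 0 < T) :
    UniqueDiffOn ℝ (tube T r D) := by
  obtain ⟨V, hV, h⟩ := hD.exists_isOpen_tube_eq r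
  rw [h, inter_comm]
  exact ((uniqueDiffOn_Icc hT).prod uniqueDiffOn_univ).inter hV

lemma tube_mem_nhds (hD : IsMeanCurvatureFlow T δ₀ D) {t : ℝ} (ht : t ∈ Ioo 0 T) {x : E d}
    (hx : |signedDist (D t) x| < r) : tube T r D ∈ 𝓝 (t, x) := by
  obtain ⟨V, hV, h⟩ := hD.exists_isOpen_tube_eq r
  rw [h]
  have hmem : (t, x) ∈ tube T r D := ⟨Ioo_subset_Icc_self ht, hx⟩
  rw [h] at hmem
  exact inter_mem (hV.mem_nhds hmem.1) (prod_mem_nhds (Icc_mem_nhds ht.1 ht.2) univ_mem)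

lemma continuousAt_signedDist (hD : IsMeanCurvatureFlow T δ₀ D) {t : ℝ} (ht : t ∈ Ioo 0 T)
    (x : E d) : ContinuousAt (fun p : ℝ × E d => signedDist (D p.1) p.2) (t, x) :=
  hD.continuous.continuousAt (prod_mem_nhds (Icc_mem_nhds ht.1 ht.2) univ_mem)

lemma slice_mem_nhds {p : ℝ × E d} (hp : p ∈ tube T r D) :
    ∀ᶠ y in 𝓝 p.2, (p.1, y) ∈ tube T r D := by
  filter_upwards [isOpen_tube.mem_nhds hp.2] with y hy
  exact ⟨hp.1, hy⟩

lemma contDiffOn_signedDist (hD : IsMeanCurvatureFlow T δ₀ D) {t : ℝ} (ht : t ∈ Icc 0 T) :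
    ContDiffOn ℝ ∞ (signedDist (D t)) {x | |signedDist (D t) x| < 4 * δ₀} :=
  (contDiffOn_slice (f := fun t => signedDist (D t)) hD.smooth t).mono fun _ hx => ⟨ht, hx⟩

lemma norm_gradient_eq_one (hD : IsMeanCurvatureFlow T δ₀ D) {t : ℝ} (ht : t ∈ Icc 0 T) {x : E d}
    (hx : |signedDist (D t) x| < 4 * δ₀) : ‖gradient (signedDist (D t)) x‖ = 1 :=
  norm_gradient_signedDist (hD.isOpen t ht) (hD.nonempty t ht) (hD.contDiffOn_signedDist ht) hx

lemma signedDist_segment (hD : IsMeanCurvatureFlow T δ₀ D) {t : ℝ} (ht : t ∈ Icc 0 T) {x : E d}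
    (hx : |signedDist (D t) x| < 4 * δ₀) {l : ℝ} (hl : l ∈ Icc (0 : ℝ) 1) :
    signedDist (D t) (x - l • signedDist (D t) x • gradient (signedDist (D t)) x)
      = (1 - l) * signedDist (D t) x :=
  signedDist_sub_smul_gradient (hD.nonempty t ht) (hasFDerivAt_of_contDiffOn_isOpen isOpen_tube
    (hD.contDiffOn_signedDist ht) hx).differentiableAt hl

lemma signedDist_proj (hD : IsMeanCurvatureFlow T δ₀ D) {t : ℝ} (ht : t ∈ Icc 0 T) {x : E d}
    (hx : |signedDist (D t) x| < 4 * δ₀) : signedDist (D t) (proj D t x) = 0 := by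
  simpa [proj] using hD.signedDist_segment ht hx (l := 1) ⟨zero_le_one, le_rfl⟩

lemma contDiffOn_gradient_tube (hD : IsMeanCurvatureFlow T δ₀ D) (hT : 0 < T) :
    ContDiffOn ℝ ∞ (fun p : ℝ × E d => gradient (signedDist (D p.1)) p.2)
      (tube T (4 * δ₀) D) := by
  rw [contDiffOn_euclidean]
  intro i
  simp only [gradient_apply]
  exact contDiffOn_slice_partialD (f := fun t => signedDist (D t)) (hD.uniqueDiffOn_tube hT)
    (fun p hp => slice_mem_nhds hp) hD.smooth i

lemma contDiffOn_laplacian_tube (hD : IsMeanCurvatureFlow T δ₀ D) (hT : 0 < T) :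
    ContDiffOn ℝ ∞ (fun p : ℝ × E d => Laplacian.laplacian (signedDist (D p.1)) p.2)
      (tube T (4 * δ₀) D) := by
  have hS := hD.uniqueDiffOn_tube hT (r := 4 * δ₀)
  have h1 : ContDiffOn ℝ ∞ (fun p : ℝ × E d =>
      ∑ i, partialD (partialD (signedDist (D p.1)) i) i p.2) (tube T (4 * δ₀) D) := by
    refine ContDiffOn.sum fun i _ => ?_
    exact contDiffOn_slice_partialD (f := fun t => partialD (signedDist (D t)) i) hS
      (fun p hp => slice_mem_nhds hp) (contDiffOn_slice_partialD (f := fun t => signedDist (D t))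
        hS (fun p hp => slice_mem_nhds hp) hD.smooth i) i
  refine h1.congr fun p hp => ?_
  exact laplacian_eq_sum_partialD (((hD.contDiffOn_signedDist hp.1).contDiffAt
    (isOpen_tube.mem_nhds hp.2)).of_le (by norm_cast))

lemma contDiffOn_normalCurvature (hD : IsMeanCurvatureFlow T δ₀ D) (hT : 0 < T) (hδ : 0 < δ₀) :
    ContDiffOn ℝ ∞ (fun p : ℝ × E d => normalCurvature D p.1 p.2) (tube T (4 * δ₀) D) := by
  have hg := hD.contDiffOn_gradient_tube hT
  have hp : ContDiffOn ℝ ∞ (fun p : ℝ × E d => ((p.1, proj D p.1 p.2) : ℝ × E d))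
      (tube T (4 * δ₀) D) :=
    contDiffOn_fst.prodMk (contDiffOn_snd.sub (ContDiffOn.smul hD.smooth hg))
  refine ((hD.contDiffOn_laplacian_tube hT).comp hp fun p hp => ?_).neg
  refine ⟨hp.1, ?_⟩
  rw [hD.signedDist_proj hp.1 hp.2, abs_zero]
  positivity

lemma contDiffOn_curvH (hD : IsMeanCurvatureFlow T δ₀ D) (hT : 0 < T) (hδ : 0 < δ₀)
    {η₀ : ℝ → E d → ℝ} (hη : IsTubeCutoff T δ₀ D η₀) :
    ContDiffOn ℝ ∞ (fun p : ℝ × E d => curvH η₀ D p.1 p.2) (tube T (4 * δ₀) D) :=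
  ((hD.contDiffOn_normalCurvature hT hδ).mul (hη.smooth.mono fun _ hp => ⟨hp.1, mem_univ _⟩)).smul
    (hD.contDiffOn_gradient_tube hT)

/-- The normal velocity is constant in normal directions. -/
lemma timeD_signedDist (hD : IsMeanCurvatureFlow T δ₀ D) (hδ : 0 < δ₀) {t : ℝ} (ht : t ∈ Ioo 0 T)
    {x : E d} (hx : |signedDist (D t) x| < 4 * δ₀) :
    timeD (fun s => signedDist (D s)) t x = -normalCurvature D t x := by
  have ht' := Ioo_subset_Icc_self ht
  have h0 := hD.signedDist_proj ht' hx
  have hfl := hD.flow t ht (proj D t x)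
    ((mem_frontier_iff_signedDist_eq_zero (hD.nonempty t ht')).2 h0)
  rw [normalCurvature, neg_neg, ← neg_inj.1 hfl]
  have hdiff : ∀ y, |signedDist (D t) y| < 4 * δ₀ → HasDerivAt (fun s => signedDist (D s) y)
      (timeD (fun s => signedDist (D s)) t y) t := by
    intro y hy
    have h1 := timeD_eq_of_hasFDerivAt (u := fun s => signedDist (D s)) (t := t) (x := y)
      ((hD.smooth.contDiffAt (hD.tube_mem_nhds ht hy)).differentiableAt (by simp)).hasFDerivAt
    rw [timeD, h1.deriv]
    exact h1
  by_cases hs : signedDist (D t) x = 0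
  · simp [proj, hs]
  · have d1 := hdiff x hx
    have d2 := hdiff (proj D t x) (by rw [h0, abs_zero]; positivity)
    have d3 := (d1.sub d2).const_mul (signedDist (D t) x)
    -- At any time `s` the signed distances of `x` and its foot point differ by at most their
    -- distance, with equality at `s = t`. Hence the derivatives at `t` agree, and at the foot point
    -- the flow equation holds.
    have hmax : IsLocalMax (fun s => signedDist (D t) x *
        (signedDist (D s) x - signedDist (D s) (proj D t x))) t := by
      refine Eventually.of_forall fun s => ?_
      beta_reduce
      rw [h0, sub_zero]
      have h1 := abs_signedDist_sub_le (U := D s) x (proj D t x)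
      have h2 : dist x (proj D t x) = |signedDist (D t) x| := by
        rw [dist_eq_norm, proj, sub_sub_cancel, norm_smul, hD.norm_gradient_eq_one ht' hx, mul_one,
          Real.norm_eq_abs]
      rw [h2] at h1
      refine (le_abs_self _).trans ?_
      rw [abs_mul, ← abs_mul_abs_self (signedDist (D t) x)]
      exact mul_le_mul_of_nonneg_left h1 (abs_nonneg _)
    have := hmax.hasDerivAt_eq_zero d3
    have h4 := (mul_eq_zero.1 this).resolve_left hs
    linarith

/-- The curvature depends on `x` only through the foot point, whose differential annihilates the
normal. -/
lemma fderiv_normalCurvature_gradient (hD : IsMeanCurvatureFlow T δ₀ D) (hT : 0 < T)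
    (hδ : 0 < δ₀) {t : ℝ} (ht : t ∈ Icc 0 T) {x : E d} (hx : |signedDist (D t) x| < 4 * δ₀) :
    fderiv ℝ (normalCurvature D t) x (gradient (signedDist (D t)) x) = 0 := by
  obtain ⟨L, hL, hL0⟩ := hasFDerivAt_foot isOpen_tube (hD.contDiffOn_signedDist ht)
    (fun x hx => hD.norm_gradient_eq_one ht hx) hx
  have hlap : ContDiffOn ℝ ∞ (Laplacian.laplacian (signedDist (D t)))
      {x | |signedDist (D t) x| < 4 * δ₀} :=
    (contDiffOn_slice (f := fun t => Laplacian.laplacian (signedDist (D t)))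
      (hD.contDiffOn_laplacian_tube hT) t).mono fun _ hx => ⟨ht, hx⟩
  have hp : |signedDist (D t) (proj D t x)| < 4 * δ₀ := by
    rw [hD.signedDist_proj ht hx, abs_zero]
    positivity
  have h1 := ((hasFDerivAt_of_contDiffOn_isOpen isOpen_tube hlap hp).comp x hL).neg
  have h2 : HasFDerivAt (normalCurvature D t) _ x := h1
  rw [h2.fderiv]
  simp [hL0]

/-- Compactness up to the endpoint times bounds all geometric quantities by constants of the
interface alone. -/
lemma isCompact_closedTube (hD : IsMeanCurvatureFlow T δ₀ D) {R : ℝ}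
    (hR : ∀ t ∈ Icc 0 T, frontier (D t) ⊆ Metric.closedBall 0 R) (ρ : ℝ) :
    IsCompact {p : ℝ × E d | p.1 ∈ Icc 0 T ∧ |signedDist (D p.1) p.2| ≤ ρ} := by
  have hcl : IsClosed {p : ℝ × E d | p.1 ∈ Icc 0 T ∧ |signedDist (D p.1) p.2| ≤ ρ} := by
    have := hD.continuous.abs.preimage_isClosed_of_isClosed (isClosed_Icc.prod isClosed_univ)
      (isClosed_Iic (a := ρ))
    convert this using 1
    ext p
    simp
  refine ((isCompact_Icc (a := (0 : ℝ)) (b := T)).prod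
    (isCompact_closedBall (0 : E d) (R + ρ))).of_isClosed_subset hcl ?_
  rintro ⟨t, x⟩ ⟨ht, hx⟩
  refine ⟨ht, ?_⟩
  obtain ⟨y, hy, hd⟩ := isClosed_frontier.exists_infDist_eq_dist (hD.nonempty t ht) x
  rw [abs_signedDist, hd] at hx
  have h1 := hR t ht hy
  rw [Metric.mem_closedBall] at h1 ⊢
  linarith [dist_triangle x y 0]

lemma exists_bound_closedTube (hD : IsMeanCurvatureFlow T δ₀ D) (hδ : 0 < δ₀) {R : ℝ}
    (hR : ∀ t ∈ Icc 0 T, frontier (D t) ⊆ Metric.closedBall 0 R) {G : Type*}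
    [NormedAddCommGroup G] {f : ℝ × E d → G} (hf : ContinuousOn f (tube T (4 * δ₀) D)) :
    ∃ B, 0 ≤ B ∧ ∀ t ∈ Icc 0 T, ∀ x, |signedDist (D t) x| ≤ 2 * δ₀ → ‖f (t, x)‖ ≤ B := by
  obtain ⟨B, hB⟩ := (hD.isCompact_closedTube hR (2 * δ₀)).exists_bound_of_continuousOn
    (hf.mono fun p hp => ⟨hp.1, hp.2.trans_lt (by linarith)⟩)
  exact ⟨max B 0, le_max_right _ _, fun t ht x hx => le_max_of_le_left (hB (t, x) ⟨ht, hx⟩)⟩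

end IsMeanCurvatureFlow

/-! ### The calibration given by a mean curvature flow -/

namespace IsProfile

variable {φ : ℝ → ℝ}

lemma apply_abs (hφ : IsProfile φ) (r : ℝ) : φ |r| = φ r := by
  rcases abs_choice r with h | h <;> rw [h]
  exact hφ.even r

/-- For `|r| > 1/2` monotonicity gives `φ(r) ≤ φ(1/2) ≤ 7/8`, which fixes the constant 8. -/
lemma le_one_sub (hφ : IsProfile φ) {r : ℝ} (hr : |r| ≤ 1) : r ^ 2 / 8 ≤ 1 - φ r := by
  by_cases h : |r| ≤ 1 / 2
  · have := (hφ.bounds r h).2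
    nlinarith [sq_nonneg r]
  · push Not at h
    have h1 := (hφ.bounds (1 / 2) (by norm_num [abs_of_pos])).2
    have h2 := hφ.antitone (a := 1 / 2) (b := |r|) ⟨by norm_num, by norm_num⟩
      ⟨abs_nonneg r, hr⟩ h.le
    rw [hφ.apply_abs] at h2
    have h3 : r ^ 2 ≤ 1 := by
      rw [← sq_abs]
      exact pow_le_one₀ (abs_nonneg _) hr
    nlinarith

lemma le_one (hφ : IsProfile φ) (r : ℝ) : φ r ≤ 1 := by
  by_cases h : |r| ≤ 1
  · have := hφ.le_one_sub h
    nlinarith [sq_nonneg r]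
  · rw [hφ.zero r (not_le.1 h).le]
    exact zero_le_one

lemma deriv_eq_zero (hφ : IsProfile φ) {r : ℝ} (hr : 1 ≤ |r|) : deriv φ r = 0 := by
  refine IsLocalMin.deriv_eq_zero (Eventually.of_forall fun s => ?_)
  rw [hφ.zero r hr]
  exact hφ.nonneg s

lemma deriv_zero (hφ : IsProfile φ) : deriv φ 0 = 0 := by
  refine IsLocalMax.deriv_eq_zero (Eventually.of_forall fun s => ?_)
  have h := (hφ.bounds 0 (by norm_num)).1
  exact (hφ.le_one s).trans (by linarith)

/-- The profile has a maximum at the origin, so its derivative vanishes there and, being Lipschitz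
on `[-1, 1]`, grows at most linearly. -/
lemma exists_abs_deriv_le (hφ : IsProfile φ) :
    ∃ L : ℝ, 0 ≤ L ∧ ∀ r, |r| ≤ 1 → |deriv φ r| ≤ L * |r| := by
  have h1 : ContDiff ℝ 1 (deriv φ) := (contDiff_succ_iff_deriv.1
    (hφ.smooth.of_le (by norm_cast : (1 + 1 : WithTop ℕ∞) ≤ ∞))).2.2
  obtain ⟨K, hK⟩ := h1.contDiffOn.exists_lipschitzOnWith (by decide) (convex_Icc (-1 : ℝ) 1)
    isCompact_Icc
  refine ⟨K, K.2, fun r hr => ?_⟩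
  have := hK.dist_le_mul r (abs_le.1 hr) 0 ⟨by norm_num, by norm_num⟩
  rwa [Real.dist_eq, Real.dist_eq, hφ.deriv_zero, sub_zero, sub_zero] at this

end IsProfile

section Calibration

variable {d : ℕ} {T δ₀ : ℝ} {D : ℝ → Set (E d)} {φ : ℝ → ℝ} {η₀ : ℝ → E d → ℝ}

lemma xi_eq_zero (hδ : 0 < δ₀) (hφ : IsProfile φ) {t : ℝ} {x : E d}
    (hx : δ₀ ≤ |signedDist (D t) x|) : xi δ₀ φ D t x = 0 := by
  rw [xi, hφ.zero _ ?_, zero_smul]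
  rwa [abs_div, abs_of_pos hδ, one_le_div hδ]

lemma norm_xi_le (hφ : IsProfile φ) (t : ℝ) (x : E d) : ‖xi δ₀ φ D t x‖ ≤ 1 := by
  rw [xi, norm_smul, Real.norm_of_nonneg (hφ.nonneg _)]
  exact mul_le_one₀ (hφ.le_one _) (norm_nonneg _) (norm_gradient_signedDist_le x)

lemma tsupport_xi_subset (hδ : 0 < δ₀) (hφ : IsProfile φ) (hη : IsTubeCutoff T δ₀ D η₀) {t : ℝ}
    (ht : t ∈ Icc 0 T) : tsupport (xi δ₀ φ D t) ⊆ tsupport (η₀ t) := by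
  refine closure_mono fun x hx h => hx ?_
  refine xi_eq_zero hδ hφ (le_of_not_gt fun hlt => ?_)
  rw [hη.one t ht x hlt] at h
  exact one_ne_zero h

lemma tsupport_curvH_subset (t : ℝ) : tsupport (curvH η₀ D t) ⊆ tsupport (η₀ t) := by
  refine closure_mono fun x hx h => hx ?_
  rw [curvH, h, mul_zero, zero_smul]

lemma curvH_align (t : ℝ) (x : E d) : ‖curvH η₀ D t x‖ ^ 2 • xi δ₀ φ D t x
    = (inner ℝ (curvH η₀ D t x) (xi δ₀ φ D t x) : ℝ) • curvH η₀ D t x := by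
  rw [← real_inner_self_eq_norm_sq]
  simp only [curvH, xi, real_inner_smul_left, real_inner_smul_right, smul_smul]
  congr 1
  ring

namespace IsMeanCurvatureFlow

lemma hasCompactSupport_of_tsupport_subset (hD : IsMeanCurvatureFlow T δ₀ D)
    (hη : IsTubeCutoff T δ₀ D η₀) {R : ℝ}
    (hR : ∀ t ∈ Icc 0 T, frontier (D t) ⊆ Metric.closedBall 0 R) {t : ℝ} (ht : t ∈ Icc 0 T)
    {X : E d → E d} (hX : tsupport X ⊆ tsupport (η₀ t)) : HasCompactSupport X := by
  have h1 := (hD.isCompact_closedTube hR (2 * δ₀)).image continuous_snd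
  refine h1.of_isClosed_subset (isClosed_tsupport _) fun x hx => ?_
  exact ⟨(t, x), ⟨ht, (hη.support t ht (hX hx)).le⟩, rfl⟩

lemma contDiffAt_xi (hD : IsMeanCurvatureFlow T δ₀ D) (hT : 0 < T) (hφ : IsProfile φ) {t : ℝ}
    (ht : t ∈ Ioo 0 T) {x : E d} (hx : |signedDist (D t) x| < 4 * δ₀) :
    ContDiffAt ℝ ∞ (fun p : ℝ × E d => xi δ₀ φ D p.1 p.2) (t, x) := by
  have hm := hD.tube_mem_nhds ht hx
  have h1 := hD.smooth.contDiffAt hm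
  have h2 := (hD.contDiffOn_gradient_tube hT).contDiffAt hm
  exact ((hφ.smooth.contDiffAt (x := signedDist (D t) x / δ₀)).comp (t, x)
    (h1.div_const δ₀)).smul h2

lemma eventually_xi_eq_zero (hD : IsMeanCurvatureFlow T δ₀ D) (hδ : 0 < δ₀) (hφ : IsProfile φ)
    {t : ℝ} (ht : t ∈ Ioo 0 T) {x : E d} (hx : δ₀ < |signedDist (D t) x|) :
    ∀ᶠ p : ℝ × E d in 𝓝 (t, x), xi δ₀ φ D p.1 p.2 = 0 := by
  filter_upwards [(hD.continuousAt_signedDist ht x).abs.eventually_const_lt hx] with p hp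
  exact xi_eq_zero hδ hφ hp.le

lemma contDiffOn_xi (hD : IsMeanCurvatureFlow T δ₀ D) (hT : 0 < T) (hδ : 0 < δ₀)
    (hφ : IsProfile φ) :
    ContDiffOn ℝ ∞ (fun p : ℝ × E d => xi δ₀ φ D p.1 p.2) (Ioo 0 T ×ˢ univ) := by
  rintro ⟨t, x⟩ ⟨ht, -⟩
  refine ContDiffAt.contDiffWithinAt ?_
  by_cases hx : |signedDist (D t) x| < 4 * δ₀
  · exact hD.contDiffAt_xi hT hφ ht hx
  · exact (contDiffAt_const (c := (0 : E d))).congr_of_eventuallyEq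
      (hD.eventually_xi_eq_zero hδ hφ ht (by linarith [not_lt.1 hx]))

lemma hasFDerivAt_xi (hD : IsMeanCurvatureFlow T δ₀ D) (hφ : IsProfile φ) {t : ℝ}
    (ht : t ∈ Icc 0 T) {x : E d} (hx : |signedDist (D t) x| < 4 * δ₀) (v : E d) :
    fderiv ℝ (xi δ₀ φ D t) x v
      = (deriv φ (signedDist (D t) x / δ₀) / δ₀ * fderiv ℝ (signedDist (D t)) x v) •
          gradient (signedDist (D t)) x
        + φ (signedDist (D t) x / δ₀) • fderiv ℝ (gradient (signedDist (D t))) x v := by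
  have hs := hD.contDiffOn_signedDist ht
  have h1 := hasFDerivAt_of_contDiffOn_isOpen isOpen_tube hs hx
  have h2 := hasFDerivAt_gradient isOpen_tube hs hx
  have h1' : HasFDerivAt (fun y => signedDist (D t) y / δ₀)
      (δ₀⁻¹ • fderiv ℝ (signedDist (D t)) x) x := by
    simpa only [div_eq_mul_inv] using h1.mul_const δ₀⁻¹
  have h3 : HasFDerivAt (fun y => φ (signedDist (D t) y / δ₀)) _ x :=
    ((hφ.smooth.differentiable (by simp)) (signedDist (D t) x / δ₀)).hasDerivAt.comp_hasFDerivAt x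
      h1'
  have h4 : HasFDerivAt (xi δ₀ φ D t) _ x := h3.smul h2
  rw [h4.fderiv]
  simp only [add_apply, smul_apply, ContinuousLinearMap.smulRight_apply, smul_eq_mul]
  rw [add_comm]
  congr 2
  ring

/-- Pairing with a fixed `v` turns the time derivative of `∇d_Σ` into the spatial derivative of
`∂ₜd_Σ`. -/
lemma timeD_xi (hD : IsMeanCurvatureFlow T δ₀ D) (hT : 0 < T) (hφ : IsProfile φ) {t : ℝ}
    (ht : t ∈ Ioo 0 T) {x : E d} (hx : |signedDist (D t) x| < 4 * δ₀) (v : E d) :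
    inner ℝ (timeD (xi δ₀ φ D) t x) v
      = deriv φ (signedDist (D t) x / δ₀) / δ₀ * timeD (fun s => signedDist (D s)) t x *
          inner ℝ (gradient (signedDist (D t)) x) v
        + φ (signedDist (D t) x / δ₀) *
          fderiv ℝ (timeD (fun s => signedDist (D s)) t) x v := by
  have hm := hD.tube_mem_nhds ht hx
  have c1 := hD.smooth.contDiffAt hm
  have h1 := timeD_eq_of_hasFDerivAt (u := fun s => signedDist (D s)) (t := t) (x := x)
    (c1.differentiableAt (by simp)).hasFDerivAt
  have h1' : HasDerivAt (fun s => signedDist (D s) x)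
      (timeD (fun s => signedDist (D s)) t x) t := by
    rw [timeD, h1.deriv]
    exact h1
  have h2 := fderiv_timeD_comm (X := fun s => signedDist (D s)) (c1.of_le (by norm_cast)) v
  have h3 : HasDerivAt (fun s => φ (signedDist (D s) x / δ₀)) _ t :=
    HasDerivAt.scomp_of_eq t
      ((hφ.smooth.differentiable (by simp)) (signedDist (D t) x / δ₀)).hasDerivAt
      (h1'.div_const δ₀) rfl
  have h4 : HasDerivAt (fun s => inner ℝ (xi δ₀ φ D s x) v) _ t :=
    (h3.mul h2).congr_of_eventuallyEq (Eventually.of_forall fun s => by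
      simp only [xi, real_inner_smul_left, Pi.mul_apply]
      rw [real_inner_comm, inner_gradient])
  have h5 := timeD_eq_of_hasFDerivAt (u := xi δ₀ φ D)
    ((hD.contDiffAt_xi hT hφ ht hx).differentiableAt (by simp)).hasFDerivAt
  have h6 : HasDerivAt (fun s => xi δ₀ φ D s x) (timeD (xi δ₀ φ D) t x) t := by
    rw [timeD, h5.deriv]
    exact h5
  have h7 := h6.inner ℝ (hasDerivAt_const t v)
  rw [inner_zero_right, zero_add] at h7
  rw [h7.unique h4, real_inner_comm, inner_gradient]
  simp only [smul_eq_mul]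
  ring

lemma curvH_eventuallyEq (hη : IsTubeCutoff T δ₀ D η₀) {t : ℝ} (ht : t ∈ Icc 0 T) {x : E d}
    (hx : |signedDist (D t) x| < δ₀) : curvH η₀ D t =ᶠ[𝓝 x]
      fun y => normalCurvature D t y • gradient (signedDist (D t)) y := by
  filter_upwards [isOpen_tube.mem_nhds hx] with y hy
  rw [curvH, hη.one t ht y hy, mul_one]
  rfl

lemma fderiv_curvH (hD : IsMeanCurvatureFlow T δ₀ D) (hT : 0 < T) (hδ : 0 < δ₀)
    (hη : IsTubeCutoff T δ₀ D η₀) {t : ℝ} (ht : t ∈ Icc 0 T) {x : E d}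
    (hx : |signedDist (D t) x| < δ₀) (v : E d) :
    fderiv ℝ (curvH η₀ D t) x v
      = fderiv ℝ (normalCurvature D t) x v • gradient (signedDist (D t)) x
        + normalCurvature D t x • fderiv ℝ (gradient (signedDist (D t))) x v := by
  have hx4 : |signedDist (D t) x| < 4 * δ₀ := by linarith
  have hs := hD.contDiffOn_signedDist ht
  have hk : ContDiffOn ℝ ∞ (normalCurvature D t) {x | |signedDist (D t) x| < 4 * δ₀} :=
    (contDiffOn_slice (hD.contDiffOn_normalCurvature hT hδ) t).mono fun _ hx => ⟨ht, hx⟩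
  have h : HasFDerivAt (fun y => normalCurvature D t y • gradient (signedDist (D t)) y) _ x :=
    (hasFDerivAt_of_contDiffOn_isOpen isOpen_tube hk hx4).smul
      (hasFDerivAt_gradient isOpen_tube hs hx4)
  rw [(curvH_eventuallyEq hη ht hx).fderiv_eq, h.fderiv]
  simp only [add_apply, smul_apply, ContinuousLinearMap.smulRight_apply]
  rw [add_comm]

/-- In the support of ξ both the curvature and the unit normal are constant along normal lines, so
`H` does not vary in the direction of ξ. -/
lemma curvH_stretch (hD : IsMeanCurvatureFlow T δ₀ D) (hT : 0 < T) (hδ : 0 < δ₀)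
    (hφ : IsProfile φ) (hη : IsTubeCutoff T δ₀ D η₀) {t : ℝ} (ht : t ∈ Icc 0 T) (x : E d) :
    inner ℝ (fderiv ℝ (curvH η₀ D t) x (xi δ₀ φ D t x)) (xi δ₀ φ D t x) = 0 := by
  by_cases hx : |signedDist (D t) x| < δ₀
  · have hx4 : |signedDist (D t) x| < 4 * δ₀ := by linarith
    have h1 : fderiv ℝ (curvH η₀ D t) x (gradient (signedDist (D t)) x) = 0 := by
      rw [hD.fderiv_curvH hT hδ hη ht hx, hD.fderiv_normalCurvature_gradient hT hδ ht hx4,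
        fderiv_gradient_apply_gradient isOpen_tube (hD.contDiffOn_signedDist ht)
          (fun y hy => hD.norm_gradient_eq_one ht hy) hx4]
      simp
    rw [xi, map_smul, h1, smul_zero, inner_zero_left]
  · rw [xi_eq_zero hδ hφ (not_lt.1 hx), inner_zero_right]

/-- In the `δ₀`-tube `∂ₜd_Σ` equals `-normalCurvature` identically, not only on the interface, so
both sides follow from the product rule. On the rest of the `4δ₀`-tube `φ` and its derivative
vanish, and farther out ξ is zero near the point in space-time. -/
lemma xi_transport (hD : IsMeanCurvatureFlow T δ₀ D) (hT : 0 < T) (hδ : 0 < δ₀)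
    (hφ : IsProfile φ) (hη : IsTubeCutoff T δ₀ D η₀) {t : ℝ} (ht : t ∈ Ioo 0 T) (x v : E d) :
    inner ℝ (timeD (xi δ₀ φ D) t x) v
      = -inner ℝ (fderiv ℝ (xi δ₀ φ D t) x (curvH η₀ D t x)) v
        - inner ℝ (fderiv ℝ (curvH η₀ D t) x v) (xi δ₀ φ D t x) := by
  have ht' := Ioo_subset_Icc_self ht
  by_cases hx : |signedDist (D t) x| < 4 * δ₀
  · rw [hD.timeD_xi hT hφ ht hx, hD.hasFDerivAt_xi hφ ht' hx]
    by_cases hx1 : |signedDist (D t) x| < δ₀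
    · have hs := hD.contDiffOn_signedDist ht'
      have hN := fun y hy => hD.norm_gradient_eq_one (x := y) ht' hy
      have e1 : timeD (fun s => signedDist (D s)) t =ᶠ[𝓝 x] fun y => -normalCurvature D t y := by
        filter_upwards [isOpen_tube.mem_nhds hx] with y hy
        exact hD.timeD_signedDist hδ ht hy
      have e2 : fderiv ℝ (timeD (fun s => signedDist (D s)) t) x v
          = -fderiv ℝ (normalCurvature D t) x v := by
        rw [e1.fderiv_eq, fderiv_fun_neg]
        rfl
      have e3 : curvH η₀ D t x = normalCurvature D t x • gradient (signedDist (D t)) x :=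
        (curvH_eventuallyEq hη ht' hx1).self_of_nhds
      rw [e1.self_of_nhds, e2, e3, hD.fderiv_curvH hT hδ hη ht' hx1, xi, map_smul, map_smul,
        fderiv_gradient_apply_gradient isOpen_tube hs hN hx, fderiv_apply_gradient hN hx,
        inner_add_left, inner_add_left]
      simp only [real_inner_smul_left, real_inner_smul_right, smul_zero, inner_zero_left,
        inner_fderiv_gradient_self isOpen_tube hs hN hx, real_inner_self_eq_norm_sq, hN x hx,
        smul_eq_mul]
      ring
    · have hr : 1 ≤ |signedDist (D t) x / δ₀| := by
        rw [abs_div, abs_of_pos hδ, one_le_div hδ]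
        exact not_lt.1 hx1
      rw [xi_eq_zero hδ hφ (not_lt.1 hx1), hφ.deriv_eq_zero hr, hφ.zero _ hr]
      simp
  · have h0 := hD.eventually_xi_eq_zero hδ hφ ht (x := x) (by linarith [not_lt.1 hx])
    have c1 : Tendsto (fun y : E d => ((t, y) : ℝ × E d)) (𝓝 x) (𝓝 (t, x)) :=
      (Continuous.prodMk_right t).tendsto x
    have c2 : Tendsto (fun s : ℝ => ((s, x) : ℝ × E d)) (𝓝 t) (𝓝 (t, x)) :=
      (Continuous.prodMk_left x).tendsto t
    have e1 : xi δ₀ φ D t =ᶠ[𝓝 x] fun _ => 0 := c1.eventually h0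
    have e2 : (fun s => xi δ₀ φ D s x) =ᶠ[𝓝 t] fun _ => 0 := c2.eventually h0
    rw [timeD, e2.deriv_eq, e1.fderiv_eq, e1.self_of_nhds]
    simp

lemma divergence_xi (hD : IsMeanCurvatureFlow T δ₀ D) (hφ : IsProfile φ) {t : ℝ}
    (ht : t ∈ Icc 0 T) {x : E d} (hx : |signedDist (D t) x| < 4 * δ₀) :
    divergence (xi δ₀ φ D t) x = deriv φ (signedDist (D t) x / δ₀) / δ₀
      + φ (signedDist (D t) x / δ₀) * Laplacian.laplacian (signedDist (D t)) x := by
  have hs := hD.contDiffOn_signedDist ht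
  have hc : ContDiffAt ℝ 2 (signedDist (D t)) x :=
    (hs.contDiffAt (isOpen_tube.mem_nhds hx)).of_le (by norm_cast)
  have hN := hD.norm_gradient_eq_one ht hx
  have h2 : ∀ i, fderiv ℝ (gradient (signedDist (D t))) x (EuclideanSpace.single i 1) i
      = partialD (partialD (signedDist (D t)) i) i x := by
    intro i
    have := partialD_apply (X := gradient (signedDist (D t)))
      (hasFDerivAt_gradient isOpen_tube hs hx).differentiableAt i i
    simp only [gradient_apply] at this
    exact this
  have h3 : ∑ i, gradient (signedDist (D t)) x i * gradient (signedDist (D t)) x i = 1 := by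
    rw [← inner_eq_sum, real_inner_self_eq_norm_sq, hN, one_pow]
  rw [laplacian_eq_sum_partialD hc, divergence]
  simp only [partialD, hD.hasFDerivAt_xi hφ ht hx, PiLp.add_apply, PiLp.smul_apply, smul_eq_mul]
  rw [Finset.sum_add_distrib, ← Finset.mul_sum]
  simp only [h2]
  congr 1
  have h4 : ∀ i, fderiv ℝ (signedDist (D t)) x (EuclideanSpace.single i 1)
      = gradient (signedDist (D t)) x i := fun i => (gradient_apply _ _ _).symm
  simp only [h4, mul_assoc, ← Finset.mul_sum, h3, mul_one]

/-- A calibrated flow satisfies the calibration properties. -/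
theorem exists_isCalibration (hD : IsMeanCurvatureFlow T δ₀ D) (hT : 0 < T) (hδ : 0 < δ₀)
    (hφ : IsProfile φ) (hη : IsTubeCutoff T δ₀ D η₀) {R : ℝ}
    (hR : ∀ t ∈ Icc 0 T, frontier (D t) ⊆ Metric.closedBall 0 R) :
    ∃ C, 0 < C ∧ IsCalibration T C (xi δ₀ φ D) (curvH η₀ D) := by
  have hS := hD.uniqueDiffOn_tube hT (r := 4 * δ₀)
  have hH := hD.contDiffOn_curvH hT hδ hη
  obtain ⟨B₁, hB₁0, hB₁⟩ := hD.exists_bound_closedTube hδ hR hH.continuousOn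
  obtain ⟨B₂, hB₂0, hB₂⟩ := hD.exists_bound_closedTube hδ hR
    (contDiffOn_slice_fderiv hS (fun p hp => slice_mem_nhds hp) hH).continuousOn
  have hlap := hD.contDiffOn_laplacian_tube hT
  obtain ⟨B₃, hB₃0, hB₃⟩ := hD.exists_bound_closedTube hδ hR
    (contDiffOn_slice_fderiv (f := fun t => Laplacian.laplacian (signedDist (D t))) hS
      (fun p hp => slice_mem_nhds hp) hlap).continuousOn
  obtain ⟨L, hL0, hL⟩ := hφ.exists_abs_deriv_le
  have hIcc : ∀ t ∈ Ioo 0 T, t ∈ Icc 0 T := fun t ht => Ioo_subset_Icc_self ht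
  have hcs : ∀ t ∈ Ioo 0 T, tsupport (curvH η₀ D t) ⊆ {x | |signedDist (D t) x| < 2 * δ₀} :=
    fun t ht => (tsupport_curvH_subset t).trans (hη.support t (hIcc t ht))
  -- The bracket is the slope of `∇·ξ + H·ξ` in `d_Σ/δ₀`: the derivative of the profile gives
  -- `L/δ₀`, the variation of the Laplacian `B₃δ₀`. The factor 8 undoes the lower bound `r²/8 ≤ 1 -
  -- φ(r)`.
  set B₄ := 8 * (L / δ₀ + B₃ * δ₀) ^ 2
  have hB₄ : 0 ≤ B₄ := by positivity
  refine ⟨B₁ + B₂ + B₄ + 1, by positivity, by positivity, hD.contDiffOn_xi hT hδ hφ, ?_, ?_, ?_,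
    fun t _ x => norm_xi_le hφ t x, ?_, ?_, fun t _ x => curvH_align t x,
    fun t ht x => hD.curvH_stretch hT hδ hφ hη (hIcc t ht) x,
    fun t ht x v => hD.xi_transport hT hδ hφ hη ht x v, ?_⟩
  · intro t ht
    have h1 : ContDiffOn ℝ ∞ (curvH η₀ D t) {x | |signedDist (D t) x| < 4 * δ₀} :=
      (contDiffOn_slice hH t).mono fun _ hx => ⟨hIcc t ht, hx⟩
    have h2 : {x | |signedDist (D t) x| < 2 * δ₀} ⊆ {x | |signedDist (D t) x| < 4 * δ₀} :=
      ofPred_subset_ofPred.2 fun x hx => by linarith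
    exact (contDiff_of_tsupport_subset isOpen_tube h1 ((hcs t ht).trans h2)).of_le (by norm_cast)
  · exact fun t ht => hD.hasCompactSupport_of_tsupport_subset hη hR (hIcc t ht)
      (tsupport_xi_subset hδ hφ hη (hIcc t ht))
  · exact fun t ht => hD.hasCompactSupport_of_tsupport_subset hη hR (hIcc t ht)
      (tsupport_curvH_subset t)
  · intro t ht x
    by_cases hx : x ∈ tsupport (curvH η₀ D t)
    · exact (hB₁ t (hIcc t ht) x (hcs t ht hx).le).trans (by linarith)
    · rw [image_eq_zero_of_notMem_tsupport hx, norm_zero]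
      positivity
  · intro t ht i x
    by_cases hx : x ∈ tsupport (curvH η₀ D t)
    · have h1 : ‖partialD (curvH η₀ D t) i x‖ ≤ ‖fderiv ℝ (curvH η₀ D t) x‖ := by
        have := (fderiv ℝ (curvH η₀ D t) x).le_opNorm (EuclideanSpace.single i 1)
        rw [partialD]
        simpa using this
      exact h1.trans ((hB₂ t (hIcc t ht) x (hcs t ht hx).le).trans (by linarith))
    · rw [partialD_of_notMem_tsupport hx, norm_zero]
      positivity
  · intro t ht x
    have ht' := hIcc t ht
    by_cases hx : |signedDist (D t) x| < δ₀
    · have hx4 : |signedDist (D t) x| < 4 * δ₀ := by linarith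
      have hN := hD.norm_gradient_eq_one ht' hx4
      set s := signedDist (D t) x with hs
      have hr : |s / δ₀| ≤ 1 := by
        rw [abs_div, abs_of_pos hδ, div_le_one hδ]
        exact hx.le
      have hφ0 := hφ.nonneg (s / δ₀)
      have hφ1 := hφ.le_one (s / δ₀)
      have hn : ‖xi δ₀ φ D t x‖ = φ (s / δ₀) := by
        rw [xi, norm_smul, hN, mul_one, Real.norm_of_nonneg hφ0]
      have hi : inner ℝ (curvH η₀ D t x) (xi δ₀ φ D t x)
          = φ (s / δ₀) * normalCurvature D t x := by
        rw [(curvH_eventuallyEq hη ht' hx).self_of_nhds, xi, real_inner_smul_left,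
          real_inner_smul_right, real_inner_self_eq_norm_sq, hN]
        ring
      -- The curvature is the Laplacian at the foot point, so the sum is an increment of the
      -- Laplacian along the normal segment, which stays in the tube.
      have hlapd : |Laplacian.laplacian (signedDist (D t)) x + normalCurvature D t x|
          ≤ B₃ * |s| := by
        have hl : ContDiffOn ℝ ∞ (Laplacian.laplacian (signedDist (D t)))
            {x | |signedDist (D t) x| < 4 * δ₀} :=
          (contDiffOn_slice (f := fun t => Laplacian.laplacian (signedDist (D t))) hlap t).mono
            fun _ hx => ⟨ht', hx⟩
        have hdist : dist x (proj D t x) = |s| := by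
          rw [dist_eq_norm, proj, sub_sub_cancel, norm_smul, hN, mul_one, Real.norm_eq_abs]
        have hseg : ∀ z ∈ segment ℝ (proj D t x) x, |signedDist (D t) z| < δ₀ := by
          intro z hz
          have h1 := abs_signedDist_sub_le (U := D t) z (proj D t x)
          rw [hD.signedDist_proj ht' hx4, sub_zero] at h1
          have h2 := dist_add_dist_of_mem_segment hz
          rw [dist_comm (proj D t x) z, dist_comm (proj D t x) x, hdist] at h2
          have := dist_nonneg (x := z) (y := x)
          linarith
        have h3 := Convex.norm_image_sub_le_of_norm_fderiv_le (𝕜 := ℝ)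
          (f := Laplacian.laplacian (signedDist (D t))) (C := B₃)
          (s := segment ℝ (proj D t x) x)
          (fun z hz => (hasFDerivAt_of_contDiffOn_isOpen isOpen_tube hl
            (by linarith [hseg z hz] : |signedDist (D t) z| < 4 * δ₀)).differentiableAt)
          (fun z hz => hB₃ t ht' z (by linarith [hseg z hz])) (convex_segment _ _)
          (left_mem_segment ℝ _ _) (right_mem_segment ℝ _ _)
        rw [Real.norm_eq_abs, ← dist_eq_norm, hdist] at h3
        rwa [normalCurvature, ← sub_eq_add_neg]
      rw [hn, hi, hD.divergence_xi hφ ht' hx4, ← hs]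
      have h1 := hL (s / δ₀) hr
      have hs2 : |s / δ₀| * δ₀ = |s| := by
        rw [abs_div, abs_of_pos hδ]
        field_simp
      have h2 : |deriv φ (s / δ₀) / δ₀ + φ (s / δ₀) * Laplacian.laplacian (signedDist (D t)) x
          + φ (s / δ₀) * normalCurvature D t x| ≤ (L / δ₀ + B₃ * δ₀) * |s / δ₀| := by
        calc _ = |deriv φ (s / δ₀) / δ₀ + φ (s / δ₀) * (Laplacian.laplacian (signedDist (D t)) x
              + normalCurvature D t x)| := by
                congr 1
                ring
          _ ≤ |deriv φ (s / δ₀) / δ₀| + |φ (s / δ₀) * (Laplacian.laplacian (signedDist (D t)) x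
              + normalCurvature D t x)| := abs_add_le _ _
          _ ≤ L * |s / δ₀| / δ₀ + 1 * (B₃ * |s|) := by
              rw [abs_div, abs_mul, abs_of_pos hδ, abs_of_nonneg hφ0]
              exact add_le_add (div_le_div_of_nonneg_right h1 hδ.le)
                (mul_le_mul hφ1 hlapd (abs_nonneg _) zero_le_one)
          _ = _ := by
              rw [← hs2]
              ring
      have h3 := pow_le_pow_left₀ (abs_nonneg _) h2 2
      rw [sq_abs, mul_pow, sq_abs] at h3
      refine h3.trans ?_
      have h4 := hφ.le_one_sub hr
      have h5 : (L / δ₀ + B₃ * δ₀) ^ 2 * (s / δ₀) ^ 2 ≤ B₄ * (1 - φ (s / δ₀)) := by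
        calc (L / δ₀ + B₃ * δ₀) ^ 2 * (s / δ₀) ^ 2 = B₄ * ((s / δ₀) ^ 2 / 8) := by ring
          _ ≤ B₄ * (1 - φ (s / δ₀)) := mul_le_mul_of_nonneg_left h4 hB₄
      refine h5.trans (mul_le_mul_of_nonneg_right (by linarith) (by linarith))
    · have h0 := xi_eq_zero (D := D) (φ := φ) hδ hφ (not_lt.1 hx)
      have hd0 : divergence (xi δ₀ φ D t) x = 0 := by
        by_cases hx4 : |signedDist (D t) x| < 4 * δ₀
        · have hr : 1 ≤ |signedDist (D t) x / δ₀| := by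
            rw [abs_div, abs_of_pos hδ, one_le_div hδ]
            exact not_lt.1 hx
          rw [hD.divergence_xi hφ ht' hx4, hφ.deriv_eq_zero hr, hφ.zero _ hr]
          simp
        · have h1 : x ∉ tsupport (xi δ₀ φ D t) := fun h => by
            have h2 : |signedDist (D t) x| < 2 * δ₀ :=
              hη.support t ht' (tsupport_xi_subset hδ hφ hη ht' h)
            linarith [not_lt.1 hx4]
          simp [divergence, partialD_of_notMem_tsupport h1]
      rw [h0, hd0, inner_zero_right, norm_zero]
      simp only [add_zero, sub_zero, mul_one, zero_pow two_ne_zero]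
      positivity

end IsMeanCurvatureFlow

end Calibration

end VectorialAllenCahn

end

open VectorialAllenCahn in
theorem proposition2p7 {d : ℕ} {T δ₀ : ℝ} (hT : 0 < T) (hδ₀ : 0 < δ₀)
    (D : ℝ → Set (E d)) (hD : IsMeanCurvatureFlow T δ₀ D)
    (φ : ℝ → ℝ) (hφ : IsProfile φ)
    (η₀ : ℝ → E d → ℝ) (hη₀ : IsTubeCutoff T δ₀ D η₀) :
    ∃ C : ℝ, 0 < C ∧
      ∀ (Ω : Set (E d)), IsOpen Ω → Bornology.IsBounded Ω → InterfaceInside T δ₀ D Ω →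
        (∀ t ∈ Icc 0 T, tsupport (η₀ t) ⊆ Ω) →
      ∀ (n : ℕ) (W : WellPotential n δ₀) (g : E d → E n), IsBoundaryDatum W Ω g →
      ∀ (ε : ℝ), 0 < ε → ∀ (u : ℝ → E d → E n), IsSolution W Ω T ε g u →
        (∀ t ∈ Ioo 0 T, IntegrableOn (energyDensity W φ D ε u t) Ω) ∧
        (∀ a b, 0 < a → a ≤ b → b < T →
          AbsolutelyContinuousOnInterval (modulatedEnergy W φ D Ω ε u) a b) ∧
        ∀ᵐ t ∂(volume.restrict (Ioo 0 T)),
          DifferentiableAt ℝ (modulatedEnergy W φ D Ω ε u) t ∧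
          IntegrableOn (fun x => ε ^ 2 * ‖timeD u t x‖ ^ 2 - ‖curvHeps W ε u t x‖ ^ 2) Ω ∧
          IntegrableOn (fun x =>
            ‖curvHeps W ε u t x - (ε * gradNorm (u t) x) • curvH η₀ D t x‖ ^ 2) Ω ∧
          IntegrableOn (fun x =>
            ‖ε • timeD u t x
              - divergence (xi δ₀ φ D t) x • genGradient W.dF u t x‖ ^ 2) Ω ∧
          deriv (modulatedEnergy W φ D Ω ε u) t
            + 1 / (2 * ε) *
                (∫ x in Ω, (ε ^ 2 * ‖timeD u t x‖ ^ 2 - ‖curvHeps W ε u t x‖ ^ 2))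
            + 1 / (2 * ε) *
                (∫ x in Ω,
                  ‖curvHeps W ε u t x - (ε * gradNorm (u t) x) • curvH η₀ D t x‖ ^ 2)
            + 1 / (2 * ε) *
                (∫ x in Ω,
                  ‖ε • timeD u t x - divergence (xi δ₀ φ D t) x • genGradient W.dF u t x‖ ^ 2)
          ≤ C * modulatedEnergy W φ D Ω ε u t := by
  -- Each interface is bounded, but a ball common to all times is not assumed. If there is none, no
  -- bounded `Ω` can contain all interfaces and the claim is vacuous. The split precedes the choice
  -- of `C`, which must not depend on `Ω`.
  by_cases hR : ∃ R, ∀ t ∈ Icc 0 T, frontier (D t) ⊆ Metric.closedBall 0 R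
  · obtain ⟨R, hR⟩ := hR
    obtain ⟨C, hC, hcal⟩ := hD.exists_isCalibration hT hδ₀ hφ hη₀ hR
    refine ⟨3 * d * C + 2 * C + 2 * C ^ 2, by positivity, ?_⟩
    intro Ω hΩ hb _ hηΩ n W g _ ε hε u hu
    have hIcc : ∀ t ∈ Ioo 0 T, t ∈ Icc 0 T := fun t ht => Ioo_subset_Icc_self ht
    have hξs : ∀ t ∈ Ioo 0 T, tsupport (xi δ₀ φ D t) ⊆ Ω := fun t ht =>
      (tsupport_xi_subset hδ₀ hφ hη₀ (hIcc t ht)).trans (hηΩ t (hIcc t ht))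
    have hHs : ∀ t ∈ Ioo 0 T, tsupport (curvH η₀ D t) ⊆ Ω := fun t ht =>
      (tsupport_curvH_subset t).trans (hηΩ t (hIcc t ht))
    refine ⟨fun t ht => ?_, ?_, ?_⟩
    · exact hu.integrableOn_relDensity hΩ hb hδ₀ ht
        (contDiff_slice (hcal.smooth) ht).continuous
    · exact (hu.relEnergy_evolution hΩ hb hδ₀ hε hcal.smooth hcal.compact hξs).1
    · exact hu.modulated_energy_inequality hΩ hb hδ₀ hε hcal hξs hHs
  · refine ⟨1, one_pos, ?_⟩
    intro Ω _ hb hin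
    obtain ⟨R, hR'⟩ := hb.subset_closedBall 0
    exact absurd ⟨R, fun t ht x hx => hR' (hin t ht x hx).1⟩ hR
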